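/- Let $t_i<t_f$ be real numbers and let $\omega,\hbar>0$. Write $\partial_\pm=\partial_t\pm i\omega$, $\langle f,g\rangle=\int_{t_i}^{t_f}f(t)g(t)\,dt$, $\sigma_\pm(t)=\sqrt{\hbar/2\omega}\;e^{\mp i\omega t}$ and $f_\pm=\langle f,\sigma_\mp\rangle$. Throughout, $I$, $J$, $I_1$, $I_2$ denote non-empty connected (relatively) open subsets of $[t_i,t_f]$. **Off-shell side.** Let $C^\infty_c(I)$ be the space of complex-valued smooth functions on $[t_i,t_f]$ (smooth up to the boundary) with compact support in $I$, and let $C^\infty_{cp}(I)=\{f\in C^\infty_c(I):\partial_-f(t_i)=\partial_+f(t_f)=0\}$. Let $\mathrm{Obs}^q(I)$ be the graded symmetric algebra (with product $\wedge$) on $C^\infty_{cp}(I)$ in degree $-1$ and $C^\infty_c(I)$ in degree $0$, with differential $\delta_{\rm BV}=d+\Delta$. Here $d$ is the derivation that extends $\partial_t^2+\omega^2:C^\infty_{cp}(I)\to C^\infty_c(I)$, and $\Delta$ is the second-order operator that vanishes on words of length at most one and on products of two letters of the same degree, and satisfies $\Delta(f\wedge g)=i\hbar\langle f,g\rangle$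 for $|f|=0$, $|g|=-1$. Put $\mathfrak F_{\rm QM}(I)=\mathrm{Obs}^q(I)$; its structure maps are the inclusions $m_I^J$ for $I\subseteq J$ and $m_{I_1,I_2}^J(F_1,F_2)=F_1\wedge F_2$ for disjoint $I_1,I_2\subseteq J$. **On-shell side.** Let $\mathrm{Weyl}=\mathbb C[a,a^\dagger]$, whose elements are read as normal ordered operators, with product $\mu=\wedge\circ\exp(\partial_a\otimes\partial_{a^\dagger})$, where $\wedge$ is the multiplication of polynomials. Let $\mathcal H=\mathbb C[a^\dagger]|0\rangle$ and $\mathcal H^*=\langle0|\mathbb C[a]$ be the ket and bra spaces with their usual actions of $\mathrm{Weyl}$ and the usual pairing. Let $\mathfrak F_{\rm H}$ assign $\mathrm{Weyl}$, $\mathcal H$, $\mathcal H^*$, $\mathbb C$ (in degree $0$, with zero differential) to the open subsets of the form $(a,b)$, $[t_i,a)$, $(b,t_f]$, $[t_i,t_f]$ respectively. Its inclusion maps are the identity between sets of the same form, and otherwise $\mathcal O\mapsto\mathcal O|0\rangle$, $\mathcal O\mapsto\langle0|\mathcal O$, $\mathcal O\mapsto\langle0|\mathcal O|0\rangle$, $|\psi\rangle\mapsto\langle0|\psi\rangle$,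 $\langle\psi|\mapsto\langle\psi|0\rangle$. For disjoint $I_1,I_2\subseteq J$ with $I_1$ earlier than $I_2$, its product is $(\mathcal O_1,\mathcal O_2)\mapsto\mu(\mathcal O_2,\mathcal O_1)$, $(|\psi\rangle,\mathcal O)\mapsto\mathcal O|\psi\rangle$, $(\mathcal O,\langle\psi|)\mapsto\langle\psi|\mathcal O$ or $(|\psi\rangle,\langle\psi'|)\mapsto\langle\psi'|\psi\rangle$, followed by the inclusion map into $\mathfrak F_{\rm H}(J)$; if $I_2$ is earlier than $I_1$, then $m_{I_1,I_2}^J(x,y)=m_{I_2,I_1}^J(y,x)$. **The maps.** Let $h(f)(t)=\frac{i}{2\omega}\int_{t_i}^{t_f}e^{-i\omega|t-s|}f(s)\,ds$. Let $C$ be the second-order operator on $\mathrm{Obs}^q(I)$ with $C(f_1\wedge f_2)=i\hbar\langle f_1,h(f_2)\rangle$ for $f_1,f_2$ of degree $0$ and with all other contractions zero. Let $\Pi_0:\mathrm{Obs}^q(I)\to\mathfrak F_{\rm H}(I)$ be the morphism for the commutative products (that is, for $\wedge$ and the multiplication of polynomials) that is $0$ on functions of degree $-1$ and sends $f$ of degree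 $0$ to $f_-a+f_+a^\dagger$, $f_+a^\dagger|0\rangle$, $f_-\langle0|a$, $0$ for $I=(a,b)$, $[t_i,a)$, $(b,t_f]$, $[t_i,t_f]$ respectively. Put $\Pi_I=\Pi_0\circ e^{-C}$. **Theorem.** Each $\mathrm{Obs}^q(I)$ is a BV algebra: a graded commutative algebra with a square-zero second-order differential of degree $1$. Both $\mathfrak F_{\rm QM}$ and $\mathfrak F_{\rm H}$ are prefactorization algebras of cochain complexes on $[t_i,t_f]$, defined on connected open subsets. The family $\Pi=(\Pi_I)_I$ is a morphism of prefactorization algebras $\mathfrak F_{\rm QM}\to\mathfrak F_{\rm H}$: each $\Pi_I$ is a chain map, and $\Pi$ commutes with all the structure maps $m_I^J$ and $m_{I_1,I_2}^J$. Every $\Pi_I$ is surjective, and $\Pi$ is a quasi-isomorphism, that is, every $\Pi_I$ induces an isomorphism on cohomology. -/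

import Mathlib

open scoped TensorProduct

noncomputable section

namespace OffShellQM

section Exponential

variable {V : Type} [AddCommGroup V] [Module ℂ V]

/-- The exponential `∑ n, Tⁿ / n!` of a locally nilpotent operator `T`. -/
def locExp (T : Module.End ℂ V) (hT : ∀ v, ∃ n, (T ^ n) v = 0) : Module.End ℂ V :=
  have key : ∀ v, (Function.support fun n : ℕ => ((n.factorial : ℂ)⁻¹) • (T ^ n) v).Finite := by
    intro v
    obtain ⟨n, hn⟩ := hT v
    refine (Set.finite_lt_nat n).subset fun m hm => ?_
    by_contra h
    refine hm ?_
    obtain ⟨k, rfl⟩ := Nat.exists_eq_add_of_le' (not_lt.mp h)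
    simp [pow_add, hn]
  { toFun := fun v => ∑ᶠ n : ℕ, ((n.factorial : ℂ)⁻¹) • (T ^ n) v
    map_add' := fun v w => by
      rw [← finsum_add_distrib (key v) (key w)]
      simp
    map_smul' := fun c v => by
      rw [RingHom.id_apply, smul_finsum' c (key v)]
      simp [smul_comm c] }

theorem neg_locNilp (T : Module.End ℂ V) (hT : ∀ v, ∃ n, (T ^ n) v = 0) (v : V) :
    ∃ n, ((-T) ^ n) v = 0 := by
  obtain ⟨n, hn⟩ := hT v
  exact ⟨n, by rw [neg_pow, Module.End.mul_apply, hn, map_zero]⟩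

/-- Local nilpotency is inherited by a tensor product of operators. -/
theorem locNilp_tensor {W : Type} [AddCommGroup W] [Module ℂ W]
    (A : Module.End ℂ V) (B : Module.End ℂ W)
    (h : (∀ v, ∃ n, (A ^ n) v = 0) ∨ ∀ w, ∃ n, (B ^ n) w = 0) (z : V ⊗[ℂ] W) :
    ∃ n, ((TensorProduct.map A B : Module.End ℂ (V ⊗[ℂ] W)) ^ n) z = 0 := by
  have hp : ∀ (n : ℕ) (x : V) (y : W),
      ((TensorProduct.map A B : Module.End ℂ (V ⊗[ℂ] W)) ^ n) (x ⊗ₜ y)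
        = (A ^ n) x ⊗ₜ (B ^ n) y := by
    intro n x y
    rw [TensorProduct.map_pow, TensorProduct.map_tmul]
  induction z with
  | zero => exact ⟨0, by simp⟩
  | tmul x y =>
    rcases h with h | h
    · obtain ⟨n, hn⟩ := h x
      exact ⟨n, by rw [hp, hn, TensorProduct.zero_tmul]⟩
    · obtain ⟨n, hn⟩ := h y
      exact ⟨n, by rw [hp, hn, TensorProduct.tmul_zero]⟩
  | add x y hx hy =>
    obtain ⟨n, hn⟩ := hx
    obtain ⟨m, hm⟩ := hy
    refine ⟨n + m, ?_⟩
    have h₁ : ((TensorProduct.map A B : Module.End ℂ (V ⊗[ℂ] W)) ^ (m + n)) x = 0 := by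
      rw [pow_add, Module.End.mul_apply, hn, map_zero]
    have h₂ : ((TensorProduct.map A B : Module.End ℂ (V ⊗[ℂ] W)) ^ (n + m)) y = 0 := by
      rw [pow_add, Module.End.mul_apply, hm, map_zero]
    rw [map_add, h₂, add_zero, add_comm n m, h₁]

end Exponential

section SymmetricAlgebra

variable {V : Type} [AddCommGroup V] [Module ℂ V]

/-- The universal derivation of a symmetric algebra,
`f₁ ⋯ fₙ ↦ ∑ i, (f₁ ⋯ f̂ᵢ ⋯ fₙ) ⊗ fᵢ`, as the nilpotent part of the algebra morphism
`f ↦ f + ε (1 ⊗ f)` into a square-zero extension. -/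
def symD : SymmetricAlgebra ℂ V →ₗ[ℂ] SymmetricAlgebra ℂ V ⊗[ℂ] V :=
  TrivSqZeroExt.sndHom (SymmetricAlgebra ℂ V) (SymmetricAlgebra ℂ V ⊗[ℂ] V) |>.restrictScalars ℂ
    |>.comp (SymmetricAlgebra.lift
      ((TrivSqZeroExt.inlAlgHom ℂ (SymmetricAlgebra ℂ V)
          (SymmetricAlgebra ℂ V ⊗[ℂ] V)).toLinearMap ∘ₗ SymmetricAlgebra.ι ℂ V +
        (TrivSqZeroExt.inrHom (SymmetricAlgebra ℂ V)
          (SymmetricAlgebra ℂ V ⊗[ℂ] V)).restrictScalars ℂ ∘ₗ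
          TensorProduct.mk ℂ (SymmetricAlgebra ℂ V) V 1)).toLinearMap

/-- The directional derivative along a functional `l`: the derivation
`f₁ ⋯ fₙ ↦ ∑ i, l(fᵢ) f₁ ⋯ f̂ᵢ ⋯ fₙ`. -/
def symDeriv : (V →ₗ[ℂ] ℂ) →ₗ[ℂ] Module.End ℂ (SymmetricAlgebra ℂ V) :=
  LinearMap.mk₂ ℂ
    (fun l s => TensorProduct.rid ℂ _ (LinearMap.lTensor (SymmetricAlgebra ℂ V) l (symD s)))
    (by intros; simp [LinearMap.lTensor_add]) (by intros; simp [LinearMap.lTensor_smul])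
    (by intros; simp) (by intros; simp)

/-- The second-order operator defined by a symmetric bilinear form `B`:
`f₁ ⋯ fₙ ↦ ∑ i < j, B(fᵢ, fⱼ) f₁ ⋯ f̂ᵢ ⋯ f̂ⱼ ⋯ fₙ`
(written as half of the sum over ordered pairs `i ≠ j`). -/
def symContract (B : V →ₗ[ℂ] V →ₗ[ℂ] ℂ) : Module.End ℂ (SymmetricAlgebra ℂ V) :=
  (2⁻¹ : ℂ) • TensorProduct.lift (symDeriv ∘ₗ B).flip ∘ₗ symD

theorem symD_ι (x : V) : symD (SymmetricAlgebra.ι ℂ V x) = 1 ⊗ₜ x := by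
  simp [symD]

theorem symD_algebraMap (r : ℂ) : symD (algebraMap ℂ (SymmetricAlgebra ℂ V) r) = 0 := by
  simp [symD, TrivSqZeroExt.algebraMap_eq_inl']

theorem symD_mul (a b : SymmetricAlgebra ℂ V) : symD (a * b) = a • symD b + b • symD a := by
  have h : ∀ s : SymmetricAlgebra ℂ V, ((SymmetricAlgebra.lift
      ((TrivSqZeroExt.inlAlgHom ℂ (SymmetricAlgebra ℂ V)
          (SymmetricAlgebra ℂ V ⊗[ℂ] V)).toLinearMap ∘ₗ SymmetricAlgebra.ι ℂ V +
        (TrivSqZeroExt.inrHom (SymmetricAlgebra ℂ V)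
          (SymmetricAlgebra ℂ V ⊗[ℂ] V)).restrictScalars ℂ ∘ₗ
          TensorProduct.mk ℂ (SymmetricAlgebra ℂ V) V 1)) s).fst = s := by
    intro s
    induction s using SymmetricAlgebra.induction with
    | algebraMap r => simp [TrivSqZeroExt.algebraMap_eq_inl']
    | ι x => simp
    | mul a b ha hb => simp [ha, hb]
    | add a b ha hb => simp [ha, hb]
  simp [symD, h]

/-- The words of length at most `n` in a symmetric algebra. -/
def symFil (V : Type) [AddCommGroup V] [Module ℂ V] (n : ℕ) :
    Submodule ℂ (SymmetricAlgebra ℂ V) :=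
  (1 ⊔ LinearMap.range (SymmetricAlgebra.ι ℂ V)) ^ n

theorem symFil_mono : Monotone (symFil V) := fun _ _ h =>
  pow_le_pow_right₀ le_sup_left h

theorem exists_mem_symFil (s : SymmetricAlgebra ℂ V) : ∃ n, s ∈ symFil V n := by
  induction s using SymmetricAlgebra.induction with
  | algebraMap r => exact ⟨0, by simp [symFil]⟩
  | ι x => exact ⟨1, by simpa [symFil] using Submodule.mem_sup_right (LinearMap.mem_range_self _ x)⟩
  | mul a b ha hb =>
    obtain ⟨n, hn⟩ := ha
    obtain ⟨m, hm⟩ := hb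
    exact ⟨n + m, by rw [symFil, pow_add]; exact Submodule.mul_mem_mul hn hm⟩
  | add a b ha hb =>
    obtain ⟨n, hn⟩ := ha
    obtain ⟨m, hm⟩ := hb
    exact ⟨max n m, add_mem (symFil_mono (le_max_left _ _) hn) (symFil_mono (le_max_right _ _) hm)⟩

theorem symD_mem (n : ℕ) : ∀ s ∈ symFil V (n + 1),
    symD s ∈ Submodule.map₂ (TensorProduct.mk ℂ (SymmetricAlgebra ℂ V) V) (symFil V n) ⊤ := by
  induction n with
  | zero =>
    intro s hs
    rw [symFil, zero_add, pow_one] at hs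
    obtain ⟨a, ha, b, ⟨x, rfl⟩, rfl⟩ := Submodule.mem_sup.mp hs
    obtain ⟨r, rfl⟩ := Submodule.mem_one.mp ha
    rw [map_add, symD_algebraMap, symD_ι, zero_add]
    exact Submodule.apply_mem_map₂ _ (by simp [symFil]) trivial
  | succ n ih =>
    intro s hs
    rw [symFil, pow_succ] at hs
    induction hs using Submodule.mul_induction_on' with
    | mem_mul_mem t ht y hy =>
      obtain ⟨a, ha, b, ⟨x, rfl⟩, rfl⟩ := Submodule.mem_sup.mp hy
      obtain ⟨r, rfl⟩ := Submodule.mem_one.mp ha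
      have hsm : ∀ z ∈ Submodule.map₂ (TensorProduct.mk ℂ (SymmetricAlgebra ℂ V) V)
          (symFil V n) ⊤, ∀ c ∈ symFil V 1,
          c • z ∈ Submodule.map₂ (TensorProduct.mk ℂ (SymmetricAlgebra ℂ V) V)
            (symFil V (n + 1)) ⊤ := by
        intro z hz c hc
        have key : z ∈ Submodule.comap (LinearMap.restrictScalars ℂ
            (LinearMap.lsmul (SymmetricAlgebra ℂ V) (SymmetricAlgebra ℂ V ⊗[ℂ] V) c))
              (Submodule.map₂ (TensorProduct.mk ℂ (SymmetricAlgebra ℂ V) V)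
                (symFil V (n + 1)) ⊤) := by
          refine (Submodule.map₂_le (R := ℂ)).mpr (fun p hp v _ => ?_) hz
          change c • (p ⊗ₜ[ℂ] v) ∈ Submodule.map₂ (TensorProduct.mk ℂ (SymmetricAlgebra ℂ V) V)
            (symFil V (n + 1)) ⊤
          rw [TensorProduct.smul_tmul']
          refine Submodule.apply_mem_map₂ _ ?_ trivial
          rw [smul_eq_mul, mul_comm, symFil, pow_succ]
          exact Submodule.mul_mem_mul hp (by simpa [symFil] using hc)
        exact key
      rw [symD_mul]
      refine add_mem ?_ (hsm _ (ih t ht) _ (by simpa [symFil] using hy))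
      rw [map_add, symD_algebraMap, symD_ι, zero_add, TensorProduct.smul_tmul', smul_eq_mul,
        mul_one]
      exact Submodule.apply_mem_map₂ _ ht trivial
    | add z hz w hw h₁ h₂ => rw [map_add]; exact add_mem h₁ h₂

theorem symDeriv_mem (l : V →ₗ[ℂ] ℂ) (n : ℕ) (s : SymmetricAlgebra ℂ V) (hs : s ∈ symFil V n) :
    symDeriv l s ∈ symFil V n := by
  have h := symD_mem n s (symFil_mono n.le_succ hs)
  refine (Submodule.map₂_le (r := Submodule.comap ((TensorProduct.rid ℂ _).toLinearMap ∘ₗ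
    LinearMap.lTensor (SymmetricAlgebra ℂ V) l) _)).mpr (fun p hp v _ => ?_) h
  simpa using Submodule.smul_mem _ _ hp

theorem symContract_locNilp (B : V →ₗ[ℂ] V →ₗ[ℂ] ℂ) (s : SymmetricAlgebra ℂ V) :
    ∃ n, ((symContract B) ^ n) s = 0 := by
  obtain ⟨n, hn⟩ := exists_mem_symFil s
  refine ⟨n + 1, ?_⟩
  induction n generalizing s with
  | zero =>
    obtain ⟨r, rfl⟩ := Submodule.mem_one.mp (by simpa [symFil] using hn)
    simp [symContract, symD_algebraMap]
  | succ n ih =>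
    rw [pow_succ, Module.End.mul_apply]
    refine ih _ ?_
    have h := symD_mem n s hn
    change (2⁻¹ : ℂ) • TensorProduct.lift (symDeriv ∘ₗ B).flip (symD s) ∈ _
    refine Submodule.smul_mem _ _ ?_
    refine (Submodule.map₂_le (r := Submodule.comap
      (TensorProduct.lift (symDeriv ∘ₗ B).flip) _)).mpr (fun p hp v _ => ?_) h
    simpa using symDeriv_mem _ _ _ hp

end SymmetricAlgebra

section GradedSymmetric

variable {E V : Type} [AddCommGroup E] [Module ℂ E] [AddCommGroup V] [Module ℂ V]

variable (E V) in
/-- The (graded) symmetric algebra of the graded vector space with `E` in degree `-1` and `V` in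
degree `0`: letters from `E` anticommute, letters from `V` are central. -/
abbrev GSym : Type := ExteriorAlgebra ℂ E ⊗[ℂ] SymmetricAlgebra ℂ V

variable (E V) in
/-- The homogeneous elements of degree `n`: for `n = -p ≤ 0` the words with `p` letters
from `E`. -/
def GSym.grading (n : ℤ) : Submodule ℂ (GSym E V) :=
  if n ≤ 0 then
    LinearMap.range (LinearMap.rTensor (SymmetricAlgebra ℂ V) (⋀[ℂ]^((-n).toNat) E).subtype)
  else ⊥

/-- The step of the recursion for `GSym.koszul`. -/
def koszulStep (φ : E →ₗ[ℂ] Module.End ℂ (SymmetricAlgebra ℂ V)) :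
    E →ₗ[ℂ] ExteriorAlgebra ℂ E × (SymmetricAlgebra ℂ V →ₗ[ℂ] GSym E V) →ₗ[ℂ]
      (SymmetricAlgebra ℂ V →ₗ[ℂ] GSym E V) :=
  LinearMap.mk₂ ℂ
    (fun g p => TensorProduct.mk ℂ _ _ p.1 ∘ₗ φ g
      - LinearMap.mulLeft ℂ (ExteriorAlgebra.ι ℂ g ⊗ₜ[ℂ] (1 : SymmetricAlgebra ℂ V)) ∘ₗ p.2)
    (by intros; ext; simp [TensorProduct.add_tmul, TensorProduct.tmul_add, add_mul]; abel)
    (by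
      intros
      ext
      simp [smul_sub]
      rw [← TensorProduct.smul_tmul', smul_mul_assoc])
    (by intros; ext; simp [mul_add]; abel)
    (by intros; ext; simp [TensorProduct.smul_tmul', smul_sub])

/-- For a linear map `φ` from the odd letters to operators on the words in the even letters,
`g₁ ∧ ⋯ ∧ gₚ ⊗ s ↦ ∑ i, (-1)^(i-1) (g₁ ∧ ⋯ ĝᵢ ⋯ ∧ gₚ) ⊗ φ(gᵢ) s`.
It is built from the recursion `g ∧ x ⊗ s ↦ x ⊗ φ(g) s - g ∧ koszul φ (x ⊗ s)`. -/
def GSym.koszul (φ : E →ₗ[ℂ] Module.End ℂ (SymmetricAlgebra ℂ V)) :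
    GSym E V →ₗ[ℂ] GSym E V :=
  TensorProduct.lift <| CliffordAlgebra.foldr'
    (N := SymmetricAlgebra ℂ V →ₗ[ℂ] GSym E V) (0 : QuadraticForm ℂ E) (koszulStep φ)
    (by
      intro g x T
      ext s
      have h : ExteriorAlgebra.ι ℂ g * ExteriorAlgebra.ι ℂ g = 0 := ExteriorAlgebra.ι_sq_zero g
      have h' : ExteriorAlgebra.ι ℂ g ⊗ₜ[ℂ] (1 : SymmetricAlgebra ℂ V) *
          (ExteriorAlgebra.ι ℂ g ⊗ₜ[ℂ] (1 : SymmetricAlgebra ℂ V) * T s) = 0 := by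
        rw [← mul_assoc, Algebra.TensorProduct.tmul_mul_tmul, h, TensorProduct.zero_tmul, zero_mul]
      simp only [koszulStep, LinearMap.mk₂_apply, LinearMap.sub_apply, LinearMap.comp_apply,
        TensorProduct.mk_apply, LinearMap.mulLeft_apply, mul_sub,
        Algebra.TensorProduct.tmul_mul_tmul, one_mul, h', zero_apply, zero_smul,
        LinearMap.zero_apply, sub_zero]
      exact sub_self _)
    0

/-- Functoriality of the graded symmetric algebra. -/
def GSym.map {E' V' : Type} [AddCommGroup E'] [Module ℂ E'] [AddCommGroup V'] [Module ℂ V']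
    (f : E →ₗ[ℂ] E') (g : V →ₗ[ℂ] V') : GSym E V →ₐ[ℂ] GSym E' V' :=
  Algebra.TensorProduct.map (ExteriorAlgebra.map f)
    (SymmetricAlgebra.lift (SymmetricAlgebra.ι ℂ V' ∘ₗ g))

/-- The algebra morphism that kills the letters from `E` and is `π` on the letters from `V`. -/
def GSym.proj {A : Type} [CommRing A] [Algebra ℂ A] (π : V →ₗ[ℂ] A) : GSym E V →ₐ[ℂ] A :=
  Algebra.TensorProduct.lift ((Algebra.ofId ℂ A).comp ExteriorAlgebra.algebraMapInv)
    (SymmetricAlgebra.lift π) fun _ _ => Commute.all _ _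

end GradedSymmetric

/-! ### Batalin-Vilkovisky algebras and prefactorization algebras -/

/-- A BV algebra: a graded commutative algebra with a differential `δ` of degree `1` which is a
second-order operator. -/
structure IsBVAlgebra {A : Type} [Ring A] [Algebra ℂ A] (gr : ℤ → Submodule ℂ A)
    (δ : A →ₗ[ℂ] A) : Prop where
  decomposition : DirectSum.IsInternal gr
  one_mem : (1 : A) ∈ gr 0
  mul_mem : ∀ p q : ℤ, ∀ x ∈ gr p, ∀ y ∈ gr q, x * y ∈ gr (p + q)
  graded_comm : ∀ p q : ℤ, ∀ x ∈ gr p, ∀ y ∈ gr q, x * y = ((-1 : ℂ) ^ (p * q)) • (y * x)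
  degree_one : ∀ p : ℤ, ∀ x ∈ gr p, δ x ∈ gr (p + 1)
  square_zero : ∀ x, δ (δ x) = 0
  second_order : ∀ p q : ℤ, ∀ x ∈ gr p, ∀ y ∈ gr q, ∀ z,
    δ (x * y * z) = δ (x * y) * z + ((-1 : ℂ) ^ p) • (x * δ (y * z))
      + ((-1 : ℂ) ^ ((p + 1) * q)) • (y * δ (x * z)) - δ x * y * z
      - ((-1 : ℂ) ^ p) • (x * δ y * z) - ((-1 : ℂ) ^ (p + q)) • (x * y * δ z)

/-- The (nonempty) connected open subsets of a space. -/
abbrev ConnOpen (X : Type) [TopologicalSpace X] : Type :=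
  {U : TopologicalSpace.Opens X // IsConnected (U : Set X)}

/-- The underlying set of a connected open subset. -/
abbrev ConnOpen.set {X : Type} [TopologicalSpace X] (U : ConnOpen X) : Set X := (U.1 : Set X)

/-- The data of a prefactorization algebra on `X` with values in complexes of complex vector
spaces: a graded vector space `obj U` with an endomorphism `d U` for each connected open `U`, the
maps `m_U^V` (`incl`) and the bilinear maps `m_{U₁,U₂}^V` (`prod`). The axioms are
`PrefactorizationData.IsPrefactorizationAlgebra`. -/
structure PrefactorizationData (X : Type) [TopologicalSpace X] where
  obj : ConnOpen X → Type
  [addCommGroup : ∀ U, AddCommGroup (obj U)]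
  [module : ∀ U, Module ℂ (obj U)]
  gr : ∀ U, ℤ → Submodule ℂ (obj U)
  d : ∀ U, obj U →ₗ[ℂ] obj U
  incl : ∀ U V : ConnOpen X, U.set ⊆ V.set → (obj U →ₗ[ℂ] obj V)
  prod : ∀ U₁ U₂ V : ConnOpen X, Disjoint U₁.set U₂.set → U₁.set ⊆ V.set → U₂.set ⊆ V.set →
    (obj U₁ →ₗ[ℂ] obj U₂ →ₗ[ℂ] obj V)

attribute [instance] PrefactorizationData.addCommGroup PrefactorizationData.module

namespace PrefactorizationData

variable {X : Type} [TopologicalSpace X]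

/-- The axioms of a prefactorization algebra with values in cochain complexes. -/
structure IsPrefactorizationAlgebra (F : PrefactorizationData X) : Prop where
  /-- Each `obj U` is a cochain complex. -/
  decomposition : ∀ U, DirectSum.IsInternal (F.gr U)
  d_degree : ∀ U, ∀ p : ℤ, ∀ x ∈ F.gr U p, F.d U x ∈ F.gr U (p + 1)
  d_d : ∀ U x, F.d U (F.d U x) = 0
  /-- The maps `m_U^V` are chain maps of degree `0`. -/
  incl_degree : ∀ U V h, ∀ p : ℤ, ∀ x ∈ F.gr U p, F.incl U V h x ∈ F.gr V p
  incl_d : ∀ U V h x, F.d V (F.incl U V h x) = F.incl U V h (F.d U x)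
  /-- The maps `m_{U₁,U₂}^V` are chain maps of degree `0` from the tensor product of complexes. -/
  prod_degree : ∀ U₁ U₂ V h h₁ h₂, ∀ p q : ℤ, ∀ x ∈ F.gr U₁ p, ∀ y ∈ F.gr U₂ q,
    F.prod U₁ U₂ V h h₁ h₂ x y ∈ F.gr V (p + q)
  prod_d : ∀ U₁ U₂ V h h₁ h₂, ∀ p : ℤ, ∀ x ∈ F.gr U₁ p, ∀ y,
    F.d V (F.prod U₁ U₂ V h h₁ h₂ x y) =
      F.prod U₁ U₂ V h h₁ h₂ (F.d U₁ x) y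
        + ((-1 : ℂ) ^ p) • F.prod U₁ U₂ V h h₁ h₂ x (F.d U₂ y)
  /-- Compatibility of the inclusion maps. -/
  incl_id : ∀ U x, F.incl U U subset_rfl x = x
  incl_incl : ∀ U V W (h : U.set ⊆ V.set) (h' : V.set ⊆ W.set) x,
    F.incl V W h' (F.incl U V h x) = F.incl U W (h.trans h') x
  /-- Compatibility of inclusions and products. -/
  incl_prod : ∀ U₁ U₂ V W (h : Disjoint U₁.set U₂.set) (h₁ : U₁.set ⊆ V.set)
    (h₂ : U₂.set ⊆ V.set) (h' : V.set ⊆ W.set) x y,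
    F.incl V W h' (F.prod U₁ U₂ V h h₁ h₂ x y) =
      F.prod U₁ U₂ W h (h₁.trans h') (h₂.trans h') x y
  prod_incl : ∀ U₁ U₂ V₁ V₂ W (h : Disjoint V₁.set V₂.set) (h₁ : U₁.set ⊆ V₁.set)
    (h₂ : U₂.set ⊆ V₂.set) (k₁ : V₁.set ⊆ W.set) (k₂ : V₂.set ⊆ W.set) x y,
    F.prod V₁ V₂ W h k₁ k₂ (F.incl U₁ V₁ h₁ x) (F.incl U₂ V₂ h₂ y) =
      F.prod U₁ U₂ W (h.mono h₁ h₂) (h₁.trans k₁) (h₂.trans k₂) x y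
  /-- Associativity. -/
  assoc : ∀ U₁ U₂ U₃ V₁ V₂ W (h₁₂ : Disjoint U₁.set U₂.set) (h₂₃ : Disjoint U₂.set U₃.set)
    (_ : Disjoint U₁.set U₃.set)
    (k₁ : Disjoint V₁.set U₃.set) (k₂ : Disjoint U₁.set V₂.set)
    (a₁ : U₁.set ⊆ V₁.set) (a₂ : U₂.set ⊆ V₁.set) (b₂ : U₂.set ⊆ V₂.set) (b₃ : U₃.set ⊆ V₂.set)
    (c₁ : V₁.set ⊆ W.set) (c₂ : V₂.set ⊆ W.set) x y z,
    F.prod V₁ U₃ W k₁ c₁ (b₃.trans c₂) (F.prod U₁ U₂ V₁ h₁₂ a₁ a₂ x y) z =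
      F.prod U₁ V₂ W k₂ (a₁.trans c₁) c₂ x (F.prod U₂ U₃ V₂ h₂₃ b₂ b₃ y z)
  /-- Graded commutativity. -/
  comm : ∀ U₁ U₂ V (h : Disjoint U₁.set U₂.set) h₁ h₂, ∀ p q : ℤ, ∀ x ∈ F.gr U₁ p,
    ∀ y ∈ F.gr U₂ q, F.prod U₁ U₂ V h h₁ h₂ x y =
      ((-1 : ℂ) ^ (p * q)) • F.prod U₂ U₁ V h.symm h₂ h₁ y x

/-- A morphism of prefactorization algebras: a family of chain maps (of degree `0`) that commutes
with the structure maps. -/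
structure IsMorphism (F G : PrefactorizationData X) (R : ∀ U, F.obj U →ₗ[ℂ] G.obj U) : Prop where
  degree : ∀ U, ∀ p : ℤ, ∀ x ∈ F.gr U p, R U x ∈ G.gr U p
  chain : ∀ U x, R U (F.d U x) = G.d U (R U x)
  incl : ∀ U V h x, R V (F.incl U V h x) = G.incl U V h (R U x)
  prod : ∀ U₁ U₂ V h h₁ h₂ x y,
    R V (F.prod U₁ U₂ V h h₁ h₂ x y) = G.prod U₁ U₂ V h h₁ h₂ (R U₁ x) (R U₂ y)

/-- The condition that, for each `U`, the chain map `R U` induces a bijection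
`ker d / im d → ker d / im d` in every degree. -/
structure InducesIsoOnCohomology (F G : PrefactorizationData X)
    (R : ∀ U, F.obj U →ₗ[ℂ] G.obj U) : Prop where
  injective : ∀ U, ∀ p : ℤ, ∀ x ∈ F.gr U p, F.d U x = 0 →
    (∃ w ∈ G.gr U (p - 1), R U x = G.d U w) → ∃ v ∈ F.gr U (p - 1), x = F.d U v
  surjective : ∀ U, ∀ p : ℤ, ∀ z ∈ G.gr U p, G.d U z = 0 →
    ∃ x ∈ F.gr U p, F.d U x = 0 ∧ ∃ w ∈ G.gr U (p - 1), z = R U x + G.d U w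

/-- A quasi-isomorphism of prefactorization algebras. -/
def IsQuasiIsomorphism (F G : PrefactorizationData X) (R : ∀ U, F.obj U →ₗ[ℂ] G.obj U) : Prop :=
  IsMorphism F G R ∧ InducesIsoOnCohomology F G R

end PrefactorizationData

/-! ### The Weyl algebra and its Fock space -/

/-- The two generators: the annihilation operator `a` and the creation operator `adag`. -/
inductive Ladder : Type
  | a
  | adag

/-- The vector space `ℂ[a, a†]` underlying the Weyl algebra; polynomials are read as normal
ordered operators (creation operators on the left). -/
abbrev Weyl : Type := MvPolynomial Ladder ℂ

/-- The ket space `ℂ[a†]`: the polynomial `g` is the state `g(a†)|0⟩`. -/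
abbrev Ket : Type := Polynomial ℂ

/-- The bra space `ℂ[a]`: the polynomial `f` is the state `⟨0|f(a)`. -/
abbrev Bra : Type := Polynomial ℂ

/-- The partial derivatives `∂/∂a` and `∂/∂a†` as linear operators. -/
def weylD (i : Ladder) : Module.End ℂ Weyl :=
  ((MvPolynomial.pderiv i : Derivation ℂ Weyl Weyl) : Weyl →ₗ[ℂ] Weyl)

theorem weylD_locNilp (i : Ladder) (F : Weyl) : ∃ n, ((weylD i) ^ n) F = 0 := by
  set D : Module.End ℂ Weyl := weylD i with hD
  have hDa : ∀ x, D x = MvPolynomial.pderiv i x := fun _ => rfl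
  induction F using MvPolynomial.induction_on with
  | C r => exact ⟨1, by simp [hDa]⟩
  | add p q hp hq =>
    obtain ⟨n, hn⟩ := hp
    obtain ⟨m, hm⟩ := hq
    have h₁ : (D ^ (m + n)) p = 0 := by rw [pow_add, Module.End.mul_apply, hn, map_zero]
    have h₂ : (D ^ (n + m)) q = 0 := by rw [pow_add, Module.End.mul_apply, hm, map_zero]
    exact ⟨n + m, by rw [map_add, h₂, add_zero, add_comm n m, h₁]⟩
  | mul_X p j hp =>
    obtain ⟨n, hn⟩ := hp
    have key : ∀ k : ℕ, (D ^ (k + 1)) (p * MvPolynomial.X j) =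
        (D ^ (k + 1)) p * MvPolynomial.X j
          + (k + 1 : ℂ) • ((D ^ k) p * MvPolynomial.pderiv i (MvPolynomial.X j)) := by
      intro k
      have hc : ∃ c : ℂ, MvPolynomial.pderiv i (MvPolynomial.X j : Weyl) = MvPolynomial.C c := by
        classical
        by_cases h : i = j
        · subst h; exact ⟨1, by simp⟩
        · exact ⟨0, by rw [MvPolynomial.pderiv_X_of_ne (Ne.symm h)]; simp⟩
      obtain ⟨c, hc⟩ := hc
      rw [hc]
      have h₁ : ∀ q : Weyl, D (q * MvPolynomial.X j) = D q * MvPolynomial.X j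
          + q * MvPolynomial.C c := by
        intro q
        simp [hDa, Derivation.leibniz, hc]
        ring
      have h₂ : ∀ q : Weyl, D (q * MvPolynomial.C c) = D q * MvPolynomial.C c := by
        intro q
        simp [hDa, Derivation.leibniz]
        ring
      induction k with
      | zero => simp [h₁]
      | succ k ih =>
        have e : (D ^ (k + 1)) p = D ((D ^ k) p) := by rw [pow_succ', Module.End.mul_apply]
        rw [pow_succ' D (k + 1), Module.End.mul_apply, Module.End.mul_apply, ih, map_add, map_smul,
          h₁, h₂, ← e, Nat.cast_succ, add_smul (k + 1 : ℂ) 1, one_smul]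
        abel
    refine ⟨n + 1, ?_⟩
    rw [key, pow_succ', Module.End.mul_apply, hn]
    simp

/-- The operator `∂/∂a ⊗ ∂/∂a†` on `ℂ[a, a†] ⊗ ℂ[a, a†]`. -/
def wick : Module.End ℂ (Weyl ⊗[ℂ] Weyl) :=
  TensorProduct.map (weylD Ladder.a) (weylD Ladder.adag)

/-- The product `μ = ∧ ∘ exp (∂/∂a ⊗ ∂/∂a†)` of the Weyl algebra. -/
def weylMul : Weyl →ₗ[ℂ] Weyl →ₗ[ℂ] Weyl :=
  TensorProduct.curry (LinearMap.mul' ℂ Weyl ∘ₗ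
    locExp wick (locNilp_tensor _ _ (Or.inl (weylD_locNilp Ladder.a))))

/-- The action of a normal ordered operator on kets: `(a†)ᵐ aⁿ` acts on `g(a†)|0⟩` with `a`
acting as `d/da†` and `a†` as multiplication. -/
def ketAction : Weyl →ₗ[ℂ] Ket →ₗ[ℂ] Ket :=
  (MvPolynomial.basisMonomials Ladder ℂ).constr ℂ fun m =>
    LinearMap.mulLeft ℂ (Polynomial.X ^ m Ladder.adag) ∘ₗ
      (Polynomial.derivative : Module.End ℂ Ket) ^ m Ladder.a

/-- The action of a normal ordered operator on bras from the right: `⟨0|f(a)` is multiplied by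
`(a†)ᵐ aⁿ` with `a†` acting as `d/da` and then `a` as multiplication. -/
def braAction : Weyl →ₗ[ℂ] Bra →ₗ[ℂ] Bra :=
  (MvPolynomial.basisMonomials Ladder ℂ).constr ℂ fun m =>
    LinearMap.mulLeft ℂ (Polynomial.X ^ m Ladder.a) ∘ₗ
      (Polynomial.derivative : Module.End ℂ Bra) ^ m Ladder.adag

/-- The component `⟨0|ψ⟩` of a ket (or `⟨ψ|0⟩` of a bra) along the vacuum. -/
def vacuumPart : Polynomial ℂ →ₗ[ℂ] ℂ := Polynomial.lcoeff ℂ 0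

/-- The pairing `⟨ψ₁|ψ₂⟩ = ⟨0|f(a) g(a†)|0⟩` of `⟨ψ₁| = ⟨0|f(a)` and `|ψ₂⟩ = g(a†)|0⟩`: the vacuum
component of the ket obtained by acting with `f(a)` on `g(a†)|0⟩`. -/
def braKet : Bra →ₗ[ℂ] Ket →ₗ[ℂ] ℂ :=
  (ketAction ∘ₗ (Polynomial.aeval (MvPolynomial.X Ladder.a : Weyl)).toLinearMap).compr₂ vacuumPart

/-- The four kinds of connected open subsets of `[tᵢ, t_f]`: open intervals `(a, b)`, half-open
intervals `[tᵢ, a)` and `(b, t_f]`, and the whole interval. -/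
inductive Kind : Type
  | op
  | ket
  | bra
  | full

/-- The space that canonical quantum mechanics assigns to an interval of a given kind. -/
def HSpace : Kind → Type
  | .op => Weyl
  | .ket => Ket
  | .bra => Bra
  | .full => ℂ

instance instCommRingHSpace : ∀ k, CommRing (HSpace k)
  | .op => inferInstanceAs (CommRing Weyl)
  | .ket => inferInstanceAs (CommRing Ket)
  | .bra => inferInstanceAs (CommRing Bra)
  | .full => inferInstanceAs (CommRing ℂ)

instance instAlgebraHSpace : ∀ k, Algebra ℂ (HSpace k)
  | .op => inferInstanceAs (Algebra ℂ Weyl)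
  | .ket => inferInstanceAs (Algebra ℂ Ket)
  | .bra => inferInstanceAs (Algebra ℂ Bra)
  | .full => inferInstanceAs (Algebra ℂ ℂ)

/-- The inclusion maps of canonical quantum mechanics: identities, `O ↦ O|0⟩`, `O ↦ ⟨0|O`,
`O ↦ ⟨0|O|0⟩`, `|ψ⟩ ↦ ⟨0|ψ⟩`, `⟨ψ| ↦ ⟨ψ|0⟩`. The remaining pairs of kinds do not occur for an
inclusion of intervals. -/
def hIncl : ∀ k l : Kind, HSpace k →ₗ[ℂ] HSpace l
  | .op, .op => LinearMap.id
  | .ket, .ket => LinearMap.id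
  | .bra, .bra => LinearMap.id
  | .full, .full => LinearMap.id
  | .op, .ket => (ketAction.flip 1 : Weyl →ₗ[ℂ] Ket)
  | .op, .bra => (braAction.flip 1 : Weyl →ₗ[ℂ] Bra)
  | .op, .full => (vacuumPart ∘ₗ ketAction.flip 1 : Weyl →ₗ[ℂ] ℂ)
  | .ket, .full => (vacuumPart : Ket →ₗ[ℂ] ℂ)
  | .bra, .full => (vacuumPart : Bra →ₗ[ℂ] ℂ)
  | _, _ => 0

/-- The products of canonical quantum mechanics for an earlier interval of kind `k₁` and a later
one of kind `k₂`: the operator product `O₂ O₁`, the operator action `O₂|ψ₁⟩`, the operator action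
`⟨ψ₂|O₁` and the pairing `⟨ψ₂|ψ₁⟩`, followed by an inclusion map. The remaining pairs of kinds do
not occur for an earlier and a later interval. -/
def hProd : ∀ k₁ k₂ l : Kind, HSpace k₁ →ₗ[ℂ] HSpace k₂ →ₗ[ℂ] HSpace l
  | .op, .op, l => (weylMul.flip : Weyl →ₗ[ℂ] Weyl →ₗ[ℂ] HSpace .op).compr₂ (hIncl .op l)
  | .ket, .op, l => (ketAction.flip : Ket →ₗ[ℂ] Weyl →ₗ[ℂ] HSpace .ket).compr₂ (hIncl .ket l)
  | .op, .bra, l => (braAction : Weyl →ₗ[ℂ] Bra →ₗ[ℂ] HSpace .bra).compr₂ (hIncl .bra l)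
  | .ket, .bra, l => (braKet.flip : Ket →ₗ[ℂ] Bra →ₗ[ℂ] HSpace .full).compr₂ (hIncl .full l)
  | _, _, _ => 0

/-! ### The off-shell harmonic oscillator on a closed interval -/

/-- The parameters: the endpoints of `[tᵢ, t_f]`, the frequency and Planck's constant. -/
structure Oscillator where
  ti : ℝ
  tf : ℝ
  freq : ℝ
  hbar : ℝ
  ti_lt_tf : ti < tf
  freq_pos : 0 < freq
  hbar_pos : 0 < hbar

namespace Oscillator

variable (S : Oscillator)

/-- The interval `[tᵢ, t_f]` as a subset of the real line. -/
abbrev interval : Set ℝ := Set.Icc S.ti S.tf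

/-- The interval `[tᵢ, t_f]` as a topological space. -/
abbrev Space : Type := S.interval

/-- The initial time as a point of the space. -/
def initialPt : S.Space := ⟨S.ti, Set.left_mem_Icc.mpr S.ti_lt_tf.le⟩

/-- The final time as a point of the space. -/
def finalPt : S.Space := ⟨S.tf, Set.right_mem_Icc.mpr S.ti_lt_tf.le⟩

open Classical in
/-- The kind of a connected open subset of `[tᵢ, t_f]`, read off from the endpoints it contains. -/
def kind (U : ConnOpen S.Space) : Kind :=
  if S.initialPt ∈ U.set then (if S.finalPt ∈ U.set then .full else .ket)
  else (if S.finalPt ∈ U.set then .bra else .op)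

/-- The space `C^∞_c(U)` of smooth functions on `[tᵢ, t_f]` (up to the boundary) with compact
support in `U`. A function on `[tᵢ, t_f]` is represented by its extension by zero to the real
line. The support is automatically compact, being closed in `[tᵢ, t_f]`. -/
def smooth (U : ConnOpen S.Space) : Submodule ℂ (ℝ → ℂ) where
  carrier := {f | ContDiffOn ℝ ((⊤ : ℕ∞) : WithTop ℕ∞) f S.interval ∧
    tsupport f ⊆ Subtype.val '' U.set}
  add_mem' := fun {f g} hf hg => ⟨hf.1.add hg.1,
    (tsupport_add f g).trans (Set.union_subset hf.2 hg.2)⟩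
  zero_mem' := ⟨contDiffOn_const, by simp [tsupport]⟩
  smul_mem' := fun c f hf => ⟨hf.1.const_smul c,
    (tsupport_smul_subset_right (fun _ => c) f).trans hf.2⟩

/-- The (one-sided at the endpoints) time derivative of a function on `[tᵢ, t_f]`. -/
def ddt (f : ℝ → ℂ) (t : ℝ) : ℂ := derivWithin f S.interval t

variable {S} in
theorem smooth_diff {U : ConnOpen S.Space} {f : ℝ → ℂ} (hf : f ∈ S.smooth U) :
    DifferentiableOn ℝ f S.interval :=
  hf.1.differentiableOn (by simp)

theorem uniqueDiff : UniqueDiffOn ℝ S.interval := uniqueDiffOn_Icc S.ti_lt_tf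

variable {S} in
theorem ddt_contDiffOn {f : ℝ → ℂ} (hf : ContDiffOn ℝ ((⊤ : ℕ∞) : WithTop ℕ∞) f S.interval) :
    ContDiffOn ℝ ((⊤ : ℕ∞) : WithTop ℕ∞) (S.ddt f) S.interval :=
  hf.derivWithin S.uniqueDiff (by simp)

theorem ddt_add {f g : ℝ → ℂ} (hf : DifferentiableOn ℝ f S.interval)
    (hg : DifferentiableOn ℝ g S.interval) {t : ℝ} (ht : t ∈ S.interval) :
    S.ddt (f + g) t = S.ddt f t + S.ddt g t :=
  derivWithin_add (hf t ht) (hg t ht)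

theorem ddt_smul (c : ℂ) {f : ℝ → ℂ} (hf : DifferentiableOn ℝ f S.interval)
    {t : ℝ} (ht : t ∈ S.interval) : S.ddt (c • f) t = c * S.ddt f t :=
  derivWithin_const_smul c (hf t ht)

theorem ddt_congr {f g : ℝ → ℂ} (h : Set.EqOn f g S.interval) {t : ℝ} (ht : t ∈ S.interval) :
    S.ddt f t = S.ddt g t :=
  derivWithin_congr h (h ht)

/-- The space `C^∞_cp(U)` of the functions in `C^∞_c(U)` which satisfy the boundary conditions
`∂₋ f(tᵢ) = 0` and `∂₊ f(t_f) = 0`, where `∂± = d/dt ± i ω`. -/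
def smoothBdry (U : ConnOpen S.Space) : Submodule ℂ (ℝ → ℂ) where
  carrier := {f | f ∈ S.smooth U ∧ S.ddt f S.ti - Complex.I * S.freq * f S.ti = 0 ∧
    S.ddt f S.tf + Complex.I * S.freq * f S.tf = 0}
  add_mem' := by
    rintro f g ⟨hf, hf₁, hf₂⟩ ⟨hg, hg₁, hg₂⟩
    refine ⟨add_mem hf hg, ?_, ?_⟩
    · rw [S.ddt_add (smooth_diff hf) (smooth_diff hg) (Set.left_mem_Icc.mpr S.ti_lt_tf.le), Pi.add_apply]
      linear_combination hf₁ + hg₁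
    · rw [S.ddt_add (smooth_diff hf) (smooth_diff hg) (Set.right_mem_Icc.mpr S.ti_lt_tf.le), Pi.add_apply]
      linear_combination hf₂ + hg₂
  zero_mem' := ⟨zero_mem _, by simp [ddt], by simp [ddt]⟩
  smul_mem' := by
    rintro c f ⟨hf, hf₁, hf₂⟩
    refine ⟨Submodule.smul_mem _ c hf, ?_, ?_⟩
    · rw [S.ddt_smul c (smooth_diff hf) (Set.left_mem_Icc.mpr S.ti_lt_tf.le), Pi.smul_apply, smul_eq_mul]
      linear_combination c * hf₁
    · rw [S.ddt_smul c (smooth_diff hf) (Set.right_mem_Icc.mpr S.ti_lt_tf.le), Pi.smul_apply, smul_eq_mul]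
      linear_combination c * hf₂

/-- The operator `d²/dt² + ω²` on functions on `[tᵢ, t_f]`. -/
def oscOp (f : ℝ → ℂ) : ℝ → ℂ :=
  S.interval.indicator fun t => S.ddt (S.ddt f) t + (S.freq : ℂ) ^ 2 * f t

theorem tsupport_ddt_subset (f : ℝ → ℂ) : tsupport (S.ddt f) ⊆ tsupport f := by
  refine closure_minimal (fun t ht => ?_) isClosed_closure
  by_contra h
  refine ht ?_
  have h0 : f =ᶠ[nhds t] fun _ => 0 := notMem_tsupport_iff_eventuallyEq.mp h
  have := (h0.filter_mono (nhdsWithin_le_nhds (s := S.interval))).derivWithin_eq h0.self_of_nhds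
  simpa [ddt] using this

theorem oscOp_mem {U : ConnOpen S.Space} {f : ℝ → ℂ} (hf : f ∈ S.smooth U) :
    S.oscOp f ∈ S.smooth U := by
  refine ⟨?_, ?_⟩
  · refine ContDiffOn.congr (f := fun t => S.ddt (S.ddt f) t + (S.freq : ℂ) ^ 2 * f t) ?_
      fun t ht => Set.indicator_of_mem ht _
    exact (ddt_contDiffOn (ddt_contDiffOn hf.1)).add (contDiffOn_const.mul hf.1)
  · refine (closure_minimal (fun t ht => ?_) isClosed_closure : tsupport (S.oscOp f) ⊆
      tsupport f).trans hf.2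
    by_contra h
    refine ht ?_
    have h₁ : f t = 0 := image_eq_zero_of_notMem_tsupport h
    have h₂ : S.ddt (S.ddt f) t = 0 := image_eq_zero_of_notMem_tsupport fun h' =>
      h ((S.tsupport_ddt_subset f) ((S.tsupport_ddt_subset _) h'))
    simp [oscOp, Set.indicator_apply, h₁, h₂]

/-- The differential `d = d²/dt² + ω² : C^∞_cp(U) → C^∞_c(U)` of the complex of linear
observables; its source has degree `-1`, its target degree `0`. -/
def linDifferential (U : ConnOpen S.Space) : S.smoothBdry U →ₗ[ℂ] S.smooth U where
  toFun f := ⟨S.oscOp f, S.oscOp_mem f.2.1⟩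
  map_add' f g := by
    ext t
    by_cases ht : t ∈ S.interval
    · have hf := f.2.1
      have hg := g.2.1
      have e : Set.EqOn (S.ddt (f + g : ℝ → ℂ)) (S.ddt f + S.ddt g) S.interval := fun s hs =>
        S.ddt_add (smooth_diff hf) (smooth_diff hg) hs
      simp only [oscOp, Submodule.coe_add, Set.indicator_of_mem ht, Pi.add_apply]
      rw [S.ddt_congr e ht, S.ddt_add ((ddt_contDiffOn hf.1).differentiableOn (by simp))
        ((ddt_contDiffOn hg.1).differentiableOn (by simp)) ht]
      ring
    · simp [oscOp, ht]
  map_smul' c f := by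
    ext t
    by_cases ht : t ∈ S.interval
    · have hf := f.2.1
      have e : Set.EqOn (S.ddt (c • f : ℝ → ℂ)) (c • S.ddt f) S.interval := fun s hs =>
        S.ddt_smul c (smooth_diff hf) hs
      simp only [oscOp, Submodule.coe_smul, Set.indicator_of_mem ht, Pi.smul_apply,
        RingHom.id_apply, smul_eq_mul]
      rw [S.ddt_congr e ht, S.ddt_smul c ((ddt_contDiffOn hf.1).differentiableOn (by simp)) ht]
      ring
    · simp [oscOp, ht]

/-- The pairing `⟨f, g⟩ = ∫ f g` over `[tᵢ, t_f]`. -/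
def pairing (f g : ℝ → ℂ) : ℂ := ∫ t in S.ti..S.tf, f t * g t

theorem integrable_mul {f g : ℝ → ℂ} (hf : ContinuousOn f S.interval)
    (hg : ContinuousOn g S.interval) :
    IntervalIntegrable (fun t => f t * g t) MeasureTheory.volume S.ti S.tf :=
  (hf.mul hg).intervalIntegrable_of_Icc S.ti_lt_tf.le

theorem pairing_add_left {f f' g : ℝ → ℂ} (hf : ContinuousOn f S.interval)
    (hf' : ContinuousOn f' S.interval) (hg : ContinuousOn g S.interval) :
    S.pairing (f + f') g = S.pairing f g + S.pairing f' g := by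
  simp only [pairing, Pi.add_apply, add_mul]
  exact intervalIntegral.integral_add (S.integrable_mul hf hg) (S.integrable_mul hf' hg)

theorem pairing_comm (f g : ℝ → ℂ) : S.pairing f g = S.pairing g f := by
  simp only [pairing, mul_comm]

theorem pairing_smul_left (c : ℂ) (f g : ℝ → ℂ) :
    S.pairing (c • f) g = c * S.pairing f g := by
  simp only [pairing, Pi.smul_apply, smul_eq_mul, mul_assoc]
  exact intervalIntegral.integral_const_mul _ _

variable {S} in
theorem smooth_cont {U : ConnOpen S.Space} {f : ℝ → ℂ} (hf : f ∈ S.smooth U) :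
    ContinuousOn f S.interval := hf.1.continuousOn

/-- The pairing of a function of degree `-1` and a function of degree `0`. -/
def pairingForm (U : ConnOpen S.Space) : S.smoothBdry U →ₗ[ℂ] S.smooth U →ₗ[ℂ] ℂ :=
  LinearMap.mk₂ ℂ (fun g f => S.pairing g f)
    (fun g g' f => S.pairing_add_left (smooth_cont g.2.1) (smooth_cont g'.2.1) (smooth_cont f.2))
    (fun c g f => S.pairing_smul_left c g f)
    (fun g f f' => by
      rw [S.pairing_comm, S.pairing_comm g f, S.pairing_comm g f']
      exact S.pairing_add_left (smooth_cont f.2) (smooth_cont f'.2) (smooth_cont g.2.1))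
    (fun c g f => by
      rw [S.pairing_comm, S.pairing_comm g f]
      exact S.pairing_smul_left c f g)

/-- The Feynman propagator `h(f)(t) = (i / 2ω) ∫ ds e^{-iω|t-s|} f(s)`. -/
def propagator (f : ℝ → ℂ) (t : ℝ) : ℂ :=
  Complex.I / (2 * S.freq) *
    ∫ s in S.ti..S.tf, Complex.exp (-(Complex.I * S.freq * (|t - s| : ℝ))) * f s

theorem kernel_cont (t : ℝ) :
    Continuous fun s : ℝ => Complex.exp (-(Complex.I * S.freq * (|t - s| : ℝ))) := by
  fun_prop

theorem propagator_cont {f : ℝ → ℂ} (hf : ContinuousOn f S.interval) :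
    Continuous (S.propagator f) := by
  refine continuous_const.mul ?_
  have hfi : IntervalIntegrable f MeasureTheory.volume S.ti S.tf :=
    hf.intervalIntegrable_of_Icc S.ti_lt_tf.le
  refine intervalIntegral.continuous_of_dominated_interval (bound := fun s => ‖f s‖) ?_ ?_
    hfi.norm ?_
  · intro t
    have := (S.integrable_mul (S.kernel_cont t).continuousOn hf).aestronglyMeasurable
    rwa [Set.uIoc_of_le S.ti_lt_tf.le]
  · intro t
    refine Filter.Eventually.of_forall fun s _ => ?_
    rw [norm_mul]
    refine mul_le_of_le_one_left (norm_nonneg _) (le_of_eq ?_)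
    rw [Complex.norm_exp]
    simp
  · refine Filter.Eventually.of_forall fun s _ => ?_
    fun_prop

theorem propagator_add {f g : ℝ → ℂ} (hf : ContinuousOn f S.interval)
    (hg : ContinuousOn g S.interval) :
    S.propagator (f + g) = S.propagator f + S.propagator g := by
  funext t
  simp only [propagator, Pi.add_apply, mul_add]
  rw [intervalIntegral.integral_add (S.integrable_mul (S.kernel_cont t).continuousOn hf)
    (S.integrable_mul (S.kernel_cont t).continuousOn hg), mul_add]

theorem propagator_smul (c : ℂ) (f : ℝ → ℂ) : S.propagator (c • f) = c • S.propagator f := by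
  funext t
  simp only [propagator, Pi.smul_apply, smul_eq_mul, mul_left_comm _ c]
  rw [intervalIntegral.integral_const_mul, mul_left_comm]

/-- The contraction `C(f₁ ∧ f₂) = Δ(f₁ ∧ h(f₂)) = iħ ⟨f₁, h(f₂)⟩` of functions of degree `0`. -/
def contraction (U : ConnOpen S.Space) : S.smooth U →ₗ[ℂ] S.smooth U →ₗ[ℂ] ℂ :=
  LinearMap.mk₂ ℂ (fun f g => Complex.I * S.hbar * S.pairing f (S.propagator g))
    (fun f f' g => by
      rw [Submodule.coe_add, S.pairing_add_left (smooth_cont f.2) (smooth_cont f'.2)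
        (S.propagator_cont (smooth_cont g.2)).continuousOn, mul_add])
    (fun c f g => by
      rw [Submodule.coe_smul, S.pairing_smul_left, smul_eq_mul, mul_left_comm])
    (fun f g g' => by
      rw [Submodule.coe_add, S.propagator_add (smooth_cont g.2) (smooth_cont g'.2),
        S.pairing_comm, S.pairing_add_left (S.propagator_cont (smooth_cont g.2)).continuousOn
        (S.propagator_cont (smooth_cont g'.2)).continuousOn (smooth_cont f.2), mul_add,
        S.pairing_comm f, S.pairing_comm f])
    (fun c f g => by
      rw [Submodule.coe_smul, S.propagator_smul, S.pairing_comm, S.pairing_smul_left,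
        S.pairing_comm f, smul_eq_mul, mul_left_comm])

/-- The observables on `U`: the graded symmetric algebra of the complex of linear observables. -/
abbrev Obs (U : ConnOpen S.Space) : Type := GSym (S.smoothBdry U) (S.smooth U)

/-- The grading of the observables. -/
def obsGrading (U : ConnOpen S.Space) : ℤ → Submodule ℂ (S.Obs U) :=
  GSym.grading (S.smoothBdry U) (S.smooth U)

/-- The differential `d` of the linear observables, extended as a derivation. -/
def classicalDifferential (U : ConnOpen S.Space) : S.Obs U →ₗ[ℂ] S.Obs U :=
  GSym.koszul (LinearMap.mul ℂ (SymmetricAlgebra ℂ (S.smooth U)) ∘ₗ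
    SymmetricAlgebra.ι ℂ (S.smooth U) ∘ₗ S.linDifferential U)

/-- The BV operator `Δ`: the second-order operator with `Δ(f ∧ g) = iħ ⟨f, g⟩` for `f` of degree
`0` and `g` of degree `-1`, all other contractions being zero. -/
def bvOperator (U : ConnOpen S.Space) : S.Obs U →ₗ[ℂ] S.Obs U :=
  GSym.koszul (symDeriv ∘ₗ ((Complex.I * S.hbar) • S.pairingForm U))

/-- The BV differential `d + Δ`. -/
def bvDifferential (U : ConnOpen S.Space) : S.Obs U →ₗ[ℂ] S.Obs U :=
  S.classicalDifferential U + S.bvOperator U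

/-- The operator `C`: the second-order operator that contracts pairs of functions of degree `0`. -/
def wickOperator (U : ConnOpen S.Space) : Module.End ℂ (S.Obs U) :=
  TensorProduct.map (1 : Module.End ℂ (ExteriorAlgebra ℂ (S.smoothBdry U)))
    (symContract (S.contraction U))

theorem neg_wickOperator_locNilp (U : ConnOpen S.Space) (x : S.Obs U) :
    ∃ n, ((-S.wickOperator U) ^ n) x = 0 :=
  neg_locNilp _ (locNilp_tensor (1 : Module.End ℂ (ExteriorAlgebra ℂ (S.smoothBdry U)))
    (symContract (S.contraction U)) (Or.inr (symContract_locNilp _))) x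

/-- The operator `e^{-C}`. -/
def expWick (U : ConnOpen S.Space) : Module.End ℂ (S.Obs U) :=
  locExp (-S.wickOperator U) (S.neg_wickOperator_locNilp U)

/-- The inclusion of `C^∞_c(U)` in `C^∞_c(V)`. -/
def smoothIncl {U V : ConnOpen S.Space} (h : U.set ⊆ V.set) : S.smooth U →ₗ[ℂ] S.smooth V :=
  Submodule.inclusion fun _ hf => ⟨hf.1, hf.2.trans (Set.image_mono h)⟩

/-- The inclusion of `C^∞_cp(U)` in `C^∞_cp(V)`. -/
def smoothBdryIncl {U V : ConnOpen S.Space} (h : U.set ⊆ V.set) :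
    S.smoothBdry U →ₗ[ℂ] S.smoothBdry V :=
  Submodule.inclusion fun _ hf => ⟨⟨hf.1.1, hf.1.2.trans (Set.image_mono h)⟩, hf.2⟩

/-- The inclusion of observables. -/
def obsIncl {U V : ConnOpen S.Space} (h : U.set ⊆ V.set) : S.Obs U →ₐ[ℂ] S.Obs V :=
  GSym.map (S.smoothBdryIncl h) (S.smoothIncl h)

/-- Off-shell quantum mechanics: the complexes of quantum observables, with the inclusions and the
wedge product as structure maps. -/
def offShell : PrefactorizationData S.Space where
  obj := S.Obs
  gr := S.obsGrading
  d := S.bvDifferential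
  incl _ _ h := (S.obsIncl h).toLinearMap
  prod _ _ V _ h₁ h₂ := (LinearMap.mul ℂ (S.Obs V)).compl₁₂
    (S.obsIncl h₁).toLinearMap (S.obsIncl h₂).toLinearMap

open Classical in
/-- Canonical quantum mechanics in the Heisenberg picture. It is concentrated in degree `0`; the
products depend on which of the two disjoint intervals is the earlier one. -/
def heisenberg : PrefactorizationData S.Space where
  obj U := HSpace (S.kind U)
  gr _ p := if p = 0 then ⊤ else ⊥
  d _ := 0
  incl U V _ := hIncl (S.kind U) (S.kind V)
  prod U₁ U₂ V _ _ _ :=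
    if ∀ t ∈ U₁.set, ∀ s ∈ U₂.set, t < s then hProd (S.kind U₁) (S.kind U₂) (S.kind V)
    else (hProd (S.kind U₂) (S.kind U₁) (S.kind V)).flip

/-- The solution `σ₊(t) = √(ħ / 2ω) e^{-iωt}`. -/
def sigmaPlus (t : ℝ) : ℂ :=
  (Real.sqrt (S.hbar / (2 * S.freq)) : ℂ) * Complex.exp (-(Complex.I * S.freq * t))

/-- The solution `σ₋(t) = √(ħ / 2ω) e^{iωt}`. -/
def sigmaMinus (t : ℝ) : ℂ :=
  (Real.sqrt (S.hbar / (2 * S.freq)) : ℂ) * Complex.exp (Complex.I * S.freq * t)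

/-- The functional `f ↦ ⟨f, σ⟩` for a continuous function `σ`. -/
def pairWith (U : ConnOpen S.Space) (σ : ℝ → ℂ) (hσ : Continuous σ) : S.smooth U →ₗ[ℂ] ℂ where
  toFun f := S.pairing f σ
  map_add' f g := S.pairing_add_left (smooth_cont f.2) (smooth_cont g.2) hσ.continuousOn
  map_smul' c f := S.pairing_smul_left c f σ

/-- The functional `f₊ = ⟨f, σ₋⟩`. -/
def coeffPlus (U : ConnOpen S.Space) : S.smooth U →ₗ[ℂ] ℂ :=
  S.pairWith U S.sigmaMinus (by unfold sigmaMinus; fun_prop)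

/-- The functional `f₋ = ⟨f, σ₊⟩`. -/
def coeffMinus (U : ConnOpen S.Space) : S.smooth U →ₗ[ℂ] ℂ :=
  S.pairWith U S.sigmaPlus (by unfold sigmaPlus; fun_prop)

/-- The projection `Π₀` on linear observables of degree `0`: `f₋ a + f₊ a†`, `f₊ a†|0⟩`,
`f₋ ⟨0|a` or `0`, depending on the kind of the interval. -/
def linProj (U : ConnOpen S.Space) : ∀ k : Kind, S.smooth U →ₗ[ℂ] HSpace k
  | .op => ((S.coeffMinus U).smulRight (MvPolynomial.X Ladder.a) +
      (S.coeffPlus U).smulRight (MvPolynomial.X Ladder.adag) : S.smooth U →ₗ[ℂ] Weyl)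
  | .ket => ((S.coeffPlus U).smulRight Polynomial.X : S.smooth U →ₗ[ℂ] Ket)
  | .bra => ((S.coeffMinus U).smulRight Polynomial.X : S.smooth U →ₗ[ℂ] Bra)
  | .full => 0

/-- The projection `Π₀`, extended to all observables as an algebra morphism with respect to the
commutative product of polynomials; it is zero on functions of degree `-1`. -/
def classicalProj (U : ConnOpen S.Space) : S.Obs U →ₐ[ℂ] HSpace (S.kind U) :=
  GSym.proj (S.linProj U (S.kind U))

/-- The quantum projection `Π = Π₀ ∘ e^{-C}`. -/
def proj (U : ConnOpen S.Space) : S.Obs U →ₗ[ℂ] HSpace (S.kind U) :=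
  (S.classicalProj U).toLinearMap ∘ₗ S.expWick U

end Oscillator

end OffShellQM

end

/-! The boundary conditions make `d = ∂_t² + ω²` symmetric for the pairing, by Green's identity, and
injective, and the propagator `h` inverts it. Hence `C(dg ∧ f) = iħ⟨g, f⟩`, which is the contraction
in `Δ` (`contraction_linDifferential`). Commuting `e^{-C}` past the letter `dg` produces minus the
derivative along this functional, and that is exactly what `Δ` contributes with the opposite sign.
So `e^{-C}(d + Δ) = d e^{-C}` (`evenOp_symExp_bvDifferential`): up to an invertible change of
variables the quantum complex is the classical Koszul complex. As `Π₀` kills the image of `d`, each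
`Π_I` is a chain map.

Products are respected because the Feynman kernel factorizes at separated times. For `f` earlier
than `g` one has `C(f ∧ g) = -f₊ g₋` (`contraction_of_lt`). Contractions inside either interval are
already accounted for by its own `e^{-C}`, so the only new ones are the cross contractions, with
weight `+f₊ g₋`: this is the Wick contraction `∂_a ⊗ ∂_{a†}` of the operator product. Both sides are
compared by one recursion in the letters of the earlier interval, `symExp_ι_mul_mul` off shell and
`hProd_linProj_mul` on shell. The latter treats the operator product, the two actions and the
pairing of states together.

On letters, `Π₀` is onto: a solution switched on smoothly inside `I` gives a source in `C^∞_c(I)`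
whose pairings with `σ±` are Wronskians. Since `e^{-C}` is invertible, each `Π_I` is onto already in
degree `0`. The axioms of the on-shell prefactorization algebra therefore descend from those off
shell, which are formal apart from the Leibniz rule for `Δ` on products from disjoint intervals;
that rule holds because functions with disjoint supports pair to zero.

For the cohomology, the linear complex has injective `d`, and its image is the kernel of the linear
`Π₀`: outside the support of `f` the function `h(f)` is a multiple of `σ±` with coefficient `f∓`, so
it is supported in `I` when the required coefficients vanish (`exists_linDifferential_eq`). A linear
left inverse of `d` extends to a derivation of degree `-1`. Its anticommutator with `d` is
diagonalizable with eigenvalues in `ℕ`, and division by the positive eigenvalues gives primitives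
(`exists_eq_raise`). Conjugation by `e^{-C}` transports this to `d + Δ`. -/

noncomputable section

namespace OffShellQM

/-! ### Exponentials of locally nilpotent operators. -/

section Exponential

variable {V V' : Type} [AddCommGroup V] [Module ℂ V] [AddCommGroup V'] [Module ℂ V']

theorem locExp_eq_sum (T : Module.End ℂ V) (hT : ∀ v, ∃ n, (T ^ n) v = 0) {v : V} {N : ℕ}
    (h : (T ^ N) v = 0) :
    locExp T hT v = ∑ n ∈ Finset.range N, ((n.factorial : ℂ)⁻¹) • (T ^ n) v := by
  change ∑ᶠ n : ℕ, ((n.factorial : ℂ)⁻¹) • (T ^ n) v = _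
  refine finsum_eq_sum_of_support_subset _ fun n hn => ?_
  by_contra hc
  refine hn ?_
  obtain ⟨k, rfl⟩ := Nat.exists_eq_add_of_le' (not_lt.mp fun h' => hc (by simpa using h'))
  simp [pow_add, h]

theorem pow_apply_eq_zero_of_le {T : Module.End ℂ V} {v : V} {m n : ℕ} (hmn : m ≤ n)
    (h : (T ^ m) v = 0) : (T ^ n) v = 0 := by
  obtain ⟨k, rfl⟩ := Nat.exists_eq_add_of_le' hmn
  simp [pow_add, h]

theorem locExp_of_apply_eq_zero (T : Module.End ℂ V) (hT : ∀ v, ∃ n, (T ^ n) v = 0) {v : V}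
    (h : T v = 0) : locExp T hT v = v := by
  rw [locExp_eq_sum T hT (N := 1) (by simpa using h)]
  simp

/-- If `[T, A] = B` commutes with `T`, then `e^T A = (A + B) e^T`. -/
theorem locExp_intertwine (T : Module.End ℂ V) (T' : Module.End ℂ V')
    (hT : ∀ v, ∃ n, (T ^ n) v = 0) (hT' : ∀ v, ∃ n, (T' ^ n) v = 0) (A B : V →ₗ[ℂ] V')
    (hA : ∀ v, T' (A v) = A (T v) + B v) (hB : ∀ v, T' (B v) = B (T v)) (v : V) :
    locExp T' hT' (A v) = A (locExp T hT v) + B (locExp T hT v) := by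
  obtain ⟨n, hn⟩ := hT v
  obtain ⟨m, hm⟩ := hT' (A v)
  have hBn : ∀ (k : ℕ) (w : V), (T' ^ k) (B w) = B ((T ^ k) w) := by
    intro k
    induction k with
    | zero => simp
    | succ k ih => intro w; rw [pow_succ, Module.End.mul_apply, hB, ih, pow_succ, Module.End.mul_apply]
  -- Each of the `k + 1` factors can be the one that is commuted past `A`, and all these terms agree
  -- because `B` intertwines `T` and `T'`.
  have hAn : ∀ (k : ℕ) (w : V), (T' ^ (k + 1)) (A w)
      = A ((T ^ (k + 1)) w) + ((k : ℂ) + 1) • B ((T ^ k) w) := by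
    intro k
    induction k with
    | zero => intro w; simp [hA]
    | succ k ih =>
      intro w
      rw [pow_succ, Module.End.mul_apply, hA, map_add, ih, hBn]
      have e : ∀ j : ℕ, (T ^ (j + 1)) w = (T ^ j) (T w) := fun j => by
        rw [pow_succ, Module.End.mul_apply]
      rw [e (k + 1), e k, Nat.cast_succ, add_smul ((k : ℂ) + 1), one_smul, add_assoc]
  -- The series with `B` is shifted by one degree, so it is truncated one term earlier than the two
  -- series with `A`.
  have h₁ : (T' ^ (max n m + 1)) (A v) = 0 :=
    pow_apply_eq_zero_of_le ((le_max_right n m).trans (Nat.le_succ _)) hm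
  have h₂ : (T ^ (max n m)) v = 0 := pow_apply_eq_zero_of_le (le_max_left n m) hn
  have h₃ : (T ^ (max n m + 1)) v = 0 := pow_apply_eq_zero_of_le (Nat.le_succ _) h₂
  rw [locExp_eq_sum T' hT' h₁]
  nth_rewrite 1 [locExp_eq_sum T hT h₃]
  rw [locExp_eq_sum T hT h₂, Finset.sum_range_succ', Finset.sum_range_succ']
  simp only [hAn, map_add, map_sum, map_smul, smul_add, Finset.sum_add_distrib, pow_zero,
    Module.End.one_apply, Nat.factorial_zero, Nat.cast_one, inv_one, one_smul, smul_smul]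
  have hc : ∀ k : ℕ, ((k + 1).factorial : ℂ)⁻¹ * ((k : ℂ) + 1) = (k.factorial : ℂ)⁻¹ := by
    intro k
    have : (k : ℂ) + 1 ≠ 0 := Nat.cast_add_one_ne_zero k
    have : (k.factorial : ℂ) ≠ 0 := Nat.cast_ne_zero.mpr k.factorial_ne_zero
    rw [Nat.factorial_succ]
    push_cast
    field_simp
  simp only [hc]
  abel

theorem locExp_commute (T : Module.End ℂ V) (T' : Module.End ℂ V')
    (hT : ∀ v, ∃ n, (T ^ n) v = 0) (hT' : ∀ v, ∃ n, (T' ^ n) v = 0) (A : V →ₗ[ℂ] V')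
    (hA : ∀ v, T' (A v) = A (T v)) (v : V) :
    locExp T' hT' (A v) = A (locExp T hT v) := by
  have := locExp_intertwine T T' hT hT' A 0 (by simpa using hA) (by simp) v
  simpa using this

end Exponential

/-! ### Contractions of a symmetric algebra and their exponentials. -/

section SymmetricAlgebra

variable {V V' : Type} [AddCommGroup V] [Module ℂ V] [AddCommGroup V'] [Module ℂ V']

/-- Reduces identities between operators to their commutation rules with a single letter. The proof
strengthens `P s` to stability of `P` under multiplication by `s`, which passes to products. -/
theorem symInduction {P : SymmetricAlgebra ℂ V → Prop} (one : P 1)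
    (add : ∀ s t, P s → P t → P (s + t)) (smul : ∀ (c : ℂ) s, P s → P (c • s))
    (ι_mul : ∀ v s, P s → P (SymmetricAlgebra.ι ℂ V v * s)) (s : SymmetricAlgebra ℂ V) : P s := by
  have key : ∀ t, P t → P (s * t) := by
    induction s using SymmetricAlgebra.induction with
    | algebraMap r => intro t ht; rw [← Algebra.smul_def]; exact smul r t ht
    | ι x => exact fun t ht => ι_mul x t ht
    | mul a b ha hb => intro t ht; rw [mul_assoc]; exact ha _ (hb t ht)
    | add a b ha hb => intro t ht; rw [add_mul]; exact add _ _ (ha t ht) (hb t ht)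
  simpa using key 1 one

@[simp]
theorem symD_one : symD (1 : SymmetricAlgebra ℂ V) = 0 := by
  simpa using symD_algebraMap (V := V) 1

theorem symDeriv_mul (l : V →ₗ[ℂ] ℂ) (s t : SymmetricAlgebra ℂ V) :
    symDeriv l (s * t) = s * symDeriv l t + t * symDeriv l s := by
  have h : ∀ (s : SymmetricAlgebra ℂ V) (z : SymmetricAlgebra ℂ V ⊗[ℂ] V),
      TensorProduct.rid ℂ _ (LinearMap.lTensor (SymmetricAlgebra ℂ V) l (s • z))
        = s * TensorProduct.rid ℂ _ (LinearMap.lTensor (SymmetricAlgebra ℂ V) l z) := by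
    intro s z
    induction z with
    | zero => simp
    | tmul x y => simp [TensorProduct.smul_tmul']
    | add x y hx hy => simp only [smul_add, map_add, hx, hy, mul_add]
  change TensorProduct.rid ℂ _ (LinearMap.lTensor (SymmetricAlgebra ℂ V) l (symD (s * t))) = _
  rw [symD_mul, map_add, map_add, h, h]
  rfl

@[simp]
theorem symDeriv_ι (l : V →ₗ[ℂ] ℂ) (v : V) :
    symDeriv l (SymmetricAlgebra.ι ℂ V v) = algebraMap ℂ _ (l v) := by
  simp [symDeriv, symD_ι, Algebra.algebraMap_eq_smul_one]

@[simp]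
theorem symDeriv_one (l : V →ₗ[ℂ] ℂ) : symDeriv l (1 : SymmetricAlgebra ℂ V) = 0 := by
  simp [symDeriv]

theorem symDeriv_ι_mul (l : V →ₗ[ℂ] ℂ) (v : V) (s : SymmetricAlgebra ℂ V) :
    symDeriv l (SymmetricAlgebra.ι ℂ V v * s)
      = SymmetricAlgebra.ι ℂ V v * symDeriv l s + l v • s := by
  rw [symDeriv_mul, symDeriv_ι, ← Algebra.commutes, Algebra.smul_def]

theorem symDeriv_comm (l m : V →ₗ[ℂ] ℂ) (s : SymmetricAlgebra ℂ V) :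
    symDeriv l (symDeriv m s) = symDeriv m (symDeriv l s) := by
  induction s using symInduction with
  | one => simp
  | add s t hs ht => simp [hs, ht]
  | smul c s hs => simp [hs]
  | ι_mul v s hs => simp only [symDeriv_ι_mul, map_add, map_smul, hs]; abel

@[simp]
theorem symContract_one (B : V →ₗ[ℂ] V →ₗ[ℂ] ℂ) : symContract B 1 = 0 := by
  simp [symContract]

/-- Among the ordered pairs, `v` occurs once as the first and once as the second entry. By symmetry
of `B` the two contributions are equal, and the factor `1/2` leaves one derivative along `B v`. -/
theorem symContract_ι_mul (B : V →ₗ[ℂ] V →ₗ[ℂ] ℂ) (hB : ∀ x y, B x y = B y x) (v : V)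
    (s : SymmetricAlgebra ℂ V) :
    symContract B (SymmetricAlgebra.ι ℂ V v * s)
      = SymmetricAlgebra.ι ℂ V v * symContract B s + symDeriv (B v) s := by
  have h : ∀ z : SymmetricAlgebra ℂ V ⊗[ℂ] V,
      TensorProduct.lift (symDeriv ∘ₗ B).flip (SymmetricAlgebra.ι ℂ V v • z)
        = SymmetricAlgebra.ι ℂ V v * TensorProduct.lift (symDeriv ∘ₗ B).flip z
          + TensorProduct.rid ℂ _ (LinearMap.lTensor (SymmetricAlgebra ℂ V) (B v) z) := by
    intro z
    induction z with
    | zero => simp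
    | tmul x y => simp [TensorProduct.smul_tmul', symDeriv_ι_mul, hB y v]
    | add x y hx hy => simp only [smul_add, map_add, hx, hy, mul_add]; abel
  change (2⁻¹ : ℂ) • TensorProduct.lift (symDeriv ∘ₗ B).flip (symD _)
    = _ * ((2⁻¹ : ℂ) • TensorProduct.lift (symDeriv ∘ₗ B).flip (symD _)) + _
  rw [symD_mul, symD_ι, map_add, h, TensorProduct.smul_tmul', smul_eq_mul, mul_one,
    TensorProduct.lift.tmul]
  change (2⁻¹ : ℂ) • (_ * _ + symDeriv (B v) s + symDeriv (B v) s) = _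
  rw [add_assoc, smul_add, ← two_smul ℂ (symDeriv (B v) s), smul_smul, mul_smul_comm]
  simp

theorem symContract_symDeriv (B : V →ₗ[ℂ] V →ₗ[ℂ] ℂ) (hB : ∀ x y, B x y = B y x)
    (l : V →ₗ[ℂ] ℂ) (s : SymmetricAlgebra ℂ V) :
    symContract B (symDeriv l s) = symDeriv l (symContract B s) := by
  induction s using symInduction with
  | one => simp
  | add s t hs ht => simp [hs, ht]
  | smul c s hs => simp [hs]
  | ι_mul v s hs =>
    simp only [symDeriv_ι_mul, symContract_ι_mul B hB, map_add, map_smul, hs, symDeriv_comm l]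
    abel

/-- The exponential `e^{-C}` of a contraction of a symmetric algebra. -/
def symExp (B : V →ₗ[ℂ] V →ₗ[ℂ] ℂ) : Module.End ℂ (SymmetricAlgebra ℂ V) :=
  locExp (-symContract B) (neg_locNilp _ (symContract_locNilp B))

@[simp]
theorem symExp_one (B : V →ₗ[ℂ] V →ₗ[ℂ] ℂ) : symExp B 1 = 1 :=
  locExp_of_apply_eq_zero _ _ (by simp)

theorem symExp_symDeriv (B : V →ₗ[ℂ] V →ₗ[ℂ] ℂ) (hB : ∀ x y, B x y = B y x)
    (l : V →ₗ[ℂ] ℂ) (s : SymmetricAlgebra ℂ V) :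
    symExp B (symDeriv l s) = symDeriv l (symExp B s) :=
  locExp_commute _ _ _ _ (symDeriv l) (fun s => by simp [symContract_symDeriv B hB]) s

/-- The commutator of `-C` with multiplication by `v` is minus the derivative along `B v`, which
commutes with `C`; so `locExp_intertwine` applies. With `symExp_one` and linearity this recursion
determines `symExp B`. -/
theorem symExp_ι_mul (B : V →ₗ[ℂ] V →ₗ[ℂ] ℂ) (hB : ∀ x y, B x y = B y x) (v : V)
    (s : SymmetricAlgebra ℂ V) :
    symExp B (SymmetricAlgebra.ι ℂ V v * s)
      = SymmetricAlgebra.ι ℂ V v * symExp B s - symDeriv (B v) (symExp B s) := by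
  have := locExp_intertwine (-symContract B) (-symContract B)
    (neg_locNilp _ (symContract_locNilp B)) (neg_locNilp _ (symContract_locNilp B))
    (LinearMap.mulLeft ℂ (SymmetricAlgebra.ι ℂ V v)) (-symDeriv (B v))
    (fun s => by simp [symContract_ι_mul B hB]; abel)
    (fun s => by simp [symContract_symDeriv B hB]) s
  simpa [sub_eq_add_neg, symExp] using this

/-- In the recursion for a letter the two derivative terms, along `B v` and `-B v`, cancel. -/
theorem symExp_symExp_neg (B : V →ₗ[ℂ] V →ₗ[ℂ] ℂ) (hB : ∀ x y, B x y = B y x)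
    (s : SymmetricAlgebra ℂ V) : symExp B (symExp (-B) s) = s := by
  induction s using symInduction with
  | one => simp
  | add s t hs ht => simp [hs, ht]
  | smul c s hs => simp [hs]
  | ι_mul v s hs =>
    rw [symExp_ι_mul (-B) (by simp [hB]), map_sub, symExp_ι_mul B hB, symExp_symDeriv B hB, hs]
    simp

theorem symExp_neg_symExp (B : V →ₗ[ℂ] V →ₗ[ℂ] ℂ) (hB : ∀ x y, B x y = B y x)
    (s : SymmetricAlgebra ℂ V) : symExp (-B) (symExp B s) = s := by
  simpa using symExp_symExp_neg (-B) (by simp [hB]) s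

/-- Functoriality of the symmetric algebra. -/
def symMap (g : V →ₗ[ℂ] V') : SymmetricAlgebra ℂ V →ₐ[ℂ] SymmetricAlgebra ℂ V' :=
  SymmetricAlgebra.lift (SymmetricAlgebra.ι ℂ V' ∘ₗ g)

@[simp]
theorem symMap_ι (g : V →ₗ[ℂ] V') (v : V) :
    symMap g (SymmetricAlgebra.ι ℂ V v) = SymmetricAlgebra.ι ℂ V' (g v) := by
  simp [symMap]

theorem symDeriv_symMap (g : V →ₗ[ℂ] V') (l : V' →ₗ[ℂ] ℂ) (s : SymmetricAlgebra ℂ V) :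
    symDeriv l (symMap g s) = symMap g (symDeriv (l ∘ₗ g) s) := by
  induction s using symInduction with
  | one => simp
  | add s t hs ht => simp [hs, ht]
  | smul c s hs => simp [hs]
  | ι_mul v s hs => simp [symDeriv_ι_mul, hs]

theorem symExp_symMap (g : V →ₗ[ℂ] V') (B : V →ₗ[ℂ] V →ₗ[ℂ] ℂ) (hB : ∀ x y, B x y = B y x)
    (B' : V' →ₗ[ℂ] V' →ₗ[ℂ] ℂ) (hB' : ∀ x y, B' x y = B' y x)
    (h : ∀ x y, B' (g x) (g y) = B x y) (s : SymmetricAlgebra ℂ V) :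
    symExp B' (symMap g s) = symMap g (symExp B s) := by
  induction s using symInduction with
  | one => simp
  | add s t hs ht => simp [hs, ht]
  | smul c s hs => simp [hs]
  | ι_mul v s hs =>
    have e : B' (g v) ∘ₗ g = B v := LinearMap.ext fun y => h v y
    simp [symExp_ι_mul B hB, symExp_ι_mul B' hB', hs, symDeriv_symMap, e]

end SymmetricAlgebra

end OffShellQM

end

/-! ### Letters of the graded symmetric algebra and Koszul operators. -/

noncomputable section

namespace OffShellQM

section GradedSymmetric

variable {E V E' V' : Type} [AddCommGroup E] [Module ℂ E] [AddCommGroup V] [Module ℂ V]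
  [AddCommGroup E'] [Module ℂ E'] [AddCommGroup V'] [Module ℂ V']

namespace GSym

/-- The letters from `E`, of degree `-1`. -/
def odd : E →ₗ[ℂ] GSym E V :=
  (Algebra.TensorProduct.includeLeft :
    ExteriorAlgebra ℂ E →ₐ[ℂ] GSym E V).toLinearMap ∘ₗ ExteriorAlgebra.ι ℂ

/-- The words in the letters from `V`, of degree `0`. -/
def even : SymmetricAlgebra ℂ V →ₐ[ℂ] GSym E V := Algebra.TensorProduct.includeRight

theorem odd_apply (g : E) : (odd g : GSym E V) = ExteriorAlgebra.ι ℂ g ⊗ₜ 1 := rfl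

theorem even_apply (s : SymmetricAlgebra ℂ V) : (even s : GSym E V) = 1 ⊗ₜ s := rfl

theorem odd_mul_tmul (g : E) (a : ExteriorAlgebra ℂ E) (s : SymmetricAlgebra ℂ V) :
    odd g * (a ⊗ₜ[ℂ] s) = (ExteriorAlgebra.ι ℂ g * a) ⊗ₜ[ℂ] s := by
  rw [odd_apply, Algebra.TensorProduct.tmul_mul_tmul, one_mul]

theorem even_mul_tmul (t : SymmetricAlgebra ℂ V) (a : ExteriorAlgebra ℂ E)
    (s : SymmetricAlgebra ℂ V) : even t * (a ⊗ₜ[ℂ] s) = a ⊗ₜ[ℂ] (t * s) := by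
  rw [even_apply, Algebra.TensorProduct.tmul_mul_tmul, one_mul]

theorem even_commute (t : SymmetricAlgebra ℂ V) (x : GSym E V) : even t * x = x * even t := by
  induction x using TensorProduct.induction_on with
  | zero => simp
  | tmul a s =>
    rw [even_apply, Algebra.TensorProduct.tmul_mul_tmul, Algebra.TensorProduct.tmul_mul_tmul,
      one_mul, mul_one, mul_comm]
  | add x y hx hy => rw [mul_add, add_mul, hx, hy]

theorem odd_mul_self (g : E) : (odd g * odd g : GSym E V) = 0 := by
  rw [odd_apply, Algebra.TensorProduct.tmul_mul_tmul, ExteriorAlgebra.ι_sq_zero,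
    TensorProduct.zero_tmul]

theorem odd_mul_odd (g h : E) : (odd g * odd h : GSym E V) = -(odd h * odd g) := by
  have := odd_mul_self (V := V) (g + h)
  rw [map_add, mul_add, add_mul, add_mul, odd_mul_self, odd_mul_self, zero_add, add_zero] at this
  exact eq_neg_of_add_eq_zero_right this

/-- Induction on the number of letters from `E`. -/
theorem odd_induction {P : GSym E V → Prop} (even : ∀ s, P (even s))
    (add : ∀ x y, P x → P y → P (x + y)) (odd_mul : ∀ g x, P x → P (odd g * x))
    (x : GSym E V) : P x := by
  induction x using TensorProduct.induction_on with
  | zero => simpa using even 0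
  | add x y hx hy => exact add x y hx hy
  | tmul a s =>
    induction a using CliffordAlgebra.left_induction with
    | algebraMap r =>
      have := even (r • s)
      rwa [even_apply, TensorProduct.tmul_smul, TensorProduct.smul_tmul',
        ← Algebra.algebraMap_eq_smul_one] at this
    | add a b ha hb => rw [TensorProduct.add_tmul]; exact add _ _ ha hb
    | ι_mul a g ha => exact (odd_mul_tmul g a s) ▸ odd_mul g _ ha

/-- Induction on the number of letters. -/
theorem letter_induction {P : GSym E V → Prop} (one : P 1)
    (add : ∀ x y, P x → P y → P (x + y)) (smul : ∀ (c : ℂ) x, P x → P (c • x))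
    (odd_mul : ∀ g x, P x → P (odd g * x))
    (even_mul : ∀ v x, P x → P (even (SymmetricAlgebra.ι ℂ V v) * x)) (x : GSym E V) : P x := by
  refine odd_induction (fun s => ?_) add odd_mul x
  induction s using symInduction with
  | one => rwa [map_one]
  | add s t hs ht => rw [map_add]; exact add _ _ hs ht
  | smul c s hs => rw [map_smul]; exact smul _ _ hs
  | ι_mul v s hs => rw [map_mul]; exact even_mul v _ hs

/-- An operator on the words in the even letters, acting on all words. -/
def evenOp (T : Module.End ℂ (SymmetricAlgebra ℂ V)) : Module.End ℂ (GSym E V) :=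
  TensorProduct.map 1 T

@[simp]
theorem evenOp_even (T : Module.End ℂ (SymmetricAlgebra ℂ V)) (s : SymmetricAlgebra ℂ V) :
    evenOp T (even s : GSym E V) = even (T s) := by
  simp [evenOp, even_apply]

@[simp]
theorem evenOp_odd_mul (T : Module.End ℂ (SymmetricAlgebra ℂ V)) (g : E) (x : GSym E V) :
    evenOp T (odd g * x) = odd g * evenOp T x := by
  induction x using TensorProduct.induction_on with
  | zero => simp
  | add x y hx hy => simp only [mul_add, map_add, hx, hy]
  | tmul a s => simp [evenOp, odd_mul_tmul]

theorem koszul_tmul (φ : E →ₗ[ℂ] Module.End ℂ (SymmetricAlgebra ℂ V)) (g : E)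
    (a : ExteriorAlgebra ℂ E) (s : SymmetricAlgebra ℂ V) :
    koszul φ ((ExteriorAlgebra.ι ℂ g * a) ⊗ₜ s) = a ⊗ₜ φ g s - odd g * koszul φ (a ⊗ₜ s) := by
  rw [koszul, TensorProduct.lift.tmul, CliffordAlgebra.foldr'_ι_mul]
  simp [koszulStep, odd_apply]

@[simp]
theorem koszul_even (φ : E →ₗ[ℂ] Module.End ℂ (SymmetricAlgebra ℂ V))
    (s : SymmetricAlgebra ℂ V) : koszul φ (even s) = 0 := by
  rw [even_apply, koszul, TensorProduct.lift.tmul, ← map_one (algebraMap ℂ (ExteriorAlgebra ℂ E)),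
    CliffordAlgebra.foldr'_algebraMap, smul_zero, LinearMap.zero_apply]

-- Together with `koszul_even` this recursion determines `koszul φ`; later identities for these
-- operators follow from it by `odd_induction`.
@[simp]
theorem koszul_odd_mul (φ : E →ₗ[ℂ] Module.End ℂ (SymmetricAlgebra ℂ V)) (g : E)
    (x : GSym E V) : koszul φ (odd g * x) = evenOp (φ g) x - odd g * koszul φ x := by
  induction x using TensorProduct.induction_on with
  | zero => simp
  | add x y hx hy => simp only [mul_add, map_add, hx, hy]; abel
  | tmul a s => rw [odd_mul_tmul, koszul_tmul]; rfl

theorem koszul_add (φ ψ : E →ₗ[ℂ] Module.End ℂ (SymmetricAlgebra ℂ V)) (x : GSym E V) :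
    koszul (φ + ψ) x = koszul φ x + koszul ψ x := by
  induction x using odd_induction with
  | even s => simp
  | add x y hx hy => simp only [map_add, hx, hy]; abel
  | odd_mul g x hx =>
    have : evenOp (φ g + ψ g) x = evenOp (φ g) x + evenOp (ψ g) x := by
      simp [evenOp, TensorProduct.map_add_right]
    simp only [koszul_odd_mul, hx, LinearMap.add_apply, this, mul_add]
    abel

theorem evenOp_evenOp (T T' : Module.End ℂ (SymmetricAlgebra ℂ V)) (x : GSym E V) :
    evenOp T (evenOp T' x) = evenOp (T * T') x := by
  rw [evenOp, evenOp, evenOp, ← LinearMap.comp_apply, ← TensorProduct.map_comp]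
  rfl

theorem evenOp_koszul (T : Module.End ℂ (SymmetricAlgebra ℂ V))
    (φ ψ : E →ₗ[ℂ] Module.End ℂ (SymmetricAlgebra ℂ V)) (h : ∀ g, T * φ g = ψ g * T)
    (x : GSym E V) : evenOp T (koszul φ x) = koszul ψ (evenOp T x) := by
  induction x using odd_induction with
  | even s => simp
  | add x y hx hy => simp only [map_add, hx, hy]
  | odd_mul g x hx => simp [hx, evenOp_evenOp, h]

/-- Removing two odd letters in either order gives opposite signs, so commuting operators `φ g`
cancel in pairs. -/
theorem koszul_koszul (φ : E →ₗ[ℂ] Module.End ℂ (SymmetricAlgebra ℂ V))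
    (h : ∀ g g', φ g * φ g' = φ g' * φ g) (x : GSym E V) : koszul φ (koszul φ x) = 0 := by
  induction x using odd_induction with
  | even s => simp
  | add x y hx hy => simp only [map_add, hx, hy, add_zero]
  | odd_mul g x hx =>
    simp [hx, evenOp_koszul (φ g) φ φ (h g)]

@[simp]
theorem map_odd (f : E →ₗ[ℂ] E') (g : V →ₗ[ℂ] V') (e : E) :
    GSym.map f g (odd e) = odd (f e) := by
  simp [GSym.map, odd_apply]

@[simp]
theorem map_even (f : E →ₗ[ℂ] E') (g : V →ₗ[ℂ] V') (s : SymmetricAlgebra ℂ V) :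
    GSym.map f g (even s) = even (symMap g s) := by
  simp [GSym.map, even_apply, symMap]

theorem evenOp_map (f : E →ₗ[ℂ] E') (g : V →ₗ[ℂ] V') (T : Module.End ℂ (SymmetricAlgebra ℂ V))
    (T' : Module.End ℂ (SymmetricAlgebra ℂ V')) (h : ∀ s, T' (symMap g s) = symMap g (T s))
    (x : GSym E V) : evenOp T' (GSym.map f g x) = GSym.map f g (evenOp T x) := by
  induction x using odd_induction with
  | even s => simp [h]
  | add x y hx hy => simp only [map_add, hx, hy]
  | odd_mul e x hx => simp [hx]

theorem koszul_map (f : E →ₗ[ℂ] E') (g : V →ₗ[ℂ] V')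
    (φ : E →ₗ[ℂ] Module.End ℂ (SymmetricAlgebra ℂ V))
    (φ' : E' →ₗ[ℂ] Module.End ℂ (SymmetricAlgebra ℂ V'))
    (h : ∀ e s, φ' (f e) (symMap g s) = symMap g (φ e s)) (x : GSym E V) :
    koszul φ' (GSym.map f g x) = GSym.map f g (koszul φ x) := by
  induction x using odd_induction with
  | even s => simp
  | add x y hx hy => simp only [map_add, hx, hy]
  | odd_mul e x hx => simp [hx, evenOp_map f g _ _ (h e)]

@[simp]
theorem map_id (x : GSym E V) : GSym.map LinearMap.id LinearMap.id x = x := by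
  induction x using letter_induction with
  | one => simp
  | add x y hx hy => simp only [map_add, hx, hy]
  | smul c x hx => rw [map_smul, hx]
  | odd_mul e x hx => simp [hx]
  | even_mul v x hx => simp [hx]

theorem map_map {E'' V'' : Type} [AddCommGroup E''] [Module ℂ E''] [AddCommGroup V'']
    [Module ℂ V''] (f' : E' →ₗ[ℂ] E'') (g' : V' →ₗ[ℂ] V'') (f : E →ₗ[ℂ] E') (g : V →ₗ[ℂ] V')
    (x : GSym E V) :
    GSym.map f' g' (GSym.map f g x) = GSym.map (f' ∘ₗ f) (g' ∘ₗ g) x := by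
  induction x using letter_induction with
  | one => simp
  | add x y hx hy => simp only [map_add, hx, hy]
  | smul c x hx => simp only [map_smul, hx]
  | odd_mul e x hx => simp [hx]
  | even_mul v x hx => simp [hx]

@[simp]
theorem proj_odd {A : Type} [CommRing A] [Algebra ℂ A] (π : V →ₗ[ℂ] A) (e : E) :
    GSym.proj π (odd e) = 0 := by
  simp [GSym.proj, odd_apply, ExteriorAlgebra.algebraMapInv]

@[simp]
theorem proj_even {A : Type} [CommRing A] [Algebra ℂ A] (π : V →ₗ[ℂ] A)
    (s : SymmetricAlgebra ℂ V) : GSym.proj (E := E) π (even s) = SymmetricAlgebra.lift π s := by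
  simp [GSym.proj, even_apply]

/-- The algebra automorphism that is `(-1)ⁿ` in degree `n`. -/
def parity : GSym E V →ₐ[ℂ] GSym E V := GSym.map (-LinearMap.id) LinearMap.id

@[simp]
theorem parity_odd (e : E) : parity (odd e : GSym E V) = -odd e := by
  simp [parity]

@[simp]
theorem symMap_id (s : SymmetricAlgebra ℂ V) : symMap LinearMap.id s = s := by
  induction s using symInduction with
  | one => simp
  | add s t hs ht => simp [hs, ht]
  | smul c s hs => simp [hs]
  | ι_mul v s hs => simp [hs]

@[simp]
theorem parity_even (s : SymmetricAlgebra ℂ V) : parity (even s : GSym E V) = even s := by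
  simp [parity]

end GSym

end GradedSymmetric

end OffShellQM

end

/-! ### The grading, graded commutativity and product rules. -/

noncomputable section

namespace OffShellQM

section GradedSymmetric

variable {E V E' V' : Type} [AddCommGroup E] [Module ℂ E] [AddCommGroup V] [Module ℂ V]
  [AddCommGroup E'] [Module ℂ E'] [AddCommGroup V'] [Module ℂ V']

namespace GSym

protected theorem neg_mul (x y : GSym E V) : -x * y = -(x * y) := neg_mul x y

theorem tmul_mem_grading (n : ℕ) {a : ExteriorAlgebra ℂ E} (ha : a ∈ ⋀[ℂ]^n E)
    (s : SymmetricAlgebra ℂ V) : a ⊗ₜ s ∈ grading E V (-n) := by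
  rw [grading, if_pos (by simp)]
  exact ⟨(⟨a, by simpa using ha⟩ : ⋀[ℂ]^((- -(n : ℤ)).toNat) E) ⊗ₜ s, by simp⟩

theorem grading_eq_bot {p : ℤ} (hp : 0 < p) : grading E V p = ⊥ :=
  if_neg (not_le.mpr hp)

theorem grading_tmul_induction {n : ℕ} {P : GSym E V → Prop} (zero : P 0)
    (add : ∀ x y, P x → P y → P (x + y)) (tmul : ∀ a ∈ ⋀[ℂ]^n E, ∀ s, P (a ⊗ₜ s))
    {x : GSym E V} (hx : x ∈ grading E V (-n)) : P x := by
  rw [grading, if_pos (by simp)] at hx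
  obtain ⟨z, rfl⟩ := hx
  induction z using TensorProduct.induction_on with
  | zero => simpa using zero
  | add z w hz hw => rw [map_add]; exact add _ _ hz hw
  | tmul a s => exact tmul _ (by simpa using a.2) s

theorem even_mem (s : SymmetricAlgebra ℂ V) : even s ∈ grading E V 0 := by
  have h := tmul_mem_grading (E := E) 0 (a := 1) (by simp) s
  simp only [Nat.cast_zero, neg_zero] at h
  exact h

theorem odd_mul_mem (g : E) {p : ℤ} {x : GSym E V} (hx : x ∈ grading E V p) :
    odd g * x ∈ grading E V (p - 1) := by
  rcases lt_or_ge 0 p with hp | hp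
  · rw [grading_eq_bot hp, Submodule.mem_bot] at hx
    simp [hx]
  obtain ⟨n, rfl⟩ : ∃ n : ℕ, p = -n := ⟨(-p).toNat, by omega⟩
  refine grading_tmul_induction (P := fun x => odd g * x ∈ grading E V (-n - 1)) ?_ ?_ ?_ hx
  · simp
  · intro x y hx hy
    rw [mul_add]
    exact add_mem hx hy
  · intro a ha s
    rw [odd_mul_tmul]
    have := tmul_mem_grading (V := V) (n + 1) (a := ExteriorAlgebra.ι ℂ g * a) (by
      change _ ∈ LinearMap.range (ExteriorAlgebra.ι ℂ) ^ (n + 1)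
      rw [pow_succ']
      exact Submodule.mul_mem_mul (LinearMap.mem_range_self _ g) ha) s
    convert this using 1
    push_cast
    ring_nf

/-- Induction on the number of odd letters, for homogeneous elements. -/
theorem grading_odd_induction {P : ℕ → GSym E V → Prop} (even : ∀ s, P 0 (even s))
    (zero : ∀ n, P n 0) (add : ∀ n x y, P n x → P n y → P n (x + y))
    (odd_mul : ∀ (n : ℕ) g x, x ∈ grading E V (-n) → P n x → P (n + 1) (odd g * x)) {n : ℕ}
    {x : GSym E V} (hx : x ∈ grading E V (-n)) : P n x := by
  refine grading_tmul_induction (zero n) (add n) (fun a ha s => ?_) hx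
  clear hx
  induction ha using Submodule.pow_induction_on_left' with
  | algebraMap r =>
    have := even (r • s)
    rwa [even_apply, TensorProduct.tmul_smul, TensorProduct.smul_tmul',
      ← Algebra.algebraMap_eq_smul_one] at this
  | add a b i _ _ ha hb =>
    rw [TensorProduct.add_tmul]
    exact add _ _ _ ha hb
  | mem_mul g hg i a ha ih =>
    obtain ⟨g, rfl⟩ := hg
    rw [← odd_mul_tmul]
    exact odd_mul i g _ (tmul_mem_grading i ha s) ih

theorem even_mul_mem (s : SymmetricAlgebra ℂ V) {p : ℤ} {x : GSym E V}
    (hx : x ∈ grading E V p) : even s * x ∈ grading E V p := by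
  rcases lt_or_ge 0 p with hp | hp
  · rw [grading_eq_bot hp, Submodule.mem_bot] at hx
    simp [hx]
  obtain ⟨n, rfl⟩ : ∃ n : ℕ, p = -n := ⟨(-p).toNat, by omega⟩
  refine grading_tmul_induction (P := fun x => even s * x ∈ grading E V (-n)) ?_ ?_ ?_ hx
  · simp
  · intro x y hx hy
    rw [mul_add]
    exact add_mem hx hy
  · intro a ha t
    rw [even_mul_tmul]
    exact tmul_mem_grading n ha _

theorem neg_natCast_of_mem {p : ℤ} {x : GSym E V} (hx : x ∈ grading E V p) :
    x = 0 ∨ ∃ n : ℕ, p = -n := by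
  rcases lt_or_ge 0 p with hp | hp
  · rw [grading_eq_bot hp, Submodule.mem_bot] at hx
    exact Or.inl hx
  · exact Or.inr ⟨(-p).toNat, by omega⟩

theorem neg_natCast_sub_one (n : ℕ) : (-(n : ℤ) - 1) = -((n + 1 : ℕ) : ℤ) := by
  push_cast
  ring

/-- Induction on the number of letters, for homogeneous elements. -/
theorem grading_letter_induction {P : ℤ → GSym E V → Prop} (one : P 0 1)
    (zero : ∀ p, P p 0) (add : ∀ p x y, P p x → P p y → P p (x + y))
    (smul : ∀ p (c : ℂ) x, P p x → P p (c • x))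
    (odd_mul : ∀ p g x, x ∈ grading E V p → P p x → P (p - 1) (odd g * x))
    (even_mul : ∀ p v x, x ∈ grading E V p → P p x →
      P p (even (SymmetricAlgebra.ι ℂ V v) * x)) {p : ℤ}
    {x : GSym E V} (hx : x ∈ grading E V p) : P p x := by
  obtain rfl | ⟨n, rfl⟩ := neg_natCast_of_mem hx
  · exact zero p
  refine grading_odd_induction (P := fun n x => P (-n) x) (fun s => ?_) (fun n => zero _)
    (fun n => add _) (fun n g x hx h => ?_) hx
  · simp only [Nat.cast_zero, neg_zero]
    induction s using symInduction with
    | one => rwa [map_one]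
    | add s t hs ht => rw [map_add]; exact add _ _ _ hs ht
    | smul c s hs => rw [map_smul]; exact smul _ _ _ hs
    | ι_mul v s hs => rw [map_mul]; exact even_mul _ v _ (even_mem s) hs
  · have := odd_mul (-n) g x hx h
    rwa [neg_natCast_sub_one] at this

theorem mul_mem {p q : ℤ} {x y : GSym E V} (hx : x ∈ grading E V p) (hy : y ∈ grading E V q) :
    x * y ∈ grading E V (p + q) := by
  refine grading_letter_induction (P := fun p x => x * y ∈ grading E V (p + q))
    ?_ ?_ ?_ ?_ ?_ ?_ hx
  · simpa using hy
  · simp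
  · intro p x x' h h'
    rw [add_mul]
    exact add_mem h h'
  · intro p c x h
    rw [smul_mul_assoc]
    exact Submodule.smul_mem _ _ h
  · intro p g x _ h
    rw [mul_assoc, sub_add_eq_add_sub]
    exact odd_mul_mem g h
  · intro p v x _ h
    rw [mul_assoc]
    exact even_mul_mem _ h

theorem odd_mul_eq (g : E) {q : ℤ} {y : GSym E V} (hy : y ∈ grading E V q) :
    y * odd g = ((-1 : ℂ) ^ q) • (odd g * y) := by
  refine grading_letter_induction (P := fun q y => y * odd g = ((-1 : ℂ) ^ q) • (odd g * y))
    ?_ ?_ ?_ ?_ ?_ ?_ hy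
  · simp
  · simp
  · intro p x x' h h'
    rw [add_mul, h, h', mul_add, smul_add]
  · intro p c x h
    rw [smul_mul_assoc, h, mul_smul_comm, smul_comm]
  · intro p e x _ h
    rw [mul_assoc, h, mul_smul_comm, ← mul_assoc, odd_mul_odd e g, zpow_sub_one₀ (by simp),
      GSym.neg_mul, mul_assoc]
    simp only [inv_neg, inv_one, mul_neg, mul_one, smul_neg]
    exact (neg_smul _ _).symm
  · intro p v x _ h
    rw [mul_assoc, h, mul_smul_comm, ← mul_assoc, even_commute, mul_assoc]

theorem graded_comm {p q : ℤ} {x y : GSym E V} (hx : x ∈ grading E V p)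
    (hy : y ∈ grading E V q) : x * y = ((-1 : ℂ) ^ (p * q)) • (y * x) := by
  refine grading_letter_induction
    (P := fun p x => x * y = ((-1 : ℂ) ^ (p * q)) • (y * x)) ?_ ?_ ?_ ?_ ?_ ?_ hx
  · simp
  · simp
  · intro p x x' h h'
    rw [add_mul, h, h', mul_add, smul_add]
  · intro p c x h
    rw [smul_mul_assoc, h, mul_smul_comm, smul_comm]
  · intro p g x _ h
    have hs : ((-1 : ℂ) ^ q) * ((-1 : ℂ) ^ q) = 1 := by
      rw [← zpow_add₀ (by simp), ← two_mul, zpow_mul]; simp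
    rw [mul_assoc, h, mul_smul_comm, ← mul_assoc, ← mul_assoc, odd_mul_eq g hy, sub_mul, one_mul,
      zpow_sub₀ (by simp), smul_mul_assoc, smul_smul, div_mul_cancel₀ _ (zpow_ne_zero _ (by simp))]
  · intro p v x _ h
    rw [mul_assoc, h, mul_smul_comm, ← mul_assoc, even_commute, mul_assoc]

theorem evenOp_mem (T : Module.End ℂ (SymmetricAlgebra ℂ V)) {p : ℤ} {x : GSym E V}
    (hx : x ∈ grading E V p) : evenOp T x ∈ grading E V p := by
  obtain rfl | ⟨n, rfl⟩ := neg_natCast_of_mem hx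
  · simp
  refine grading_tmul_induction (P := fun x => evenOp T x ∈ grading E V (-n)) ?_ ?_ ?_ hx
  · simp
  · intro x y hx hy
    rw [map_add]
    exact add_mem hx hy
  · intro a ha s
    exact tmul_mem_grading n ha _

theorem koszul_mem (φ : E →ₗ[ℂ] Module.End ℂ (SymmetricAlgebra ℂ V)) {p : ℤ} {x : GSym E V}
    (hx : x ∈ grading E V p) : koszul φ x ∈ grading E V (p + 1) := by
  obtain rfl | ⟨n, rfl⟩ := neg_natCast_of_mem hx
  · simp
  refine grading_odd_induction (P := fun n x => koszul φ x ∈ grading E V (-n + 1))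
    ?_ ?_ ?_ ?_ hx
  · simp
  · simp
  · intro n x y hx hy
    rw [map_add]
    exact add_mem hx hy
  · intro n g x hx h
    rw [koszul_odd_mul]
    have e : -((n + 1 : ℕ) : ℤ) + 1 = -(n : ℤ) := by push_cast; ring
    rw [e]
    refine sub_mem (evenOp_mem _ hx) ?_
    simpa using odd_mul_mem g h

theorem map_mem (f : E →ₗ[ℂ] E') (g : V →ₗ[ℂ] V') {p : ℤ} {x : GSym E V}
    (hx : x ∈ grading E V p) : GSym.map f g x ∈ grading E' V' p := by
  refine grading_letter_induction (P := fun p x => GSym.map f g x ∈ grading E' V' p)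
    ?_ ?_ ?_ ?_ ?_ ?_ hx
  · simpa using even_mem (E := E') (1 : SymmetricAlgebra ℂ V')
  · simp
  · intro p x x' h h'
    rw [map_add]
    exact add_mem h h'
  · intro p c x h
    rw [map_smul]
    exact Submodule.smul_mem _ _ h
  · intro p e x _ h
    rw [map_mul, map_odd]
    exact odd_mul_mem _ h
  · intro p v x _ h
    rw [map_mul, map_even]
    exact even_mul_mem _ h

theorem proj_eq_zero {A : Type} [CommRing A] [Algebra ℂ A] (π : V →ₗ[ℂ] A) {p : ℤ} (hp : p ≠ 0)
    {x : GSym E V} (hx : x ∈ grading E V p) : GSym.proj π x = 0 := by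
  refine grading_letter_induction (P := fun p x => p ≠ 0 → GSym.proj π x = 0)
    ?_ ?_ ?_ ?_ ?_ ?_ hx hp
  · simp
  · simp
  · intro p x x' h h' hp
    rw [map_add, h hp, h' hp, add_zero]
  · intro p c x h hp
    rw [map_smul, h hp, smul_zero]
  · intro p e x _ h _
    simp
  · intro p v x _ h hp
    rw [map_mul, h hp, mul_zero]

theorem parity_eq {p : ℤ} {x : GSym E V} (hx : x ∈ grading E V p) :
    parity x = ((-1 : ℂ) ^ p) • x := by
  refine grading_letter_induction (P := fun p x => parity x = ((-1 : ℂ) ^ p) • x)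
    ?_ ?_ ?_ ?_ ?_ ?_ hx
  · simp
  · simp
  · intro p x x' h h'
    rw [map_add, h, h', smul_add]
  · intro p c x h
    rw [map_smul, h, smul_comm]
  · intro p e x _ h
    rw [map_mul, parity_odd, h, zpow_sub_one₀ (by simp), GSym.neg_mul, mul_smul_comm]
    simp only [inv_neg, inv_one, mul_neg, mul_one]
    exact (neg_smul _ _).symm
  · intro p v x _ h
    rw [map_mul, parity_even, h, mul_smul_comm]

theorem iSup_grading : ⨆ p, grading E V p = ⊤ := by
  rw [eq_top_iff]
  intro x _
  induction x using odd_induction with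
  | even s => exact Submodule.mem_iSup_of_mem 0 (even_mem s)
  | add x y hx hy => exact add_mem (hx trivial) (hy trivial)
  | odd_mul g x hx =>
    refine Submodule.iSup_induction _ (motive := fun x => odd g * x ∈ ⨆ p, grading E V p)
      (hx trivial) (fun p y hy => Submodule.mem_iSup_of_mem _ (odd_mul_mem g hy)) (by simp) ?_
    intro y z hy hz
    rw [mul_add]
    exact add_mem hy hz

/-- The projection onto the words with `n` odd letters. -/
def gradingProj (n : ℕ) : GSym E V →ₗ[ℂ] GSym E V :=
  LinearMap.rTensor _ (GradedAlgebra.proj (fun i : ℕ => ⋀[ℂ]^i E) n)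

theorem gradingProj_apply (m n : ℕ) {x : GSym E V} (hx : x ∈ grading E V (-n)) :
    gradingProj m x = if m = n then x else 0 := by
  refine grading_tmul_induction (P := fun x => gradingProj m x = if m = n then x else 0)
    ?_ ?_ ?_ hx
  · simp
  · intro x y hx hy
    rw [map_add, hx, hy]
    split_ifs <;> simp
  · intro a ha s
    rw [gradingProj, LinearMap.rTensor_tmul, GradedAlgebra.proj_apply]
    split_ifs with h
    · subst h
      rw [DirectSum.decompose_of_mem_same (fun i : ℕ => ⋀[ℂ]^i E) ha]
    · rw [DirectSum.decompose_of_mem_ne (fun i : ℕ => ⋀[ℂ]^i E) ha (Ne.symm h), TensorProduct.zero_tmul]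

theorem isInternal_grading : DirectSum.IsInternal (grading E V) := by
  rw [DirectSum.isInternal_submodule_iff_iSupIndep_and_iSup_eq_top]
  refine ⟨fun p => ?_, iSup_grading⟩
  rw [Submodule.disjoint_def]
  intro x hx hx'
  obtain rfl | ⟨n, rfl⟩ := neg_natCast_of_mem hx
  · rfl
  -- `gradingProj n` is the identity in degree `-n` and kills every other degree; this gives
  -- independence.
  have hle : ⨆ q, ⨆ (_ : q ≠ -(n : ℤ)), grading E V q ≤ LinearMap.ker (gradingProj n) := by
    refine iSup₂_le fun q hq y hy => ?_
    obtain rfl | ⟨m, rfl⟩ := neg_natCast_of_mem hy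
    · simp
    · rw [LinearMap.mem_ker, gradingProj_apply n m hy, if_neg]
      rintro rfl
      exact hq rfl
  have := hle hx'
  rwa [LinearMap.mem_ker, gradingProj_apply n n hx, if_pos rfl] at this

/-- In an internally graded space, an exact homogeneous element for a differential of degree `1`
is the differential of a homogeneous element. -/
theorem exists_homogeneous_primitive {A : Type} [AddCommGroup A] [Module ℂ A]
    (gr : ℤ → Submodule ℂ A) (hgr : DirectSum.IsInternal gr) (δ : A →ₗ[ℂ] A)
    (hδ : ∀ p, ∀ x ∈ gr p, δ x ∈ gr (p + 1)) {p : ℤ} {v : A} (hv : δ v ∈ gr p) :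
    ∃ w ∈ gr (p - 1), δ v = δ w := by
  classical
  have h := (DirectSum.isInternal_submodule_iff_iSupIndep_and_iSup_eq_top gr).mp hgr
  have hv' : v ∈ ⨆ q, gr q := h.2 ▸ Submodule.mem_top
  have hle : ⨆ q, gr q ≤ gr (p - 1) ⊔ ⨆ q, ⨆ (_ : q ≠ p - 1), gr q := by
    refine iSup_le fun q => ?_
    by_cases hq : q = p - 1
    · subst hq; exact le_sup_left
    · exact (le_iSup₂ (f := fun q (_ : q ≠ p - 1) => gr q) q hq).trans le_sup_right
  -- The degree `p - 1` component of the primitive suffices: the image of the remainder lies both in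
  -- degree `p` and in the span of the other degrees, hence is zero.
  obtain ⟨w, hw, u, hu, rfl⟩ := Submodule.mem_sup.mp (hle hv')
  refine ⟨w, hw, ?_⟩
  have hu' : δ u ∈ ⨆ q, ⨆ (_ : q ≠ p), gr q := by
    have : (⨆ q, ⨆ (_ : q ≠ p - 1), gr q) ≤ (⨆ q, ⨆ (_ : q ≠ p), gr q).comap δ := by
      refine iSup₂_le fun q hq y hy => ?_
      have hne : q + 1 ≠ p := fun h => hq (by omega)
      exact (le_iSup₂ (f := fun q (_ : q ≠ p) => gr q) (q + 1) hne) (hδ q y hy)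
    exact this hu
  have hw' : δ w ∈ gr p := by simpa using hδ _ w hw
  have hu'' : δ u ∈ gr p := by
    have := sub_mem hv hw'
    rwa [map_add, add_sub_cancel_left] at this
  rw [map_add, (Submodule.disjoint_def.mp (h.1 p)) _ hu'' hu', add_zero]

/-- Linearity of `T` is required only over words that come from `V'`. A derivative has this property
when its functional vanishes on those letters, as happens for disjoint supports. -/
theorem evenOp_mul_map (T : Module.End ℂ (SymmetricAlgebra ℂ V)) (f : E' →ₗ[ℂ] E)
    (g : V' →ₗ[ℂ] V) (h : ∀ s t, T (s * symMap g t) = T s * symMap g t) (x : GSym E V)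
    (y : GSym E' V') :
    evenOp T (x * GSym.map f g y) = evenOp T x * GSym.map f g y := by
  induction x using odd_induction with
  | add x y hx hy => simp only [add_mul, map_add, hx, hy]
  | odd_mul e x hx => simp [mul_assoc, hx]
  | even s =>
    induction y using odd_induction with
    | even t => rw [evenOp_even, map_even, ← map_mul, evenOp_even, h, map_mul]
    | add x y hx hy => simp only [mul_add, map_add, hx, hy]
    | odd_mul e x hx =>
      rw [map_mul (GSym.map f g), map_odd, ← mul_assoc, even_commute, mul_assoc, evenOp_odd_mul, hx, evenOp_even,
        ← mul_assoc, ← mul_assoc, even_commute]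

/-- The product rule for two words such that the operators of the odd letters of one are linear
over the even letters of the other. -/
theorem koszul_map_mul_map {E₁ V₁ E₂ V₂ : Type} [AddCommGroup E₁] [Module ℂ E₁] [AddCommGroup V₁]
    [Module ℂ V₁] [AddCommGroup E₂] [Module ℂ E₂] [AddCommGroup V₂] [Module ℂ V₂]
    (φ : E →ₗ[ℂ] Module.End ℂ (SymmetricAlgebra ℂ V)) (f₁ : E₁ →ₗ[ℂ] E) (g₁ : V₁ →ₗ[ℂ] V)
    (f₂ : E₂ →ₗ[ℂ] E) (g₂ : V₂ →ₗ[ℂ] V)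
    (h₁ : ∀ e s t, φ (f₁ e) (s * symMap g₂ t) = φ (f₁ e) s * symMap g₂ t)
    (h₂ : ∀ e s t, φ (f₂ e) (s * symMap g₁ t) = φ (f₂ e) s * symMap g₁ t)
    (x : GSym E₁ V₁) (y : GSym E₂ V₂) :
    koszul φ (GSym.map f₁ g₁ x * GSym.map f₂ g₂ y)
      = koszul φ (GSym.map f₁ g₁ x) * GSym.map f₂ g₂ y
        + parity (GSym.map f₁ g₁ x) * koszul φ (GSym.map f₂ g₂ y) := by
  induction x using odd_induction with
  | add x y hx hy => simp only [map_add, add_mul, hx, hy]; abel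
  | odd_mul e x hx =>
    rw [map_mul (GSym.map f₁ g₁), map_odd, mul_assoc, koszul_odd_mul, koszul_odd_mul, hx,
      evenOp_mul_map _ f₂ g₂ (h₁ e), map_mul, parity_odd, mul_add, sub_mul, GSym.neg_mul, GSym.neg_mul,
      mul_assoc, mul_assoc]
    abel
  | even s =>
    rw [map_even, koszul_even, zero_mul, zero_add, parity_even]
    induction y using odd_induction with
    | even t => rw [map_even, ← map_mul, koszul_even, koszul_even, mul_zero]
    | add x y hx hy => simp only [map_add, mul_add, hx, hy]
    | odd_mul e y hy =>
      have := evenOp_mul_map (φ (f₂ e)) (E' := E₁) f₁ g₁ (h₂ e) (GSym.map f₂ g₂ y) (even s)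
      rw [map_even, ← even_commute, ← even_commute] at this
      rw [map_mul (GSym.map f₂ g₂), map_odd, ← mul_assoc, even_commute, mul_assoc, koszul_odd_mul, hy, this,
        koszul_odd_mul, mul_sub, ← mul_assoc (odd _), ← even_commute, mul_assoc]

/-- When every `φ e` is linear over all even words, `koszul φ` is an odd derivation. This covers
`raise` and the contraction with a fixed even letter. -/
theorem koszul_mul (φ : E →ₗ[ℂ] Module.End ℂ (SymmetricAlgebra ℂ V))
    (h : ∀ e s t, φ e (s * t) = φ e s * t) (x y : GSym E V) :
    koszul φ (x * y) = koszul φ x * y + parity x * koszul φ y := by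
  simpa using koszul_map_mul_map φ LinearMap.id LinearMap.id LinearMap.id LinearMap.id
    (by simpa using h) (by simpa using h) x y

theorem evenOp_mulLeft (s : SymmetricAlgebra ℂ V) (x : GSym E V) :
    evenOp (LinearMap.mulLeft ℂ s) x = even s * x := by
  induction x using odd_induction with
  | even t => simp
  | add x y hx hy => simp only [map_add, mul_add, hx, hy]
  | odd_mul e x hx => rw [evenOp_odd_mul, hx, ← mul_assoc, ← mul_assoc, even_commute]

theorem evenOp_derivation (T : Module.End ℂ (SymmetricAlgebra ℂ V))
    (h : ∀ s t, T (s * t) = s * T t + t * T s) (x y : GSym E V) :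
    evenOp T (x * y) = evenOp T x * y + x * evenOp T y := by
  induction x using odd_induction with
  | add x y hx hy => simp only [add_mul, map_add, hx, hy]; abel
  | odd_mul e x hx => simp [mul_assoc, hx, mul_add]
  | even s =>
    induction y using odd_induction with
    | even t =>
      rw [← map_mul, evenOp_even, h, evenOp_even, evenOp_even, map_add, map_mul, map_mul,
        even_commute t, add_comm]
    | add x y hx hy => simp only [mul_add, map_add, hx, hy]; abel
    | odd_mul e y hy =>
      rw [← mul_assoc, even_commute, mul_assoc, evenOp_odd_mul, hy, evenOp_even, evenOp_odd_mul,
        mul_add, ← mul_assoc, ← mul_assoc, ← mul_assoc, ← mul_assoc, even_commute, even_commute]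

end GSym

end GradedSymmetric

end OffShellQM

end

/-! ### Koszul operators of second order. -/

noncomputable section

namespace OffShellQM

section GradedSymmetric

variable {E V : Type} [AddCommGroup E] [Module ℂ E] [AddCommGroup V] [Module ℂ V]

namespace GSym

/-- The commutator of `koszul φ` with the letter `v` contracts `v` with the odd letters. It is again
a Koszul operator, now with scalar coefficients and hence a derivation. -/
theorem even_mul_koszul (φ : E →ₗ[ℂ] Module.End ℂ (SymmetricAlgebra ℂ V)) (c : E →ₗ[ℂ] ℂ)
    (v : V)
    (h : ∀ e s, φ e (SymmetricAlgebra.ι ℂ V v * s) = SymmetricAlgebra.ι ℂ V v * φ e s + c e • s)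
    (x : GSym E V) :
    koszul φ (even (SymmetricAlgebra.ι ℂ V v) * x) = even (SymmetricAlgebra.ι ℂ V v) * koszul φ x
      + koszul (c.smulRight 1) x := by
  have hT : ∀ (e : E) (x : GSym E V), evenOp (φ e) (even (SymmetricAlgebra.ι ℂ V v) * x)
      = even (SymmetricAlgebra.ι ℂ V v) * evenOp (φ e) x + evenOp (c.smulRight 1 e) x := by
    intro e x
    induction x using odd_induction with
    | even s =>
      rw [← map_mul, evenOp_even, h, evenOp_even, evenOp_even, map_add, map_mul]
      rfl
    | add x y hx hy => simp only [mul_add, map_add, hx, hy]; abel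
    | odd_mul g x hx =>
      rw [← mul_assoc, even_commute, mul_assoc, evenOp_odd_mul, evenOp_odd_mul, evenOp_odd_mul, hx,
        mul_add, ← mul_assoc, ← mul_assoc, even_commute]
  induction x using odd_induction with
  | even s => rw [← map_mul even, koszul_even, koszul_even, koszul_even, mul_zero, add_zero]
  | add x y hx hy => simp only [mul_add, map_add, hx, hy]; abel
  | odd_mul g x hx =>
    rw [← mul_assoc, even_commute, mul_assoc, koszul_odd_mul, koszul_odd_mul, koszul_odd_mul, hx,
      hT, mul_sub, mul_add, ← mul_assoc (odd g), ← even_commute, mul_assoc]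
    abel

/-- An operator is of second order when its commutators with letters are of first order. Here the
commutator with an odd letter is a derivation plus a multiplication, and with an even letter it is
the derivation of `even_mul_koszul`; the identity then follows by induction on the letters of `x`.
-/
theorem koszul_second_order (φ : E →ₗ[ℂ] Module.End ℂ (SymmetricAlgebra ℂ V))
    (D : E → Module.End ℂ (SymmetricAlgebra ℂ V)) (hD : ∀ e s t, D e (s * t) = s * D e t + t * D e s)
    (u : E → SymmetricAlgebra ℂ V) (hφ : ∀ e s, φ e s = D e s + u e * s)
    (c : V → E →ₗ[ℂ] ℂ) (hc : ∀ v e, D e (SymmetricAlgebra.ι ℂ V v) = algebraMap ℂ _ (c v e))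
    {p q : ℤ} {x y : GSym E V} (hx : x ∈ grading E V p) (hy : y ∈ grading E V q) (z : GSym E V) :
    koszul φ (x * y * z) = koszul φ (x * y) * z + ((-1 : ℂ) ^ p) • (x * koszul φ (y * z))
      + ((-1 : ℂ) ^ ((p + 1) * q)) • (y * koszul φ (x * z)) - koszul φ x * y * z
      - ((-1 : ℂ) ^ p) • (x * koszul φ y * z) - ((-1 : ℂ) ^ (p + q)) • (x * y * koszul φ z) := by
  have hφ' : ∀ e (w : GSym E V), evenOp (φ e) w = evenOp (D e) w + even (u e) * w := by
    intro e w
    induction w using odd_induction with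
    | even s => rw [evenOp_even, evenOp_even, hφ, map_add, map_mul]
    | add x y hx hy => simp only [map_add, mul_add, hx, hy]; abel
    | odd_mul g x hx =>
      rw [evenOp_odd_mul, evenOp_odd_mul, hx, mul_add, ← mul_assoc (even _), even_commute (u e) (odd g),
        mul_assoc]
  have hv : ∀ v (w : GSym E V), koszul φ (even (SymmetricAlgebra.ι ℂ V v) * w)
      = even (SymmetricAlgebra.ι ℂ V v) * koszul φ w + koszul ((c v).smulRight 1) w := by
    intro v w
    refine even_mul_koszul φ (c v) v (fun e s => ?_) w
    rw [hφ, hφ, hD, hc, Algebra.smul_def]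
    ring
  have hneg : ((-1 : ℂ)) ≠ 0 := by simp
  -- The next three rules move `y` to the right of `x`, of odd letters and of even words, so that
  -- all terms reach one normal form.
  have hyx : ∀ {p : ℤ} {x : GSym E V}, x ∈ grading E V p →
      ∀ w, y * (x * w) = ((-1 : ℂ) ^ (p * q)) • (x * (y * w)) := by
    intro p x hx w
    rw [← mul_assoc, graded_comm hy hx, smul_mul_assoc, mul_assoc, mul_comm q p]
  have hyg : ∀ g w, y * (odd g * w) = ((-1 : ℂ) ^ q) • (odd g * (y * w)) := by
    intro g w
    rw [← mul_assoc, odd_mul_eq g hy, smul_mul_assoc, mul_assoc]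
  have hyu : ∀ s w, y * (even s * w) = even s * (y * w) := by
    intro s w
    rw [← mul_assoc, ← even_commute, mul_assoc]
  have hT := fun e => evenOp_derivation (E := E) (D e) (hD e)
  refine grading_letter_induction (P := fun p x => koszul φ (x * y * z)
      = koszul φ (x * y) * z + ((-1 : ℂ) ^ p) • (x * koszul φ (y * z))
      + ((-1 : ℂ) ^ ((p + 1) * q)) • (y * koszul φ (x * z)) - koszul φ x * y * z
      - ((-1 : ℂ) ^ p) • (x * koszul φ y * z) - ((-1 : ℂ) ^ (p + q)) • (x * y * koszul φ z))
      ?_ ?_ ?_ ?_ ?_ ?_ hx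
  · have h1 : koszul φ (1 : GSym E V) = 0 := by
      rw [← map_one (even : SymmetricAlgebra ℂ V →ₐ[ℂ] GSym E V), koszul_even]
    simp only [h1, one_mul, zpow_zero, one_smul, zero_add, zero_mul, sub_zero]
    abel
  · simp
  · intro p x x' h h'
    simp only [add_mul, mul_add, map_add, h, h', smul_add]
    abel
  · intro p r x h
    simp only [smul_mul_assoc, mul_smul_comm, map_smul, h, smul_add, smul_sub, smul_comm _ r]
  · intro p g x hx h
    have e₁ : ((-1 : ℂ) ^ (p - 1)) = -(-1) ^ p := by rw [zpow_sub_one₀ hneg]; simp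
    have e₂ : ((-1 : ℂ) ^ (p - 1 + q)) = -((-1) ^ p * (-1) ^ q) := by
      rw [zpow_add₀ hneg, e₁]; ring
    have e₃ : ((-1 : ℂ) ^ ((p - 1 + 1) * q)) = (-1) ^ (p * q) := by ring_nf
    have e₄ : ((-1 : ℂ) ^ ((p + 1) * q)) = (-1) ^ (p * q) * (-1) ^ q := by
      rw [add_mul, zpow_add₀ hneg, one_mul]
    have e₅ : ((-1 : ℂ) ^ (p * q)) * ((-1) ^ (p * q)) = 1 := by
      rw [← zpow_add₀ hneg, ← two_mul, zpow_mul]; simp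
    rw [e₁, e₂, e₃]
    rw [e₄, zpow_add₀ hneg] at h
    simp only [mul_assoc] at h ⊢
    simp only [koszul_odd_mul, hφ', h, hT, mul_add, mul_sub, add_mul, sub_mul, mul_assoc,
      hyg, hyu, hyx hx, hyx (evenOp_mem (D g) hx), mul_smul_comm, smul_add,
      smul_sub, smul_smul, e₅]
    module
  · intro p v x hx h
    have hder := fun x y => koszul_mul (E := E) (V := V) ((c v).smulRight 1) (fun e s t => by simp) x y
    have e₄ : ((-1 : ℂ) ^ ((p + 1) * q)) = (-1) ^ (p * q) * (-1) ^ q := by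
      rw [add_mul, zpow_add₀ hneg, one_mul]
    have hsq : ∀ n : ℤ, (-1 : ℂ) ^ n = 1 ∨ (-1 : ℂ) ^ n = -1 := fun n => by
      rw [← mul_self_eq_one_iff, ← zpow_add₀ hneg, ← two_mul, zpow_mul]
      simp
    have hyc := hyx (koszul_mem ((c v).smulRight 1) hx)
    rw [add_mul p 1 q, zpow_add₀ hneg, one_mul] at hyc
    rw [e₄, zpow_add₀ hneg] at h ⊢
    simp only [mul_assoc] at h ⊢
    simp only [hv, h, hder, parity_eq hx, parity_eq hy, mul_add, mul_sub, add_mul,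
      mul_assoc, hyu, hyx hx, hyc, mul_smul_comm, smul_mul_assoc, smul_add, smul_smul]
    -- Only the values `±1` of the signs `(-1)^(pq)` and `(-1)^q` matter for the remaining
    -- cancellation.
    rcases hsq (p * q) with h₁ | h₁ <;> rcases hsq q with h₂ | h₂ <;> simp only [h₁, h₂] <;> module

end GSym

end GradedSymmetric

end OffShellQM

end

/-! ### The contracting homotopy of the Koszul complex. -/

noncomputable section

namespace OffShellQM

section GradedSymmetric

variable {E V : Type} [AddCommGroup E] [Module ℂ E] [AddCommGroup V] [Module ℂ V]

namespace GSym

/-- The derivation of degree `-1` that extends a linear map `h` from the even to the odd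
letters. -/
def lower (h : V →ₗ[ℂ] E) : GSym E V →ₗ[ℂ] GSym E V :=
  TensorProduct.lift ((LinearMap.mul ℂ (GSym E V)).flip.compl₂ (odd ∘ₗ h)) ∘ₗ
    (TensorProduct.assoc ℂ _ _ _).symm.toLinearMap ∘ₗ
    LinearMap.lTensor (ExteriorAlgebra ℂ E) symD

theorem lower_one (h : V →ₗ[ℂ] E) : lower h 1 = 0 := by
  simp [lower, Algebra.TensorProduct.one_def]

theorem lower_odd_mul (h : V →ₗ[ℂ] E) (g : E) (x : GSym E V) :
    lower h (odd g * x) = -(odd g * lower h x) := by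
  induction x using TensorProduct.induction_on with
  | zero => simp
  | add x y hx hy => simp only [mul_add, map_add, hx, hy, neg_add]
  | tmul a s =>
    rw [odd_mul_tmul]
    simp only [lower, LinearMap.comp_apply, LinearMap.lTensor_tmul, LinearEquiv.coe_coe]
    induction symD s using TensorProduct.induction_on with
    | zero => simp
    | add z w hz hw => simp only [TensorProduct.tmul_add, map_add, mul_add, neg_add, hz, hw]
    | tmul t v =>
      simp only [TensorProduct.assoc_symm_tmul, TensorProduct.lift.tmul, LinearMap.compl₂_apply,
        LinearMap.flip_apply, LinearMap.mul_apply', LinearMap.comp_apply]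
      rw [← odd_mul_tmul, ← mul_assoc, ← mul_assoc, odd_mul_odd, GSym.neg_mul]

theorem lower_even_mul (h : V →ₗ[ℂ] E) (v : V) (x : GSym E V) :
    lower h (even (SymmetricAlgebra.ι ℂ V v) * x)
      = even (SymmetricAlgebra.ι ℂ V v) * lower h x + odd (h v) * x := by
  induction x using TensorProduct.induction_on with
  | zero => simp
  | add x y hx hy => simp only [mul_add, map_add, hx, hy]; abel
  | tmul a s =>
    rw [even_mul_tmul]
    simp only [lower, LinearMap.comp_apply, LinearMap.lTensor_tmul, LinearEquiv.coe_coe, symD_mul,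
      symD_ι, TensorProduct.tmul_add, map_add]
    congr 1
    · induction symD s using TensorProduct.induction_on with
      | zero => simp
      | add z w hz hw => simp only [TensorProduct.tmul_add, map_add, mul_add, smul_add, hz, hw]
      | tmul t w =>
        simp only [TensorProduct.smul_tmul', smul_eq_mul, TensorProduct.assoc_symm_tmul,
          TensorProduct.lift.tmul, LinearMap.compl₂_apply,
          LinearMap.flip_apply, LinearMap.mul_apply', LinearMap.comp_apply]
        rw [← even_mul_tmul, ← mul_assoc, ← mul_assoc, even_commute]
    · simp [TensorProduct.smul_tmul']

/-- The derivation that extends a linear map `d` from the odd to the even letters. -/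
abbrev raise (d : E →ₗ[ℂ] V) : GSym E V →ₗ[ℂ] GSym E V :=
  koszul (LinearMap.mul ℂ (SymmetricAlgebra ℂ V) ∘ₗ SymmetricAlgebra.ι ℂ V ∘ₗ d)

theorem raise_odd_mul (d : E →ₗ[ℂ] V) (g : E) (x : GSym E V) :
    raise d (odd g * x) = even (SymmetricAlgebra.ι ℂ V (d g)) * x - odd g * raise d x := by
  rw [koszul_odd_mul]
  exact congrArg (· - _) (evenOp_mulLeft _ x)

theorem raise_even_mul (d : E →ₗ[ℂ] V) (s : SymmetricAlgebra ℂ V) (x : GSym E V) :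
    raise d (even s * x) = even s * raise d x := by
  rw [raise, koszul_mul _ (by simp [mul_assoc])]
  simp

theorem raise_one (d : E →ₗ[ℂ] V) : raise d 1 = 0 := by
  rw [← map_one (even : SymmetricAlgebra ℂ V →ₐ[ℂ] GSym E V), koszul_even]

theorem raise_raise (d : E →ₗ[ℂ] V) (x : GSym E V) : raise d (raise d x) = 0 := by
  refine koszul_koszul _ (fun g g' => ?_) x
  ext s
  simp [mul_left_comm]

/-- The anticommutator of `raise d` and `lower h`; if `h` is a left inverse of `d`, it counts the
odd letters and the even letters in the range of `d`. -/
def counting (d : E →ₗ[ℂ] V) (h : V →ₗ[ℂ] E) : Module.End ℂ (GSym E V) :=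
  raise d ∘ₗ lower h + lower h ∘ₗ raise d

theorem counting_apply (d : E →ₗ[ℂ] V) (h : V →ₗ[ℂ] E) (x : GSym E V) :
    counting d h x = raise d (lower h x) + lower h (raise d x) := rfl

theorem counting_one (d : E →ₗ[ℂ] V) (h : V →ₗ[ℂ] E) : counting d h 1 = 0 := by
  rw [counting_apply, lower_one, raise_one, map_zero, map_zero, add_zero]

/-- The anticommutator of two odd derivations is an even derivation; on odd letters it is `h ∘ d`,
on even letters `d ∘ h`. -/
theorem counting_odd_mul (d : E →ₗ[ℂ] V) (h : V →ₗ[ℂ] E) (g : E) (x : GSym E V) :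
    counting d h (odd g * x) = odd g * counting d h x + odd (h (d g)) * x := by
  simp only [counting_apply, lower_odd_mul, raise_odd_mul, map_neg, map_sub, lower_even_mul,
    mul_add]
  abel

theorem counting_even_mul (d : E →ₗ[ℂ] V) (h : V →ₗ[ℂ] E) (v : V) (x : GSym E V) :
    counting d h (even (SymmetricAlgebra.ι ℂ V v) * x)
      = even (SymmetricAlgebra.ι ℂ V v) * counting d h x
        + even (SymmetricAlgebra.ι ℂ V (d (h v))) * x := by
  simp only [counting_apply, lower_even_mul, raise_even_mul, map_add, raise_odd_mul, mul_add]
  abel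

theorem raise_counting (d : E →ₗ[ℂ] V) (h : V →ₗ[ℂ] E) (x : GSym E V) :
    raise d (counting d h x) = counting d h (raise d x) := by
  simp only [counting_apply, map_add, raise_raise, zero_add, add_zero, map_zero]

variable {d : E →ₗ[ℂ] V} {h : V →ₗ[ℂ] E}

/-- Eigenvalues add under products. An odd letter has eigenvalue `1`, and an even letter splits as
`(v - d (h v)) + d (h v)` with eigenvalues `0` and `1`. -/
theorem mem_iSup_eigenspace_counting (hd : ∀ e, h (d e) = e) (x : GSym E V) :
    x ∈ ⨆ n : ℕ, (counting d h).eigenspace (n : ℂ) := by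
  induction x using letter_induction with
  | one =>
    refine Submodule.mem_iSup_of_mem 0 ?_
    rw [Module.End.mem_eigenspace_iff, counting_one]
    simp
  | add x y hx hy => exact add_mem hx hy
  | smul c x hx => exact Submodule.smul_mem _ c hx
  | odd_mul g x hx =>
    refine Submodule.iSup_induction _ (motive := fun x => odd g * x ∈ _) hx (fun n y hy => ?_)
      (by simp) fun y z hy hz => by rw [mul_add]; exact add_mem hy hz
    refine Submodule.mem_iSup_of_mem (n + 1) ?_
    rw [Module.End.mem_eigenspace_iff] at hy ⊢
    rw [counting_odd_mul, hy, hd, mul_smul_comm, Nat.cast_succ, add_smul, one_smul]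
  | even_mul v x hx =>
    refine Submodule.iSup_induction _ (motive := fun x => even _ * x ∈ _) hx (fun n y hy => ?_)
      (by simp) fun y z hy hz => by rw [mul_add]; exact add_mem hy hz
    obtain ⟨u, w, rfl, hu, hw⟩ : ∃ u w, v = u + w ∧ h u = 0 ∧ d (h w) = w :=
      ⟨v - d (h v), d (h v), by simp, by simp [hd], by simp [hd]⟩
    rw [Module.End.mem_eigenspace_iff] at hy
    rw [map_add, map_add, add_mul]
    refine add_mem (Submodule.mem_iSup_of_mem n ?_) (Submodule.mem_iSup_of_mem (n + 1) ?_)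
    · rw [Module.End.mem_eigenspace_iff, counting_even_mul, hy, hu, map_zero, map_zero, map_zero,
        zero_mul, add_zero, mul_smul_comm]
    · rw [Module.End.mem_eigenspace_iff, counting_even_mul, hy, hw, mul_smul_comm, Nat.cast_succ,
        add_smul, one_smul]

/-- The words of eigenvalue `0` are those in the even letters of `ker h`, and `ψ ∘ proj π` is the
projection onto them; the remainder has only positive eigenvalues. -/
theorem sub_mem_iSup_eigenspace_counting (hd : ∀ e, h (d e) = e) {A : Type} [CommRing A]
    [Algebra ℂ A] (π : V →ₗ[ℂ] A) (ψ : A →ₐ[ℂ] SymmetricAlgebra ℂ V)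
    (hψ : ∀ v, ψ (π v) = SymmetricAlgebra.ι ℂ V (v - d (h v))) (x : GSym E V) :
    x - even (ψ (GSym.proj π x)) ∈ ⨆ n : ℕ, (counting d h).eigenspace ((n : ℂ) + 1) := by
  induction x using letter_induction with
  | one => simp
  | add x y hx hy =>
    simp only [map_add, add_sub_add_comm]
    exact add_mem hx hy
  | smul c x hx =>
    have e : c • x - even (ψ (GSym.proj π (c • x))) = c • (x - even (ψ (GSym.proj π x))) := by
      simp only [map_smul]
      exact (smul_sub _ _ _).symm
    rw [e]
    exact Submodule.smul_mem _ c hx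
  | odd_mul g x hx =>
    simp only [map_mul, proj_odd, zero_mul, map_zero, sub_zero]
    refine Submodule.iSup_induction _ (motive := fun x => odd g * x ∈ _)
      (mem_iSup_eigenspace_counting hd x) (fun n y hy => ?_)
      (by simp) fun y z hy hz => by rw [mul_add]; exact add_mem hy hz
    refine Submodule.mem_iSup_of_mem n ?_
    rw [Module.End.mem_eigenspace_iff] at hy ⊢
    rw [counting_odd_mul, hy, hd, mul_smul_comm, add_smul, one_smul]
  | even_mul v x hx =>
    -- The first summand on the right has positive eigenvalues because of the letter `d (h v)`, the
    -- second because of its last factor.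
    have e : even (SymmetricAlgebra.ι ℂ V v) * x
          - even (ψ (GSym.proj π (even (SymmetricAlgebra.ι ℂ V v) * x)))
        = even (SymmetricAlgebra.ι ℂ V (d (h v))) * x
          + even (SymmetricAlgebra.ι ℂ V (v - d (h v))) * (x - even (ψ (GSym.proj π x))) := by
      rw [map_mul, proj_even, SymmetricAlgebra.lift_ι_apply, map_mul, map_mul, hψ, map_sub,
        map_sub, mul_sub]
      simp only [sub_mul]
      abel
    rw [e]
    refine add_mem ?_ ?_
    · refine Submodule.iSup_induction _ (motive := fun x => even _ * x ∈ _)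
        (mem_iSup_eigenspace_counting hd x) (fun n y hy => ?_)
        (by simp) fun y z hy hz => by rw [mul_add]; exact add_mem hy hz
      refine Submodule.mem_iSup_of_mem n ?_
      rw [Module.End.mem_eigenspace_iff] at hy ⊢
      rw [counting_even_mul, hy, hd, mul_smul_comm, add_smul, one_smul]
    · refine Submodule.iSup_induction _ (motive := fun x => even _ * x ∈ _)
        hx (fun n y hy => ?_)
        (by simp) fun y z hy hz => by rw [mul_add]; exact add_mem hy hz
      refine Submodule.mem_iSup_of_mem n ?_
      rw [Module.End.mem_eigenspace_iff] at hy ⊢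
      rw [counting_even_mul, hy, map_sub h, hd, mul_smul_comm]
      simp

/-- The Koszul complex of an injective map `d` with quotient `π` is acyclic on the kernel of the
projection to the polynomial functions on the quotient. -/
theorem exists_eq_raise (hd : ∀ e, h (d e) = e) {A : Type} [CommRing A]
    [Algebra ℂ A] (π : V →ₗ[ℂ] A) (ψ : A →ₐ[ℂ] SymmetricAlgebra ℂ V)
    (hψ : ∀ v, ψ (π v) = SymmetricAlgebra.ι ℂ V (v - d (h v))) (x : GSym E V)
    (hx : raise d x = 0) (hp : GSym.proj π x = 0) : ∃ v, x = raise d v := by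
  classical
  have hmem := sub_mem_iSup_eigenspace_counting hd π ψ hψ x
  rw [hp, map_zero, map_zero, sub_zero, Submodule.mem_iSup_iff_exists_dfinsupp'] at hmem
  obtain ⟨f, rfl⟩ := hmem
  have hinj : Function.Injective fun n : ℕ => (n : ℂ) + 1 := fun m n hmn => by
    simpa using hmn
  have hind := (Module.End.eigenspaces_iSupIndep (counting d h)).comp hinj
  -- Since `raise d` commutes with `counting`, independence of the eigenspaces makes each
  -- eigencomponent of a closed element closed.
  have hf : ∀ n : ℕ, raise d (f n) = 0 := by
    have hmap : ∀ n : ℕ, raise d (f n) ∈ (counting d h).eigenspace ((n : ℂ) + 1) := by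
      intro n
      have := (f n).2
      rw [Module.End.mem_eigenspace_iff] at this ⊢
      rw [← raise_counting, this, map_smul]
    have hsum : ∑ n ∈ f.support, raise d (f n) = 0 := by
      rw [← map_sum]
      exact hx
    intro n
    by_cases hn : n ∈ f.support
    · exact (iSupIndep_iff_finsetSum_eq_zero_imp_eq_zero _).mp hind f.support _ (fun i _ => hmap i) hsum n hn
    · rw [DFinsupp.notMem_support_iff.mp hn]; simp
  -- On a closed element of eigenvalue `n + 1` the anticommutator reduces to `raise d ∘ lower h`, so
  -- dividing by `n + 1` yields a primitive.
  refine ⟨∑ n ∈ f.support, ((n : ℂ) + 1)⁻¹ • lower h (f n), ?_⟩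
  rw [map_sum]
  refine Finset.sum_congr rfl fun n _ => ?_
  have := (f n).2
  rw [Module.End.mem_eigenspace_iff, counting_apply, hf, map_zero, add_zero] at this
  rw [map_smul, this, smul_smul, inv_mul_cancel₀ (Nat.cast_add_one_ne_zero n), one_smul]

end GSym

end GradedSymmetric

end OffShellQM

end

/-! ### Green's identity, uniqueness and regularity of the propagator. -/

noncomputable section

namespace OffShellQM

namespace Oscillator

variable (S : Oscillator)

/-- Smoothness up to the boundary. -/
abbrev SmoothOn (f : ℝ → ℂ) : Prop := ContDiffOn ℝ ((⊤ : ℕ∞) : WithTop ℕ∞) f S.interval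

variable {S}

theorem ti_mem : S.ti ∈ S.interval := Set.left_mem_Icc.mpr S.ti_lt_tf.le

theorem tf_mem : S.tf ∈ S.interval := Set.right_mem_Icc.mpr S.ti_lt_tf.le

theorem SmoothOn.hasDerivWithinAt {f : ℝ → ℂ} (hf : S.SmoothOn f) {t : ℝ} (ht : t ∈ S.interval) :
    HasDerivWithinAt f (S.ddt f t) S.interval t :=
  ((hf.differentiableOn (by simp)) t ht).hasDerivWithinAt

theorem SmoothOn.hasDerivAt {f : ℝ → ℂ} (hf : S.SmoothOn f) {t : ℝ} (ht : t ∈ Set.Ioo S.ti S.tf) :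
    HasDerivAt f (S.ddt f t) t :=
  (hf.hasDerivWithinAt (Set.Ioo_subset_Icc_self ht)).hasDerivAt (Icc_mem_nhds ht.1 ht.2)

theorem ddt_eq {f : ℝ → ℂ} {f' : ℂ} {t : ℝ} (ht : t ∈ S.interval)
    (h : HasDerivWithinAt f f' S.interval t) : S.ddt f t = f' :=
  h.derivWithin (S.uniqueDiff t ht)

theorem oscOp_apply (f : ℝ → ℂ) {t : ℝ} (ht : t ∈ S.interval) :
    S.oscOp f t = S.ddt (S.ddt f) t + (S.freq : ℂ) ^ 2 * f t :=
  Set.indicator_of_mem ht _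

theorem SmoothOn.oscOp {f : ℝ → ℂ} (hf : S.SmoothOn f) : S.SmoothOn (S.oscOp f) :=
  ContDiffOn.congr ((ddt_contDiffOn (ddt_contDiffOn hf)).add (contDiffOn_const.mul hf))
    fun _ ht => oscOp_apply f ht

theorem pairing_congr {f f' g g' : ℝ → ℂ}
    (h : ∀ t ∈ S.interval, f t * g t = f' t * g' t) : S.pairing f g = S.pairing f' g' := by
  refine intervalIntegral.integral_congr fun t ht => ?_
  rw [Set.uIcc_of_le S.ti_lt_tf.le] at ht
  exact h t ht

/-- Green's identity for `d²/dt² + ω²`. -/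
theorem pairing_oscOp_sub {u w : ℝ → ℂ} (hu : S.SmoothOn u) (hw : S.SmoothOn w) :
    S.pairing (S.oscOp u) w - S.pairing u (S.oscOp w)
      = (S.ddt u S.tf * w S.tf - u S.tf * S.ddt w S.tf)
        - (S.ddt u S.ti * w S.ti - u S.ti * S.ddt w S.ti) := by
  have hu' := ddt_contDiffOn hu
  have hw' := ddt_contDiffOn hw
  have hint := intervalIntegral.integral_eq_sub_of_hasDerivAt_of_le S.ti_lt_tf.le
    (f := fun t => S.ddt u t * w t - u t * S.ddt w t)
    (f' := fun t => S.oscOp u t * w t - u t * S.oscOp w t)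
    ((hu'.continuousOn.mul hw.continuousOn).sub (hu.continuousOn.mul hw'.continuousOn))
    (fun t ht => by
      refine (((SmoothOn.hasDerivAt hu' ht).mul (SmoothOn.hasDerivAt hw ht)).sub
        ((SmoothOn.hasDerivAt hu ht).mul (SmoothOn.hasDerivAt hw' ht))).congr_deriv ?_
      rw [oscOp_apply u (Set.Ioo_subset_Icc_self ht), oscOp_apply w (Set.Ioo_subset_Icc_self ht)]
      ring)
    ((S.integrable_mul (SmoothOn.oscOp hu).continuousOn hw.continuousOn).sub
      (S.integrable_mul hu.continuousOn (SmoothOn.oscOp hw).continuousOn))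
  rw [← hint]
  exact (intervalIntegral.integral_sub
    (S.integrable_mul (SmoothOn.oscOp hu).continuousOn hw.continuousOn)
    (S.integrable_mul hu.continuousOn (SmoothOn.oscOp hw).continuousOn)).symm

/-! ### The exponential solutions -/

theorem hasDerivAt_cexp_mul (c : ℂ) (t : ℝ) :
    HasDerivAt (fun t : ℝ => Complex.exp (c * t)) (c * Complex.exp (c * t)) t := by
  have h := ((Complex.ofRealCLM.hasDerivAt (x := t)).const_mul c).cexp
  simpa [mul_comm] using h

theorem contDiff_cexp_mul (c : ℂ) (n : WithTop ℕ∞) :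
    ContDiff ℝ n (fun t : ℝ => Complex.exp (c * t)) :=
  (contDiff_const.mul Complex.ofRealCLM.contDiff).cexp

variable (S) in
/-- The amplitude of `σ±`. -/
def amplitude : ℂ := (Real.sqrt (S.hbar / (2 * S.freq)) : ℂ)

theorem amplitude_sq : S.amplitude * S.amplitude = S.hbar / (2 * S.freq) := by
  have h : 0 ≤ S.hbar / (2 * S.freq) :=
    div_nonneg S.hbar_pos.le (mul_nonneg (by norm_num) S.freq_pos.le)
  rw [amplitude, ← Complex.ofReal_mul, Real.mul_self_sqrt h]
  push_cast
  rfl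

theorem freq_ne_zero : (S.freq : ℂ) ≠ 0 := Complex.ofReal_ne_zero.mpr S.freq_pos.ne'

theorem hbar_ne_zero : (S.hbar : ℂ) ≠ 0 := Complex.ofReal_ne_zero.mpr S.hbar_pos.ne'

theorem sigmaPlus_eq : S.sigmaPlus
    = fun t : ℝ => S.amplitude * Complex.exp (-(Complex.I * S.freq) * t) := by
  funext t
  rw [sigmaPlus, neg_mul]
  rfl

theorem sigmaMinus_eq : S.sigmaMinus
    = fun t : ℝ => S.amplitude * Complex.exp ((Complex.I * S.freq) * t) := rfl

theorem sigmaPlus_mul_sigmaMinus (t : ℝ) :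
    S.sigmaPlus t * S.sigmaMinus t = S.hbar / (2 * S.freq) := by
  rw [sigmaPlus_eq, sigmaMinus_eq, mul_mul_mul_comm, amplitude_sq, ← Complex.exp_add]
  simp

theorem hasDerivAt_sigmaPlus (t : ℝ) :
    HasDerivAt S.sigmaPlus (-(Complex.I * S.freq) * S.sigmaPlus t) t := by
  rw [sigmaPlus_eq]
  refine ((hasDerivAt_cexp_mul (-(Complex.I * S.freq)) t).const_mul S.amplitude).congr_deriv ?_
  ring

theorem hasDerivAt_sigmaMinus (t : ℝ) :
    HasDerivAt S.sigmaMinus ((Complex.I * S.freq) * S.sigmaMinus t) t := by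
  rw [sigmaMinus_eq]
  refine ((hasDerivAt_cexp_mul (Complex.I * S.freq) t).const_mul S.amplitude).congr_deriv ?_
  ring

theorem smoothOn_sigmaPlus : S.SmoothOn S.sigmaPlus := by
  rw [sigmaPlus_eq]
  exact (contDiff_const.mul (contDiff_cexp_mul _ _)).contDiffOn

theorem smoothOn_sigmaMinus : S.SmoothOn S.sigmaMinus := by
  rw [sigmaMinus_eq]
  exact (contDiff_const.mul (contDiff_cexp_mul _ _)).contDiffOn

/-- An eigenfunction of `d/dt` with eigenvalue `c`, `c² = -ω²`, solves the equation of motion. -/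
theorem ddt_ddt_of_hasDerivAt {σ : ℝ → ℂ} {c : ℂ} (hσ : ∀ t, HasDerivAt σ (c * σ t) t) {t : ℝ}
    (ht : t ∈ S.interval) : S.ddt (S.ddt σ) t = c * (c * σ t) := by
  rw [S.ddt_congr (g := fun t => c * σ t) (fun s hs => ddt_eq hs (hσ s).hasDerivWithinAt) ht]
  exact ddt_eq ht ((hσ t).const_mul c).hasDerivWithinAt

theorem oscOp_of_hasDerivAt {σ : ℝ → ℂ} {c : ℂ} (hc : c * c = -(S.freq : ℂ) ^ 2)
    (hσ : ∀ t, HasDerivAt σ (c * σ t) t) : S.oscOp σ = 0 := by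
  funext t
  by_cases ht : t ∈ S.interval
  · rw [oscOp_apply _ ht, ddt_ddt_of_hasDerivAt hσ ht, ← mul_assoc, hc]
    simp
  · exact Set.indicator_of_notMem ht _

theorem I_freq_sq : (Complex.I * S.freq) * (Complex.I * S.freq) = -(S.freq : ℂ) ^ 2 := by
  rw [mul_mul_mul_comm, Complex.I_mul_I]
  ring

theorem oscOp_sigmaPlus : S.oscOp S.sigmaPlus = 0 :=
  oscOp_of_hasDerivAt (by rw [neg_mul_neg, I_freq_sq]) hasDerivAt_sigmaPlus

theorem oscOp_sigmaMinus : S.oscOp S.sigmaMinus = 0 :=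
  oscOp_of_hasDerivAt I_freq_sq hasDerivAt_sigmaMinus

theorem ddt_sigmaPlus {t : ℝ} (ht : t ∈ S.interval) :
    S.ddt S.sigmaPlus t = -(Complex.I * S.freq) * S.sigmaPlus t :=
  ddt_eq ht (hasDerivAt_sigmaPlus t).hasDerivWithinAt

theorem ddt_sigmaMinus {t : ℝ} (ht : t ∈ S.interval) :
    S.ddt S.sigmaMinus t = (Complex.I * S.freq) * S.sigmaMinus t :=
  ddt_eq ht (hasDerivAt_sigmaMinus t).hasDerivWithinAt

theorem pairing_zero_right (f : ℝ → ℂ) : S.pairing f 0 = 0 := by simp [pairing]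

/-! ### Boundary conditions and uniqueness -/

variable (S) in
/-- The boundary conditions `∂₋ f(tᵢ) = 0` and `∂₊ f(t_f) = 0`. -/
def IsBdry (f : ℝ → ℂ) : Prop :=
  S.ddt f S.ti - Complex.I * S.freq * f S.ti = 0 ∧ S.ddt f S.tf + Complex.I * S.freq * f S.tf = 0

/-- At each endpoint the boundary conditions fix the same ratio of derivative to value for `u` and
`w`, so their Wronskian vanishes there. -/
theorem pairing_oscOp_comm {u w : ℝ → ℂ} (hu : S.SmoothOn u) (hw : S.SmoothOn w)
    (hu' : S.IsBdry u) (hw' : S.IsBdry w) :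
    S.pairing (S.oscOp u) w = S.pairing u (S.oscOp w) := by
  have h := pairing_oscOp_sub hu hw
  rw [sub_eq_zero.mp hu'.1, sub_eq_zero.mp hw'.1, eq_neg_of_add_eq_zero_left hu'.2,
    eq_neg_of_add_eq_zero_left hw'.2] at h
  refine sub_eq_zero.mp (h.trans ?_)
  ring

theorem eqOn_zero_of_ddt_eq {v : ℝ → ℂ} {c : ℂ} (hv : S.SmoothOn v)
    (h : ∀ t ∈ S.interval, S.ddt v t = c * v t) {t₀ : ℝ} (ht₀ : t₀ ∈ S.interval) (h₀ : v t₀ = 0) :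
    ∀ t ∈ S.interval, v t = 0 := by
  have hd : ∀ t ∈ S.interval,
      HasDerivWithinAt (fun t : ℝ => v t * Complex.exp (-c * t)) 0 S.interval t := by
    intro t ht
    refine ((SmoothOn.hasDerivWithinAt hv ht).mul
      (hasDerivAt_cexp_mul (-c) t).hasDerivWithinAt).congr_deriv ?_
    rw [h t ht]
    ring
  have hc := constant_of_derivWithin_zero (fun t ht => (hd t ht).differentiableWithinAt)
    (fun t ht => ddt_eq (S := S) (Set.Ico_subset_Icc_self ht) (hd t (Set.Ico_subset_Icc_self ht)))
  intro t ht
  have := (hc t ht).trans (hc t₀ ht₀).symm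
  simp only [h₀, zero_mul] at this
  exact (mul_eq_zero.mp this).resolve_right (Complex.exp_ne_zero _)

/-- Factor `∂_t² + ω² = ∂₋∂₊`. The function `∂₊u` solves a first-order equation and vanishes at
`t_f`, hence is zero. Then `∂₊u` and `∂₋u` both vanish at `tᵢ`, so `2iω u(tᵢ) = 0`, and the
first-order equation `∂₊u = 0` gives `u = 0`. -/
theorem eqOn_zero_of_oscOp_eq_zero {u : ℝ → ℂ} (hu : S.SmoothOn u) (hu' : S.IsBdry u)
    (h : ∀ t ∈ S.interval, S.oscOp u t = 0) : ∀ t ∈ S.interval, u t = 0 := by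
  have hdu := ddt_contDiffOn hu
  have hw : S.SmoothOn (fun t => S.ddt u t + Complex.I * S.freq * u t) :=
    hdu.add (contDiffOn_const.mul hu)
  have h₁ := eqOn_zero_of_ddt_eq (c := Complex.I * S.freq) hw (fun t ht => by
    refine (ddt_eq ht ((SmoothOn.hasDerivWithinAt hdu ht).add
      ((SmoothOn.hasDerivWithinAt hu ht).const_mul (Complex.I * S.freq)))).trans ?_
    have := h t ht
    rw [oscOp_apply _ ht] at this
    linear_combination this + u t * I_freq_sq (S := S) * (-1)) tf_mem hu'.2
  refine eqOn_zero_of_ddt_eq (c := -(Complex.I * S.freq)) hu (fun t ht => ?_) ti_mem ?_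
  · linear_combination h₁ t ht
  · have e₁ := h₁ _ ti_mem
    have e₂ := hu'.1
    have : 2 * (Complex.I * S.freq) * u S.ti = 0 := by linear_combination e₁ - e₂
    simpa [S.freq_pos.ne'] using this

/-! ### The propagator -/

/-- Splitting at `s = t` removes the absolute value. The later half is written with base point
`t_f`, whence the minus sign, so that `t` is the upper limit of both integrals. -/
theorem propagator_eq {f : ℝ → ℂ} (hf : ContinuousOn f S.interval) {t : ℝ}
    (ht : t ∈ S.interval) :
    S.propagator f t = Complex.I / (2 * S.freq) *
      (Complex.exp (-(Complex.I * S.freq) * t) *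
          (∫ s in S.ti..t, Complex.exp (Complex.I * S.freq * s) * f s)
        - Complex.exp (Complex.I * S.freq * t) *
          (∫ s in S.tf..t, Complex.exp (-(Complex.I * S.freq) * s) * f s)) := by
  have hint : ∀ a ∈ S.interval, ∀ b ∈ S.interval, IntervalIntegrable
      (fun s => Complex.exp (-(Complex.I * S.freq * (|t - s| : ℝ))) * f s)
      MeasureTheory.volume a b := by
    intro a ha b hb
    refine (((S.kernel_cont t).continuousOn.mul hf).mono ?_).intervalIntegrable
    exact Set.uIcc_subset_Icc ha hb
  rw [propagator, ← intervalIntegral.integral_add_adjacent_intervals (hint _ ti_mem _ ht)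
    (hint _ ht _ tf_mem), intervalIntegral.integral_symm t S.tf (f := fun s => Complex.exp _ * f s),
    mul_neg, sub_neg_eq_add, ← intervalIntegral.integral_const_mul,
    ← intervalIntegral.integral_const_mul]
  congr 2
  · refine intervalIntegral.integral_congr fun s hs => ?_
    rw [Set.uIcc_of_le ht.1] at hs
    rw [abs_of_nonneg (sub_nonneg.mpr hs.2), ← mul_assoc, ← Complex.exp_add]
    push_cast
    ring_nf
  · refine intervalIntegral.integral_congr fun s hs => ?_
    rw [Set.uIcc_of_le ht.2] at hs
    rw [abs_of_nonpos (sub_nonpos.mpr hs.1), ← mul_assoc, ← Complex.exp_add]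
    push_cast
    ring_nf

theorem hasDerivWithinAt_integral {g : ℝ → ℂ} (hg : ContinuousOn g S.interval) {a t : ℝ}
    (ha : a ∈ S.interval) (ht : t ∈ S.interval) :
    HasDerivWithinAt (fun t => ∫ s in a..t, g s) (g t) S.interval t := by
  have : Fact (t ∈ Set.Icc S.ti S.tf) := ⟨ht⟩
  refine intervalIntegral.integral_hasDerivWithinAt_right
    ((hg.mono (Set.uIcc_subset_Icc ha ht)).intervalIntegrable) (t := S.interval)
    ?_ (hg t ht)
  exact hg.stronglyMeasurableAtFilter_nhdsWithin measurableSet_Icc t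

/-- The terms from differentiating the two integrals cancel, because the kernel is continuous at `s
= t`. -/
theorem hasDerivWithinAt_propagator {f : ℝ → ℂ} (hf : ContinuousOn f S.interval) {t : ℝ}
    (ht : t ∈ S.interval) :
    HasDerivWithinAt (S.propagator f) (Complex.I / (2 * S.freq) *
      (-(Complex.I * S.freq) * Complex.exp (-(Complex.I * S.freq) * t) *
          (∫ s in S.ti..t, Complex.exp (Complex.I * S.freq * s) * f s)
        - (Complex.I * S.freq) * Complex.exp (Complex.I * S.freq * t) *
          (∫ s in S.tf..t, Complex.exp (-(Complex.I * S.freq) * s) * f s))) S.interval t := by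
  have h₁ := hasDerivWithinAt_integral
    ((contDiff_cexp_mul (Complex.I * S.freq) 0).continuous.continuousOn.mul hf) ti_mem ht
  have h₂ := hasDerivWithinAt_integral
    ((contDiff_cexp_mul (-(Complex.I * S.freq)) 0).continuous.continuousOn.mul hf) tf_mem ht
  refine HasDerivWithinAt.congr ?_ (fun s hs => propagator_eq hf hs) (propagator_eq hf ht)
  refine (((((hasDerivAt_cexp_mul (-(Complex.I * S.freq)) t).hasDerivWithinAt).mul h₁).sub
    (((hasDerivAt_cexp_mul (Complex.I * S.freq) t).hasDerivWithinAt).mul h₂)).const_mul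
      (Complex.I / (2 * S.freq))).congr_deriv ?_
  simp only [Pi.mul_apply]
  ring

/-- At the second derivative the integral terms add instead of cancelling: the kernel's derivative
jumps by `-2iω` at `s = t`, and the prefactor `i/2ω` turns the jump into `1`. -/
theorem hasDerivWithinAt_ddt_propagator {f : ℝ → ℂ} (hf : ContinuousOn f S.interval) {t : ℝ}
    (ht : t ∈ S.interval) :
    HasDerivWithinAt (S.ddt (S.propagator f))
      (f t - (S.freq : ℂ) ^ 2 * S.propagator f t) S.interval t := by
  have h₁ := hasDerivWithinAt_integral
    ((contDiff_cexp_mul (Complex.I * S.freq) 0).continuous.continuousOn.mul hf) ti_mem ht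
  have h₂ := hasDerivWithinAt_integral
    ((contDiff_cexp_mul (-(Complex.I * S.freq)) 0).continuous.continuousOn.mul hf) tf_mem ht
  have hd := fun s (hs : s ∈ S.interval) => ddt_eq hs (hasDerivWithinAt_propagator hf hs)
  refine HasDerivWithinAt.congr ?_ hd (hd t ht)
  refine ((((((hasDerivAt_cexp_mul (-(Complex.I * S.freq)) t).hasDerivWithinAt).const_mul
      (-(Complex.I * S.freq))).mul h₁).sub
    ((((hasDerivAt_cexp_mul (Complex.I * S.freq) t).hasDerivWithinAt).const_mul
      (Complex.I * S.freq)).mul h₂)).const_mul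
      (Complex.I / (2 * S.freq))).congr_deriv ?_
  have e : Complex.exp (-(Complex.I * S.freq) * t) * Complex.exp (Complex.I * S.freq * t) = 1 := by
    rw [← Complex.exp_add]; simp
  have e₂ := I_freq_sq (S := S)
  have e₃ : Complex.I / (2 * S.freq) * (Complex.I * S.freq) = -1 / 2 := by
    have := freq_ne_zero (S := S)
    field_simp
    rw [Complex.I_sq]
  rw [propagator_eq hf ht]
  simp only [Pi.mul_apply]
  generalize (∫ s in S.ti..t, Complex.exp (Complex.I * S.freq * s) * f s) = F
  generalize (∫ s in S.tf..t, Complex.exp (-(Complex.I * S.freq) * s) * f s) = G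
  generalize Complex.exp (-(Complex.I * S.freq) * t) = p at *
  generalize Complex.exp (Complex.I * S.freq * t) = m at *
  generalize Complex.I / (2 * S.freq) = k at *
  linear_combination (k * p * F - k * m * G) * e₂ - 2 * p * m * f t * e₃ + f t * e

theorem smoothOn_propagator {f : ℝ → ℂ} (hf : S.SmoothOn f) : S.SmoothOn (S.propagator f) := by
  have hd₁ : DifferentiableOn ℝ (S.propagator f) S.interval := fun t ht =>
    (hasDerivWithinAt_propagator hf.continuousOn ht).differentiableWithinAt
  have hd₂ : DifferentiableOn ℝ (S.ddt (S.propagator f)) S.interval := fun t ht =>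
    (hasDerivWithinAt_ddt_propagator hf.continuousOn ht).differentiableWithinAt
  -- Bootstrap: the second derivative is `f - ω² h(f)`, so it has whatever regularity `h(f)` is
  -- already known to have.
  have step : ∀ n : ℕ, ContDiffOn ℝ n (S.propagator f) S.interval →
      ContDiffOn ℝ (n + 1 : ℕ) (S.ddt (S.propagator f)) S.interval := by
    intro n hn
    rw [Nat.cast_add, Nat.cast_one, contDiffOn_succ_iff_derivWithin S.uniqueDiff]
    refine ⟨hd₂, by simp, ?_⟩
    refine ((hf.of_le (by exact_mod_cast le_top)).sub (contDiffOn_const.mul hn) :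
      ContDiffOn ℝ n (fun t => f t - (S.freq : ℂ) ^ 2 * S.propagator f t) S.interval).congr ?_
    exact fun t ht => ddt_eq ht (hasDerivWithinAt_ddt_propagator hf.continuousOn ht)
  have key : ∀ n : ℕ, ContDiffOn ℝ n (S.propagator f) S.interval := by
    intro n
    induction n with
    | zero => exact contDiffOn_zero.mpr (S.propagator_cont hf.continuousOn).continuousOn
    | succ n ih =>
      rw [Nat.cast_add, Nat.cast_one, contDiffOn_succ_iff_derivWithin S.uniqueDiff]
      exact ⟨hd₁, by simp, (step n ih).of_le (by exact_mod_cast Nat.le_succ n)⟩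
  exact contDiffOn_infty.mpr key

end Oscillator

end OffShellQM

end

/-! ### The propagator as inverse, supports, and exactness of the linear complex. -/

noncomputable section

namespace OffShellQM

namespace Oscillator

variable {S : Oscillator}

theorem oscOp_propagator {f : ℝ → ℂ} (hf : ContinuousOn f S.interval) {t : ℝ}
    (ht : t ∈ S.interval) : S.oscOp (S.propagator f) t = f t := by
  rw [oscOp_apply _ ht, ddt_eq ht (hasDerivWithinAt_ddt_propagator hf ht)]
  ring

/-- At `tᵢ` the integral with base point `tᵢ` is empty and only the `e^{iωt}` part remains, which
`∂₋` kills; at `t_f` the roles are exchanged. -/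
theorem isBdry_propagator {f : ℝ → ℂ} (hf : ContinuousOn f S.interval) :
    S.IsBdry (S.propagator f) := by
  constructor
  · rw [ddt_eq ti_mem (hasDerivWithinAt_propagator hf ti_mem), propagator_eq hf ti_mem,
      intervalIntegral.integral_same]
    ring
  · rw [ddt_eq tf_mem (hasDerivWithinAt_propagator hf tf_mem), propagator_eq hf tf_mem,
      intervalIntegral.integral_same (a := S.tf)]
    ring

theorem ddt_sub {f g : ℝ → ℂ} (hf : S.SmoothOn f) (hg : S.SmoothOn g) {t : ℝ}
    (ht : t ∈ S.interval) : S.ddt (f - g) t = S.ddt f t - S.ddt g t :=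
  ddt_eq ht ((SmoothOn.hasDerivWithinAt hf ht).sub (SmoothOn.hasDerivWithinAt hg ht))

theorem eqOn_of_oscOp_eq {u w : ℝ → ℂ} (hu : S.SmoothOn u) (hw : S.SmoothOn w)
    (hu' : S.IsBdry u) (hw' : S.IsBdry w) (h : ∀ t ∈ S.interval, S.oscOp u t = S.oscOp w t) :
    ∀ t ∈ S.interval, u t = w t := by
  intro t ht
  refine sub_eq_zero.mp (eqOn_zero_of_oscOp_eq_zero (u := u - w) (hu.sub hw) ⟨?_, ?_⟩
    (fun t ht => ?_) t ht)
  · rw [ddt_sub hu hw ti_mem, Pi.sub_apply]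
    linear_combination hu'.1 - hw'.1
  · rw [ddt_sub hu hw tf_mem, Pi.sub_apply]
    linear_combination hu'.2 - hw'.2
  · have := h t ht
    rw [oscOp_apply _ ht, oscOp_apply _ ht] at this
    rw [oscOp_apply _ ht, S.ddt_congr (g := S.ddt u - S.ddt w) (fun s hs => ddt_sub hu hw hs) ht,
      ddt_sub (ddt_contDiffOn hu) (ddt_contDiffOn hw) ht, Pi.sub_apply]
    linear_combination this

theorem propagator_oscOp {u : ℝ → ℂ} (hu : S.SmoothOn u) (hu' : S.IsBdry u) {t : ℝ}
    (ht : t ∈ S.interval) : S.propagator (S.oscOp u) t = u t :=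
  eqOn_of_oscOp_eq (smoothOn_propagator (SmoothOn.oscOp hu)) hu
    (isBdry_propagator (SmoothOn.oscOp hu).continuousOn) hu'
    (fun _ hs => oscOp_propagator (SmoothOn.oscOp hu).continuousOn hs) t ht

theorem pairing_propagator_comm {f g : ℝ → ℂ} (hf : S.SmoothOn f) (hg : S.SmoothOn g) :
    S.pairing f (S.propagator g) = S.pairing g (S.propagator f) := by
  have h := pairing_oscOp_comm (smoothOn_propagator hf) (smoothOn_propagator hg)
    (isBdry_propagator hf.continuousOn) (isBdry_propagator hg.continuousOn)
  rw [pairing_congr (f' := f) (g' := S.propagator g) (fun t ht => by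
      rw [oscOp_propagator hf.continuousOn ht]),
    pairing_congr (f := S.propagator f) (f' := S.propagator f) (g' := g) (fun t ht => by
      rw [oscOp_propagator hg.continuousOn ht])] at h
  rw [h, S.pairing_comm]

section Supports

variable {U U₁ U₂ : ConnOpen S.Space}

theorem image_subset_interval (U : ConnOpen S.Space) : Subtype.val '' U.set ⊆ S.interval := by
  rintro _ ⟨t, _, rfl⟩
  exact t.2

theorem ordConnected_image (U : ConnOpen S.Space) : (Subtype.val '' U.set).OrdConnected :=
  (U.2.2.image _ continuous_subtype_val.continuousOn).ordConnected

theorem ti_mem_image : S.ti ∈ Subtype.val '' U.set ↔ S.initialPt ∈ U.set :=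
  ⟨fun ⟨t, ht, h⟩ => by rwa [show S.initialPt = t from Subtype.ext h.symm], fun h => ⟨_, h, rfl⟩⟩

theorem tf_mem_image : S.tf ∈ Subtype.val '' U.set ↔ S.finalPt ∈ U.set :=
  ⟨fun ⟨t, ht, h⟩ => by rwa [show S.finalPt = t from Subtype.ext h.symm], fun h => ⟨_, h, rfl⟩⟩

theorem eq_zero_of_notMem {f : ℝ → ℂ} (hf : f ∈ S.smooth U) {t : ℝ}
    (ht : t ∉ Subtype.val '' U.set) : f t = 0 :=
  image_eq_zero_of_notMem_tsupport fun h => ht (hf.2 h)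

/-- Before the support of `f`, the propagated function is a negative frequency solution. -/
theorem propagator_of_before {f : ℝ → ℂ} {t : ℝ} (hf : ∀ s ∈ S.interval, s ≤ t → f s = 0) :
    S.propagator f t
      = Complex.I / S.hbar * S.sigmaMinus t * S.pairing f S.sigmaPlus := by
  -- For `t < s` the kernel factorizes as `e^{iωt} e^{-iωs}`, and `2ω/ħ` undoes the squared
  -- amplitude of `σ±`.
  have key : ∀ s ∈ S.interval, Complex.exp (-(Complex.I * S.freq * (|t - s| : ℝ))) * f s
      = 2 * S.freq / S.hbar * S.sigmaMinus t * (f s * S.sigmaPlus s) := by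
    intro s hs
    rcases le_or_gt s t with h | h
    · rw [hf s hs h]; simp
    · have e : Complex.exp (-(Complex.I * S.freq * (|t - s| : ℝ)))
          = Complex.exp (Complex.I * S.freq * t) * Complex.exp (-(Complex.I * S.freq) * s) := by
        rw [abs_of_neg (sub_neg.mpr h), ← Complex.exp_add]
        push_cast
        ring_nf
      rw [e, sigmaPlus_eq, sigmaMinus_eq]
      have h₁ := amplitude_sq (S := S)
      have h₂ := freq_ne_zero (S := S)
      have h₃ := hbar_ne_zero (S := S)
      have h₄ : 2 * S.freq / S.hbar * (S.amplitude * S.amplitude) = 1 := by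
        rw [h₁]; field_simp
      linear_combination (-(Complex.exp (Complex.I * S.freq * t)
        * Complex.exp (-(Complex.I * S.freq) * s) * f s)) * h₄
  rw [propagator, pairing, intervalIntegral.integral_congr (g := fun s =>
    2 * S.freq / S.hbar * S.sigmaMinus t * (f s * S.sigmaPlus s)) (fun s hs => by
      rw [Set.uIcc_of_le S.ti_lt_tf.le] at hs
      exact key s hs), intervalIntegral.integral_const_mul]
  have h₂ := freq_ne_zero (S := S)
  field_simp

/-- After the support of `f`, the propagated function is a positive frequency solution. -/
theorem propagator_of_after {f : ℝ → ℂ} {t : ℝ} (hf : ∀ s ∈ S.interval, t ≤ s → f s = 0) :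
    S.propagator f t
      = Complex.I / S.hbar * S.sigmaPlus t * S.pairing f S.sigmaMinus := by
  have key : ∀ s ∈ S.interval, Complex.exp (-(Complex.I * S.freq * (|t - s| : ℝ))) * f s
      = 2 * S.freq / S.hbar * S.sigmaPlus t * (f s * S.sigmaMinus s) := by
    intro s hs
    rcases le_or_gt t s with h | h
    · rw [hf s hs h]; simp
    · have e : Complex.exp (-(Complex.I * S.freq * (|t - s| : ℝ)))
          = Complex.exp (-(Complex.I * S.freq) * t) * Complex.exp (Complex.I * S.freq * s) := by
        rw [abs_of_pos (sub_pos.mpr h), ← Complex.exp_add]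
        push_cast
        ring_nf
      rw [e, sigmaPlus_eq, sigmaMinus_eq]
      have h₁ := amplitude_sq (S := S)
      have h₂ := freq_ne_zero (S := S)
      have h₃ := hbar_ne_zero (S := S)
      have h₄ : 2 * S.freq / S.hbar * (S.amplitude * S.amplitude) = 1 := by
        rw [h₁]; field_simp
      linear_combination (-(Complex.exp (-(Complex.I * S.freq) * t)
        * Complex.exp (Complex.I * S.freq * s) * f s)) * h₄
  rw [propagator, pairing, intervalIntegral.integral_congr (g := fun s =>
    2 * S.freq / S.hbar * S.sigmaPlus t * (f s * S.sigmaMinus s)) (fun s hs => by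
      rw [Set.uIcc_of_le S.ti_lt_tf.le] at hs
      exact key s hs), intervalIntegral.integral_const_mul]
  have h₂ := freq_ne_zero (S := S)
  field_simp

theorem contraction_apply (f g : S.smooth U) :
    S.contraction U f g = Complex.I * S.hbar * S.pairing f (S.propagator g) := rfl

theorem coeffPlus_apply (f : S.smooth U) : S.coeffPlus U f = S.pairing f S.sigmaMinus := rfl

theorem coeffMinus_apply (f : S.smooth U) : S.coeffMinus U f = S.pairing f S.sigmaPlus := rfl

theorem contraction_comm (f g : S.smooth U) : S.contraction U f g = S.contraction U g f := by
  rw [contraction_apply, contraction_apply, pairing_propagator_comm f.2.1 g.2.1]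

theorem smoothIncl_apply {V : ConnOpen S.Space} (h : U.set ⊆ V.set) (f : S.smooth U) :
    (S.smoothIncl h f : ℝ → ℂ) = f := rfl

theorem contraction_smoothIncl {V : ConnOpen S.Space} (h : U.set ⊆ V.set) (f g : S.smooth U) :
    S.contraction V (S.smoothIncl h f) (S.smoothIncl h g) = S.contraction U f g := rfl

/-- This is `h ∘ d = id` on `C^∞_cp`, read through the symmetric form `C`. It lets `e^{-C}` remove
`Δ` from the differential. -/
theorem contraction_linDifferential (g : S.smoothBdry U) (f : S.smooth U) :
    S.contraction U (S.linDifferential U g) f = Complex.I * S.hbar * S.pairingForm U g f := by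
  rw [contraction_comm, contraction_apply]
  congr 1
  change S.pairing f (S.propagator (S.oscOp g)) = S.pairing g f
  rw [S.pairing_comm g f]
  exact pairing_congr fun t ht => by rw [propagator_oscOp g.2.1.1 g.2.2 ht]

/-- Symmetry of `d` makes the operators `bvLetter U g` commute, and hence gives `δ_BV² = 0`. -/
theorem pairingForm_linDifferential_comm (g k : S.smoothBdry U) :
    S.pairingForm U g (S.linDifferential U k) = S.pairingForm U k (S.linDifferential U g) := by
  change S.pairing g (S.oscOp k) = S.pairing k (S.oscOp g)
  rw [← pairing_oscOp_comm g.2.1.1 k.2.1.1 g.2.2 k.2.2, S.pairing_comm]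

/-- The contraction of a function with a later one. -/
theorem contraction_of_lt {V : ConnOpen S.Space} (h₁ : U₁.set ⊆ V.set) (h₂ : U₂.set ⊆ V.set)
    (h : ∀ t ∈ U₁.set, ∀ s ∈ U₂.set, t < s) (f : S.smooth U₁) (g : S.smooth U₂) :
    S.contraction V (S.smoothIncl h₁ f) (S.smoothIncl h₂ g)
      = -(S.coeffPlus U₁ f * S.coeffMinus U₂ g) := by
  rw [contraction_apply, coeffPlus_apply, coeffMinus_apply, smoothIncl_apply, smoothIncl_apply]
  have key : S.pairing f (S.propagator g)
      = S.pairing f ((Complex.I / S.hbar * S.pairing g S.sigmaPlus) • S.sigmaMinus) := by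
    refine pairing_congr fun t _ => ?_
    by_cases ht : t ∈ Subtype.val '' U₁.set
    · rw [propagator_of_before]
      · simp only [Pi.smul_apply, smul_eq_mul]
        ring
      · intro s _ hst
        refine eq_zero_of_notMem g.2 ?_
        rintro ⟨s, hs, rfl⟩
        obtain ⟨t, ht, rfl⟩ := ht
        exact absurd (h t ht s hs) (not_lt.mpr hst)
    · rw [eq_zero_of_notMem f.2 ht]
      simp
  rw [key, S.pairing_comm, S.pairing_smul_left, S.pairing_comm S.sigmaMinus]
  have h₃ := hbar_ne_zero (S := S)
  field_simp
  rw [Complex.I_sq]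
  ring

theorem pairing_eq_zero_of_disjoint (h : Disjoint U₁.set U₂.set) {f g : ℝ → ℂ}
    (hf : f ∈ S.smooth U₁) (hg : g ∈ S.smooth U₂) : S.pairing f g = 0 := by
  rw [pairing_congr (f' := 0) (g' := 0)]
  · simp [pairing]
  intro t _
  by_cases ht : t ∈ Subtype.val '' U₁.set
  · have : t ∉ Subtype.val '' U₂.set := by
      rintro ⟨s, hs, rfl⟩
      obtain ⟨t, ht, hts⟩ := ht
      rw [Subtype.ext hts] at ht
      exact Set.disjoint_left.mp h ht hs
    rw [eq_zero_of_notMem hg this]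
    simp
  · rw [eq_zero_of_notMem hf ht]
    simp

/-! ### The cohomology of the linear observables -/

theorem linProj_eq_zero_iff (f : S.smooth U) : S.linProj U (S.kind U) f = 0 ↔
    (S.initialPt ∉ U.set → S.coeffMinus U f = 0) ∧ (S.finalPt ∉ U.set → S.coeffPlus U f = 0) := by
  have hop : S.linProj U .op f = 0 ↔ S.coeffMinus U f = 0 ∧ S.coeffPlus U f = 0 := by
    change S.coeffMinus U f • (MvPolynomial.X Ladder.a : Weyl)
      + S.coeffPlus U f • MvPolynomial.X Ladder.adag = 0 ↔ _
    constructor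
    · intro h
      classical
      have h₁ := congrArg (MvPolynomial.coeff (Finsupp.single Ladder.a 1)) h
      have h₂ := congrArg (MvPolynomial.coeff (Finsupp.single Ladder.adag 1)) h
      simpa [MvPolynomial.coeff_X, Finsupp.single_left_inj] using And.intro h₁ h₂
    · rintro ⟨h₁, h₂⟩
      rw [h₁, h₂, zero_smul, zero_smul, add_zero]
  have hket : S.linProj U .ket f = 0 ↔ S.coeffPlus U f = 0 := by
    change S.coeffPlus U f • (Polynomial.X : Ket) = 0 ↔ _
    simp [Polynomial.X_ne_zero]
  have hbra : S.linProj U .bra f = 0 ↔ S.coeffMinus U f = 0 := by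
    change S.coeffMinus U f • (Polynomial.X : Bra) = 0 ↔ _
    simp [Polynomial.X_ne_zero]
  have hfull : S.linProj U .full f = 0 := rfl
  by_cases hi : S.initialPt ∈ U.set <;> by_cases hf : S.finalPt ∈ U.set
  · rw [show S.kind U = .full by simp [kind, hi, hf]]
    simp [hi, hf, hfull]
  · rw [show S.kind U = .ket by simp [kind, hi, hf]]
    simp [hi, hf, hket]
  · rw [show S.kind U = .bra by simp [kind, hi, hf]]
    simp [hi, hf, hbra]
  · rw [show S.kind U = .op by simp [kind, hi, hf]]
    simp [hi, hf, hop]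

/-- Green's identity with a solution leaves only boundary terms. For `σ₊` the one at `t_f` vanishes
since `∂₊` kills both functions there, and the one at `tᵢ` vanishes when `tᵢ ∉ U`, since `g` is zero
near `tᵢ`; for `σ₋` the endpoints are exchanged. -/
theorem coeff_linDifferential (g : S.smoothBdry U) :
    (S.initialPt ∉ U.set → S.coeffMinus U (S.linDifferential U g) = 0) ∧
      (S.finalPt ∉ U.set → S.coeffPlus U (S.linDifferential U g) = 0) := by
  have hz : ∀ {t}, t ∉ Subtype.val '' U.set → (g : ℝ → ℂ) t = 0 ∧ S.ddt g t = 0 := by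
    intro t ht
    exact ⟨eq_zero_of_notMem g.2.1 ht, image_eq_zero_of_notMem_tsupport fun h =>
      ht (g.2.1.2 (S.tsupport_ddt_subset _ h))⟩
  have h₁ := sub_eq_zero.mp g.2.2.1
  have h₂ := eq_neg_of_add_eq_zero_left g.2.2.2
  constructor
  · intro hi
    have hi' := hz (mt ti_mem_image.mp hi)
    have h := pairing_oscOp_sub g.2.1.1 (smoothOn_sigmaPlus (S := S))
    rw [oscOp_sigmaPlus, pairing_zero_right, hi'.1, hi'.2, h₂, ddt_sigmaPlus tf_mem] at h
    rw [coeffMinus_apply]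
    change S.pairing (S.oscOp g) S.sigmaPlus = 0
    linear_combination h
  · intro hf
    have hf' := hz (mt tf_mem_image.mp hf)
    have h := pairing_oscOp_sub g.2.1.1 (smoothOn_sigmaMinus (S := S))
    rw [oscOp_sigmaMinus, pairing_zero_right, hf'.1, hf'.2, h₁, ddt_sigmaMinus ti_mem] at h
    rw [coeffPlus_apply]
    change S.pairing (S.oscOp g) S.sigmaMinus = 0
    linear_combination h

theorem linProj_linDifferential (g : S.smoothBdry U) :
    S.linProj U (S.kind U) (S.linDifferential U g) = 0 :=
  (linProj_eq_zero_iff _).mpr (coeff_linDifferential g)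

theorem linDifferential_injective : Function.Injective (S.linDifferential U) := by
  intro g k hgk
  have h : S.oscOp g = S.oscOp k := congrArg Subtype.val hgk
  ext t
  by_cases ht : t ∈ S.interval
  · exact eqOn_of_oscOp_eq g.2.1.1 k.2.1.1 g.2.2 k.2.2 (fun s _ => congrFun h s) t ht
  · have := fun h => ht (image_subset_interval U h)
    rw [eq_zero_of_notMem g.2.1 this, eq_zero_of_notMem k.2.1 this]

/-- The preimage is `h(f)`, cut off outside `[tᵢ, t_f]`; the issue is its support. Before the
support of `f` it is `f₋` times a multiple of `σ₋`, and after it `f₊` times a multiple of `σ₊`. The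
hypothesis makes these vanish on each side where `U` does not reach the endpoint. -/
theorem exists_linDifferential_eq (f : S.smooth U) (hf : S.linProj U (S.kind U) f = 0) :
    ∃ g, S.linDifferential U g = f := by
  rw [linProj_eq_zero_iff] at hf
  have hs := f.2.1
  set u : ℝ → ℂ := S.interval.indicator (S.propagator f) with hu
  have hup : Set.EqOn u (S.propagator f) S.interval := fun t ht => Set.indicator_of_mem ht _
  have hsu : S.SmoothOn u := (smoothOn_propagator hs).congr hup
  have hosc : S.oscOp u = f := by
    funext t
    by_cases ht : t ∈ S.interval
    · rw [← oscOp_propagator hs.continuousOn ht, oscOp_apply _ ht, oscOp_apply _ ht, hup ht,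
        S.ddt_congr (fun s hs => S.ddt_congr hup hs) ht]
    · rw [eq_zero_of_notMem f.2 fun h => ht (image_subset_interval U h)]
      exact Set.indicator_of_notMem ht _
  have hbd : S.IsBdry u := by
    have := isBdry_propagator hs.continuousOn
    refine ⟨?_, ?_⟩
    · rw [S.ddt_congr hup ti_mem, hup ti_mem]; exact this.1
    · rw [S.ddt_congr hup tf_mem, hup tf_mem]; exact this.2
  have hsupp : tsupport u ⊆ Subtype.val '' U.set := by
    -- The extreme points of the support are used as bounds below, so an empty support is treated
    -- apart.
    rcases (tsupport (f : ℝ → ℂ)).eq_empty_or_nonempty with h0 | hne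
    · have : (f : ℝ → ℂ) = 0 := tsupport_eq_empty_iff.mp h0
      have hu0 : u = 0 := by
        funext t
        simp [hu, this, propagator, Set.indicator_apply]
      simp [hu0]
    have hK : IsCompact (tsupport (f : ℝ → ℂ)) :=
      isCompact_Icc.of_isClosed_subset isClosed_closure (f.2.2.trans (image_subset_interval U))
    obtain ⟨c, hc, hcmin⟩ : ∃ c ∈ Subtype.val '' U.set, ∀ t ∈ S.interval, t < c → u t = 0 := by
      by_cases hi : S.initialPt ∈ U.set
      · exact ⟨S.ti, ti_mem_image.mpr hi, fun t ht htc => absurd ht.1 (not_le.mpr htc)⟩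
      · refine ⟨_, f.2.2 (hK.sInf_mem hne), fun t ht htc => ?_⟩
        have h0 := hf.1 hi
        rw [coeffMinus_apply] at h0
        rw [hup ht, propagator_of_before, h0, mul_zero]
        exact fun s _ hst => image_eq_zero_of_notMem_tsupport fun h =>
          absurd (csInf_le hK.bddBelow h) (not_le.mpr (hst.trans_lt htc))
    obtain ⟨d, hd, hdmax⟩ : ∃ d ∈ Subtype.val '' U.set, ∀ t ∈ S.interval, d < t → u t = 0 := by
      by_cases hi : S.finalPt ∈ U.set
      · exact ⟨S.tf, tf_mem_image.mpr hi, fun t ht htc => absurd ht.2 (not_le.mpr htc)⟩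
      · refine ⟨_, f.2.2 (hK.sSup_mem hne), fun t ht htc => ?_⟩
        have h0 := hf.2 hi
        rw [coeffPlus_apply] at h0
        rw [hup ht, propagator_of_after, h0, mul_zero]
        exact fun s _ hst => image_eq_zero_of_notMem_tsupport fun h =>
          absurd (le_csSup hK.bddAbove h) (not_le.mpr (htc.trans_le hst))
    -- Connectedness of `U` enters here: it contains `c` and `d`, hence all of `[c, d]`.
    refine (closure_minimal (fun t ht => ?_) isClosed_Icc : tsupport u ⊆ Set.Icc c d).trans
      ((ordConnected_image U).out hc hd)
    by_contra hcd
    refine ht ?_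
    by_cases hI : t ∈ S.interval
    · rcases not_and_or.mp hcd with h | h
      · exact hcmin t hI (not_le.mp h)
      · exact hdmax t hI (not_le.mp h)
    · exact Set.indicator_of_notMem hI _
  exact ⟨⟨u, ⟨hsu, hsupp⟩, hbd⟩, Subtype.ext hosc⟩

end Supports

end Oscillator

end OffShellQM

end

/-! ### Sources with prescribed coefficients and a section of the linear projection. -/

noncomputable section

namespace OffShellQM

namespace Oscillator

variable {S : Oscillator} (U : ConnOpen S.Space)

theorem exists_Icc_subset_image : ∃ c d, S.ti < c ∧ c < d ∧ d < S.tf ∧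
    Set.Icc c d ⊆ Subtype.val '' U.set := by
  obtain ⟨O, hO, hOU⟩ := isOpen_induced_iff.mp U.1.2
  obtain ⟨x, hx⟩ := U.2.1
  have hmem : ∀ t ∈ S.interval, t ∈ O → t ∈ Subtype.val '' U.set := fun t ht htO =>
    ⟨⟨t, ht⟩, by
      change (⟨t, ht⟩ : S.Space) ∈ U.1.1
      rw [← hOU]
      exact htO, rfl⟩
  have hxO : (x : ℝ) ∈ O := by
    have : x ∈ U.1.1 := hx
    rw [← hOU] at this
    exact this
  have hcl : (x : ℝ) ∈ closure (Set.Ioo S.ti S.tf) := by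
    rw [closure_Ioo S.ti_lt_tf.ne]
    exact x.2
  obtain ⟨y, hyO, hy⟩ := mem_closure_iff.mp hcl O hO hxO
  obtain ⟨ε, hε, hball⟩ := Metric.isOpen_iff.mp (hO.inter isOpen_Ioo) y ⟨hyO, hy⟩
  have hI : Set.Icc (y - ε / 2) (y + ε / 2) ⊆ O ∩ Set.Ioo S.ti S.tf := by
    refine Set.Subset.trans (fun t ht => ?_) hball
    rw [Metric.mem_ball, Real.dist_eq, abs_lt]
    constructor <;> linarith [ht.1, ht.2]
  refine ⟨y - ε / 2, y + ε / 2, (hI (Set.left_mem_Icc.mpr (by linarith))).2.1, by linarith,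
    (hI (Set.right_mem_Icc.mpr (by linarith))).2.2, fun t ht => ?_⟩
  exact hmem t (Set.Ioo_subset_Icc_self (hI ht).2) (hI ht).1

/-- For a solution `σ`, the equation of motion applied to a function that is `0` at early times and
`σ` at late times. Its pairing with another solution is the Wronskian. -/
theorem exists_mem_smooth_wronskian {σ : ℝ → ℂ} (hσ : ContDiff ℝ ((⊤ : ℕ∞) : WithTop ℕ∞) σ)
    (hσ0 : S.oscOp σ = 0) : ∃ f : S.smooth U, ∀ τ, S.SmoothOn τ → S.oscOp τ = 0 →
      S.pairing f τ = S.ddt σ S.tf * τ S.tf - σ S.tf * S.ddt τ S.tf := by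
  obtain ⟨c, d, hc, hcd, hd, hsub⟩ := exists_Icc_subset_image U
  -- As `χ` is constant outside `[c, d]`, the equation of motion applied to `χσ` vanishes there. In
  -- Green's identity the boundary term at `tᵢ` is zero, and the one at `t_f` is that of `σ` itself.
  set χ : ℝ → ℝ := fun t => Real.smoothTransition ((t - c) / (d - c)) with hχ
  have hχs : ContDiff ℝ ((⊤ : ℕ∞) : WithTop ℕ∞) χ :=
    Real.smoothTransition.contDiff.comp ((contDiff_id.sub contDiff_const).div_const _)
  have h0 : ∀ t ≤ c, χ t = 0 := fun t ht =>
    Real.smoothTransition.zero_of_nonpos (div_nonpos_of_nonpos_of_nonneg (by linarith) (by linarith))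
  have h1 : ∀ t, d ≤ t → χ t = 1 := fun t ht =>
    Real.smoothTransition.one_of_one_le ((one_le_div (by linarith)).mpr (by linarith))
  set w : ℝ → ℂ := fun t => (χ t : ℂ) * σ t with hw
  have hws : S.SmoothOn w :=
    ((Complex.ofRealCLM.contDiff.comp hχs).mul hσ).contDiffOn
  have hw0 : ∀ t < c, w =ᶠ[nhds t] 0 := fun t ht => by
    filter_upwards [Iio_mem_nhds ht] with s hs
    simp [hw, h0 s (le_of_lt hs)]
  have hw1 : ∀ t, d < t → w =ᶠ[nhds t] σ := fun t ht => by
    filter_upwards [Ioi_mem_nhds ht] with s hs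
    simp [hw, h1 s (le_of_lt hs)]
  have hddt : ∀ {f g : ℝ → ℂ} {t : ℝ}, f =ᶠ[nhds t] g → S.ddt f =ᶠ[nhds t] S.ddt g := by
    intro f g t h
    filter_upwards [h.eventuallyEq_nhds] with s hs
    exact (hs.filter_mono nhdsWithin_le_nhds).derivWithin_eq hs.self_of_nhds
  have hosc : ∀ {f g : ℝ → ℂ} {t : ℝ}, f =ᶠ[nhds t] g → S.oscOp f t = S.oscOp g t := by
    intro f g t h
    by_cases ht : t ∈ S.interval
    · rw [oscOp_apply _ ht, oscOp_apply _ ht, h.self_of_nhds, (hddt (hddt h)).self_of_nhds]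
    · rw [oscOp, oscOp, Set.indicator_of_notMem ht, Set.indicator_of_notMem ht]
  have hzero : S.oscOp (0 : ℝ → ℂ) = 0 :=
    oscOp_of_hasDerivAt I_freq_sq fun t => by simp
  refine ⟨⟨S.oscOp w, SmoothOn.oscOp hws, (closure_minimal (fun t ht => ?_) isClosed_Icc :
    tsupport (S.oscOp w) ⊆ Set.Icc c d).trans hsub⟩, fun τ hτ hτ0 => ?_⟩
  · by_contra hI
    refine ht ?_
    rcases not_and_or.mp hI with h | h
    · rw [hosc (hw0 t (not_le.mp h)), hzero]; rfl
    · rw [hosc (hw1 t (not_le.mp h)), hσ0]; rfl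
  · have h := pairing_oscOp_sub hws hτ
    have e₁ : S.ddt w S.ti = 0 := by
      rw [(hddt (hw0 _ hc)).self_of_nhds]
      exact ddt_eq ti_mem (hasDerivWithinAt_const S.ti _ (0 : ℂ))
    rw [hτ0, pairing_zero_right, sub_zero, e₁, (hw0 _ hc).self_of_nhds,
      (hddt (hw1 _ hd)).self_of_nhds, (hw1 _ hd).self_of_nhds] at h
    refine h.trans ?_
    simp

theorem exists_coeffPlus_eq_one : ∃ f : S.smooth U, S.coeffPlus U f = 1 ∧ S.coeffMinus U f = 0 := by
  obtain ⟨f, hf⟩ := exists_mem_smooth_wronskian U (σ := S.sigmaPlus)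
    (by rw [sigmaPlus_eq]; exact contDiff_const.mul (contDiff_cexp_mul _ _)) oscOp_sigmaPlus
  -- The Wronskian of `σ₊` with `σ₋` is `-2iω · ħ/2ω = -iħ`, and with itself it is zero.
  refine ⟨(Complex.I / S.hbar) • f, ?_, ?_⟩
  · rw [map_smul, coeffPlus_apply, hf _ smoothOn_sigmaMinus oscOp_sigmaMinus, ddt_sigmaPlus tf_mem,
      ddt_sigmaMinus tf_mem, smul_eq_mul]
    have h := sigmaPlus_mul_sigmaMinus (S := S) S.tf
    have h₂ := freq_ne_zero (S := S)
    have h₃ := hbar_ne_zero (S := S)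
    have e : Complex.I / S.hbar * (-2 * Complex.I * S.freq * (S.hbar / (2 * S.freq))) = 1 := by
      field_simp
      rw [Complex.I_sq]; ring
    rw [← h] at e
    linear_combination e
  · rw [map_smul, coeffMinus_apply, hf _ smoothOn_sigmaPlus oscOp_sigmaPlus, smul_eq_mul]
    ring

theorem exists_coeffMinus_eq_one :
    ∃ f : S.smooth U, S.coeffPlus U f = 0 ∧ S.coeffMinus U f = 1 := by
  obtain ⟨f, hf⟩ := exists_mem_smooth_wronskian U (σ := S.sigmaMinus)
    (by rw [sigmaMinus_eq]; exact contDiff_const.mul (contDiff_cexp_mul _ _)) oscOp_sigmaMinus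
  refine ⟨(-Complex.I / S.hbar) • f, ?_, ?_⟩
  · rw [map_smul, coeffPlus_apply, hf _ smoothOn_sigmaMinus oscOp_sigmaMinus, smul_eq_mul]
    ring
  · rw [map_smul, coeffMinus_apply, hf _ smoothOn_sigmaPlus oscOp_sigmaPlus, ddt_sigmaPlus tf_mem,
      ddt_sigmaMinus tf_mem, smul_eq_mul]
    have h := sigmaPlus_mul_sigmaMinus (S := S) S.tf
    have h₂ := freq_ne_zero (S := S)
    have h₃ := hbar_ne_zero (S := S)
    have e : Complex.I / S.hbar * (-2 * Complex.I * S.freq * (S.hbar / (2 * S.freq))) = 1 := by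
      field_simp
      rw [Complex.I_sq]; ring
    rw [← h] at e
    linear_combination e

/-- A section of the projection of linear observables, extended to polynomials. -/
theorem exists_section : ∃ (ψ : HSpace (S.kind U) →ₐ[ℂ] SymmetricAlgebra ℂ (S.smooth U))
    (q : S.smooth U →ₗ[ℂ] S.smooth U),
    (∀ x, SymmetricAlgebra.lift (S.linProj U (S.kind U)) (ψ x) = x) ∧
    ∀ f, ψ (S.linProj U (S.kind U) f) = SymmetricAlgebra.ι ℂ _ (q f) ∧
      S.linProj U (S.kind U) (q f) = S.linProj U (S.kind U) f := by
  obtain ⟨p, hp₁, hp₂⟩ := exists_coeffPlus_eq_one U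
  obtain ⟨m, hm₁, hm₂⟩ := exists_coeffMinus_eq_one U
  -- The functions `p` and `m` exist for every `U`; the kind only decides which of them lift the
  -- generators of the target.
  generalize S.kind U = k
  cases k with
  | op =>
    let ψ : Weyl →ₐ[ℂ] SymmetricAlgebra ℂ (S.smooth U) := MvPolynomial.aeval fun i =>
      SymmetricAlgebra.ι ℂ _ (match i with | .a => m | .adag => p)
    let π : S.smooth U →ₗ[ℂ] Weyl := S.linProj U .op
    have hπ : ∀ f, π f = S.coeffMinus U f • (MvPolynomial.X Ladder.a : Weyl)
      + S.coeffPlus U f • MvPolynomial.X Ladder.adag := fun f => rfl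
    have hcomp : (SymmetricAlgebra.lift π).comp ψ = AlgHom.id ℂ Weyl := by
      refine MvPolynomial.algHom_ext fun i => ?_
      cases i <;> simp [ψ, hπ, hp₁, hp₂, hm₁, hm₂]
    refine ⟨ψ, (S.coeffMinus U).smulRight m + (S.coeffPlus U).smulRight p,
      fun x => AlgHom.congr_fun hcomp x, fun f => ⟨?_, ?_⟩⟩
    · change ψ (π f) = _
      rw [hπ]
      simp [ψ]
    · change π _ = π f
      rw [hπ, hπ]
      simp [hp₁, hp₂, hm₁, hm₂]
  | ket =>
    let ψ : Ket →ₐ[ℂ] SymmetricAlgebra ℂ (S.smooth U) :=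
      Polynomial.aeval (SymmetricAlgebra.ι ℂ _ p)
    let π : S.smooth U →ₗ[ℂ] Ket := S.linProj U .ket
    have hπ : ∀ f, π f = S.coeffPlus U f • (Polynomial.X : Ket) := fun f => rfl
    have hcomp : (SymmetricAlgebra.lift π).comp ψ = AlgHom.id ℂ Ket := by
      refine Polynomial.algHom_ext ?_
      simp [ψ, hπ, hp₁]
    refine ⟨ψ, (S.coeffPlus U).smulRight p, fun x => AlgHom.congr_fun hcomp x,
      fun f => ⟨?_, ?_⟩⟩
    · change ψ (π f) = _
      rw [hπ]
      simp [ψ]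
    · change π _ = π f
      rw [hπ, hπ]
      simp [hp₁]
  | bra =>
    let ψ : Bra →ₐ[ℂ] SymmetricAlgebra ℂ (S.smooth U) :=
      Polynomial.aeval (SymmetricAlgebra.ι ℂ _ m)
    let π : S.smooth U →ₗ[ℂ] Bra := S.linProj U .bra
    have hπ : ∀ f, π f = S.coeffMinus U f • (Polynomial.X : Bra) := fun f => rfl
    have hcomp : (SymmetricAlgebra.lift π).comp ψ = AlgHom.id ℂ Bra := by
      refine Polynomial.algHom_ext ?_
      simp [ψ, hπ, hm₂]
    refine ⟨ψ, (S.coeffMinus U).smulRight m, fun x => AlgHom.congr_fun hcomp x,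
      fun f => ⟨?_, ?_⟩⟩
    · change ψ (π f) = _
      rw [hπ]
      simp [ψ]
    · change π _ = π f
      rw [hπ, hπ]
      simp [hm₂]
  | full =>
    let ψ : ℂ →ₐ[ℂ] SymmetricAlgebra ℂ (S.smooth U) := Algebra.ofId _ _
    refine ⟨ψ, 0, fun x => (SymmetricAlgebra.lift (0 : S.smooth U →ₗ[ℂ] ℂ)).commutes x,
      fun f => ⟨?_, rfl⟩⟩
    change ψ 0 = _
    simp

end Oscillator

end OffShellQM

end

noncomputable section

namespace OffShellQM

/-! ### Recursion formulas for canonical quantum mechanics -/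

theorem wick_locNilp (z : Weyl ⊗[ℂ] Weyl) : ∃ n, (wick ^ n) z = 0 :=
  locNilp_tensor _ _ (Or.inl (weylD_locNilp Ladder.a)) z

theorem weylMul_apply (y x : Weyl) :
    weylMul y x = LinearMap.mul' ℂ Weyl (locExp wick wick_locNilp (y ⊗ₜ x)) := rfl

theorem weylD_mul (i : Ladder) (x y : Weyl) : weylD i (x * y) = weylD i x * y + x * weylD i y := by
  change MvPolynomial.pderiv i (x * y) = _
  rw [Derivation.leibniz, smul_eq_mul, smul_eq_mul]
  change _ = MvPolynomial.pderiv i x * y + x * MvPolynomial.pderiv i y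
  ring

theorem weylD_X_self (i : Ladder) : weylD i (MvPolynomial.X i) = 1 :=
  MvPolynomial.pderiv_X_self i

theorem weylD_X_of_ne {i j : Ladder} (h : j ≠ i) : weylD i (MvPolynomial.X j) = 0 :=
  MvPolynomial.pderiv_X_of_ne h

theorem weylD_one (i : Ladder) : weylD i 1 = 0 := MvPolynomial.pderiv_one

theorem weylMul_one_right (y : Weyl) : weylMul y 1 = y := by
  rw [weylMul_apply, locExp_of_apply_eq_zero _ _ (by simp [wick, weylD_one])]
  simp

/-- Since `∂_{a†} c` is the scalar `β`, the commutator of `wick` with `1 ⊗ c` is `β (∂_a ⊗ 1)`,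
which commutes with `wick`; so `locExp_intertwine` applies. The right factor is the earlier
operator, and this is its letter recursion. -/
theorem weylMul_mul_right (y c x : Weyl) (β : ℂ)
    (hc : weylD Ladder.adag c = algebraMap ℂ Weyl β) :
    weylMul y (c * x) = c * weylMul y x + β • weylMul (weylD Ladder.a y) x := by
  have hT := wick_locNilp
  have h₁ := locExp_intertwine wick wick hT hT (LinearMap.lTensor Weyl (LinearMap.mulLeft ℂ c))
    (β • LinearMap.rTensor Weyl (weylD Ladder.a)) (fun z => by
      induction z using TensorProduct.induction_on with
      | zero => simp
      | add z w hz hw => simp only [map_add, hz, hw]; abel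
      | tmul y x =>
        simp only [wick, LinearMap.lTensor_tmul, TensorProduct.map_tmul, LinearMap.mulLeft_apply,
          weylD_mul, hc, LinearMap.smul_apply, LinearMap.rTensor_tmul, ← Algebra.smul_def,
          TensorProduct.tmul_add, TensorProduct.tmul_smul]
        abel) (fun z => by
      induction z using TensorProduct.induction_on with
      | zero => simp
      | add z w hz hw => simp only [map_add, hz, hw]
      | tmul y x => simp [wick]) (y ⊗ₜ x)
  have h₂ := locExp_commute wick wick hT hT (LinearMap.rTensor Weyl (weylD Ladder.a)) (fun z => by
      induction z using TensorProduct.induction_on with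
      | zero => simp
      | add z w hz hw => simp only [map_add, hz, hw]
      | tmul y x => simp [wick]) (y ⊗ₜ x)
  rw [LinearMap.lTensor_tmul, LinearMap.mulLeft_apply] at h₁
  rw [LinearMap.rTensor_tmul] at h₂
  have h₃ : ∀ z, LinearMap.mul' ℂ Weyl (LinearMap.lTensor Weyl (LinearMap.mulLeft ℂ c) z)
      = c * LinearMap.mul' ℂ Weyl z := by
    intro z
    induction z using TensorProduct.induction_on with
    | zero => simp
    | add z w hz hw => simp only [map_add, hz, hw, mul_add]
    | tmul y x => simp [mul_left_comm]
  rw [weylMul_apply, h₁, map_add, h₃, LinearMap.smul_apply, map_smul, ← h₂]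
  rfl

theorem ketAction_monomial (m : Ladder →₀ ℕ) (r : ℂ) (x : Ket) :
    ketAction (MvPolynomial.monomial m r) x
      = r • (Polynomial.X ^ m Ladder.adag * (Polynomial.derivative^[m Ladder.a]) x) := by
  have h : (MvPolynomial.monomial m r : Weyl) = r • MvPolynomial.basisMonomials Ladder ℂ m := by
    simp [MvPolynomial.smul_monomial]
  rw [h, map_smul, ketAction, Module.Basis.constr_basis, LinearMap.smul_apply,
    LinearMap.comp_apply, LinearMap.mulLeft_apply, Module.End.pow_apply]

theorem braAction_monomial (m : Ladder →₀ ℕ) (r : ℂ) (x : Bra) :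
    braAction (MvPolynomial.monomial m r) x
      = r • (Polynomial.X ^ m Ladder.a * (Polynomial.derivative^[m Ladder.adag]) x) := by
  have h : (MvPolynomial.monomial m r : Weyl) = r • MvPolynomial.basisMonomials Ladder ℂ m := by
    simp [MvPolynomial.smul_monomial]
  rw [h, map_smul, braAction, Module.Basis.constr_basis, LinearMap.smul_apply,
    LinearMap.comp_apply, LinearMap.mulLeft_apply, Module.End.pow_apply]

theorem ketAction_C (r : ℂ) (x : Ket) : ketAction (MvPolynomial.C r) x = r • x := by
  simpa using ketAction_monomial 0 r x

theorem braAction_C (r : ℂ) (x : Bra) : braAction (MvPolynomial.C r) x = r • x := by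
  simpa using braAction_monomial 0 r x

theorem ketAction_mul_a (y : Weyl) (x : Ket) :
    ketAction (y * MvPolynomial.X Ladder.a) x = ketAction y (Polynomial.derivative x) := by
  induction y using MvPolynomial.induction_on' with
  | monomial m r =>
    rw [MvPolynomial.X, MvPolynomial.monomial_mul, ketAction_monomial, ketAction_monomial]
    simp
  | add p q hp hq => simp only [add_mul, map_add, LinearMap.add_apply, hp, hq]

theorem ketAction_mul_adag (y : Weyl) (x : Ket) :
    ketAction (y * MvPolynomial.X Ladder.adag) x = Polynomial.X * ketAction y x := by
  induction y using MvPolynomial.induction_on' with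
  | monomial m r =>
    rw [MvPolynomial.X, MvPolynomial.monomial_mul, ketAction_monomial, ketAction_monomial]
    simp [pow_succ', mul_assoc]
  | add p q hp hq => simp only [add_mul, map_add, LinearMap.add_apply, hp, hq, mul_add]

theorem braAction_mul_adag (y : Weyl) (x : Bra) :
    braAction (y * MvPolynomial.X Ladder.adag) x = braAction y (Polynomial.derivative x) := by
  induction y using MvPolynomial.induction_on' with
  | monomial m r =>
    rw [MvPolynomial.X, MvPolynomial.monomial_mul, braAction_monomial, braAction_monomial]
    simp
  | add p q hp hq => simp only [add_mul, map_add, LinearMap.add_apply, hp, hq]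

theorem braAction_mul_a (y : Weyl) (x : Bra) :
    braAction (y * MvPolynomial.X Ladder.a) x = Polynomial.X * braAction y x := by
  induction y using MvPolynomial.induction_on' with
  | monomial m r =>
    rw [MvPolynomial.X, MvPolynomial.monomial_mul, braAction_monomial, braAction_monomial]
    simp [pow_succ', mul_assoc]
  | add p q hp hq => simp only [add_mul, map_add, LinearMap.add_apply, hp, hq, mul_add]

/-- This is `O a† = a† O + ∂O/∂a`, the canonical commutation relation acting on kets. -/
theorem ketAction_X_mul (y : Weyl) (x : Ket) :
    ketAction y (Polynomial.X * x)
      = Polynomial.X * ketAction y x + ketAction (weylD Ladder.a y) x := by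
  induction y using MvPolynomial.induction_on generalizing x with
  | C r =>
    have : weylD Ladder.a (MvPolynomial.C r) = 0 := MvPolynomial.pderiv_C
    rw [ketAction_C, ketAction_C, this]
    simp
  | add p q hp hq => simp only [map_add, LinearMap.add_apply, hp, hq]; ring
  | mul_X p i hp =>
    cases i with
    | a =>
      rw [weylD_mul, weylD_X_self, mul_one, map_add, LinearMap.add_apply, ketAction_mul_a,
        ketAction_mul_a, ketAction_mul_a, Polynomial.derivative_mul, Polynomial.derivative_X,
        one_mul, map_add, hp]
      ring
    | adag =>
      rw [weylD_mul, weylD_X_of_ne (by simp), mul_zero, add_zero, ketAction_mul_adag,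
        ketAction_mul_adag, ketAction_mul_adag, hp]
      ring

/-- The algebra morphism underlying `O ↦ O|0⟩`. -/
def vacuumKet : Weyl →ₐ[ℂ] Ket :=
  MvPolynomial.aeval fun i => match i with | .a => 0 | .adag => Polynomial.X

/-- The algebra morphism underlying `O ↦ ⟨0|O`. -/
def vacuumBra : Weyl →ₐ[ℂ] Bra :=
  MvPolynomial.aeval fun i => match i with | .a => Polynomial.X | .adag => 0

theorem ketAction_one_right (y : Weyl) : ketAction y 1 = vacuumKet y := by
  induction y using MvPolynomial.induction_on with
  | C r => rw [ketAction_C]; simp [vacuumKet, Polynomial.smul_eq_C_mul]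
  | add p q hp hq => simp only [map_add, LinearMap.add_apply, hp, hq]
  | mul_X p i hp =>
    cases i with
    | a => rw [ketAction_mul_a]; simp [vacuumKet]
    | adag => rw [ketAction_mul_adag, hp, map_mul, mul_comm]; simp [vacuumKet]

theorem braAction_one_right (y : Weyl) : braAction y 1 = vacuumBra y := by
  induction y using MvPolynomial.induction_on with
  | C r => rw [braAction_C]; simp [vacuumBra, Polynomial.smul_eq_C_mul]
  | add p q hp hq => simp only [map_add, LinearMap.add_apply, hp, hq]
  | mul_X p i hp =>
    cases i with
    | a => rw [braAction_mul_a, hp, map_mul, mul_comm]; simp [vacuumBra]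
    | adag => rw [braAction_mul_adag]; simp [vacuumBra]

theorem vacuumPart_apply (x : Polynomial ℂ) : vacuumPart x = Polynomial.aeval (0 : ℂ) x := by
  rw [vacuumPart, Polynomial.lcoeff_apply, Polynomial.coeff_zero_eq_eval_zero,
    Polynomial.coe_aeval_eq_eval]

/-- The linear observable `α a + β a†`. -/
def linWeyl (α β : ℂ) : Weyl := α • MvPolynomial.X Ladder.a + β • MvPolynomial.X Ladder.adag

theorem weylD_a_linWeyl (α β : ℂ) : weylD Ladder.a (linWeyl α β) = algebraMap ℂ Weyl α := by
  rw [linWeyl, map_add, map_smul, map_smul, weylD_X_self, weylD_X_of_ne (by simp),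
    Algebra.algebraMap_eq_smul_one, smul_zero, add_zero]

theorem weylD_adag_linWeyl (α β : ℂ) : weylD Ladder.adag (linWeyl α β) = algebraMap ℂ Weyl β := by
  rw [linWeyl, map_add, map_smul, map_smul, weylD_X_self, weylD_X_of_ne (by simp),
    Algebra.algebraMap_eq_smul_one, smul_zero, zero_add]

theorem vacuumKet_linWeyl (α β : ℂ) : vacuumKet (linWeyl α β) = β • Polynomial.X := by
  simp [vacuumKet, linWeyl]

theorem vacuumBra_linWeyl (α β : ℂ) : vacuumBra (linWeyl α β) = α • Polynomial.X := by
  simp [vacuumBra, linWeyl]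

theorem vacuumPart_smul_X (α : ℂ) : vacuumPart (α • Polynomial.X) = 0 := by
  simp [vacuumPart]

theorem braAction_linWeyl_mul (α β : ℂ) (x : Weyl) (y : Bra) :
    braAction (linWeyl α β * x) y
      = (α • Polynomial.X) * braAction x y + β • braAction x (Polynomial.derivative y) := by
  rw [mul_comm, linWeyl, mul_add, mul_smul_comm, mul_smul_comm, map_add, map_smul, map_smul,
    LinearMap.add_apply, LinearMap.smul_apply, LinearMap.smul_apply, braAction_mul_a,
    braAction_mul_adag, smul_mul_assoc]

theorem ketAction_smul_X_mul (β : ℂ) (x : Ket) (y : Weyl) :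
    ketAction y ((β • Polynomial.X) * x)
      = (β • Polynomial.X) * ketAction y x + β • ketAction (weylD Ladder.a y) x := by
  rw [smul_mul_assoc, map_smul, ketAction_X_mul, smul_add, smul_mul_assoc]

theorem weylD_aeval (y : Bra) : weylD Ladder.a (Polynomial.aeval (MvPolynomial.X Ladder.a : Weyl) y)
    = Polynomial.aeval (MvPolynomial.X Ladder.a : Weyl) (Polynomial.derivative y) := by
  change MvPolynomial.pderiv Ladder.a (Polynomial.aeval _ y) = _
  rw [Derivation.map_aeval, MvPolynomial.pderiv_X_self, smul_eq_mul, mul_one]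

theorem braKet_apply (y : Bra) (x : Ket) : braKet y x
    = vacuumPart (ketAction (Polynomial.aeval (MvPolynomial.X Ladder.a : Weyl) y) x) := rfl

/-- The term with factor `0` keeps the shape of the other three recursions: the factor is `linProj`
on the whole interval. -/
theorem braKet_smul_X_mul (β : ℂ) (x : Ket) (y : Bra) :
    braKet y ((β • Polynomial.X) * x)
      = 0 * braKet y x + β • braKet (Polynomial.derivative y) x := by
  rw [braKet_apply, ketAction_smul_X_mul, weylD_aeval, map_add, vacuumPart_apply, map_mul,
    map_smul, Polynomial.aeval_X, smul_zero, zero_mul, map_smul, braKet_apply, zero_mul]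
  rfl

theorem braKet_one_right (y : Bra) : braKet y 1 = vacuumPart y := by
  have h : (Polynomial.aeval (0 : ℂ)).comp (vacuumKet.comp
      (Polynomial.aeval (MvPolynomial.X Ladder.a : Weyl))) = Polynomial.aeval (0 : ℂ) :=
    Polynomial.algHom_ext (by simp [vacuumKet])
  rw [braKet_apply, ketAction_one_right, vacuumPart_apply, vacuumPart_apply]
  exact AlgHom.congr_fun h y

theorem braAction_one_left (y : Bra) : braAction 1 y = y := by
  rw [← map_one MvPolynomial.C, braAction_C, one_smul]

theorem vacuumPart_ketAction_one (x : Weyl) :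
    vacuumPart (ketAction x 1) = ((Polynomial.aeval (0 : ℂ)).comp vacuumKet) x := by
  rw [vacuumPart_apply, ketAction_one_right]
  rfl

/-- The pairs of kinds that occur for an inclusion of intervals. -/
def Kind.Le : Kind → Kind → Prop
  | .op, _ => True
  | .ket, .ket => True
  | .ket, .full => True
  | .bra, .bra => True
  | .bra, .full => True
  | .full, .full => True
  | _, _ => False

/-- The kind of the smallest interval that contains an earlier and a later interval. -/
def Kind.join : Kind → Kind → Kind
  | .op, .op => .op
  | .ket, .op => .ket
  | .op, .bra => .bra
  | _, _ => .full

/-- The inclusion maps are morphisms for the commutative products. -/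
theorem exists_hIncl_eq {k l : Kind} (h : k.Le l) :
    ∃ F : HSpace k →ₐ[ℂ] HSpace l, ∀ x, hIncl k l x = F x :=
  match k, l, h with
  | .op, .op, _ => ⟨AlgHom.id ℂ _, fun _ => rfl⟩
  | .op, .ket, _ => ⟨vacuumKet, ketAction_one_right⟩
  | .op, .bra, _ => ⟨vacuumBra, braAction_one_right⟩
  | .op, .full, _ => ⟨((Polynomial.aeval (0 : ℂ)).comp vacuumKet : Weyl →ₐ[ℂ] ℂ),
      vacuumPart_ketAction_one⟩
  | .ket, .ket, _ => ⟨AlgHom.id ℂ _, fun _ => rfl⟩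
  | .ket, .full, _ => ⟨(Polynomial.aeval (0 : ℂ) : Ket →ₐ[ℂ] ℂ), vacuumPart_apply⟩
  | .bra, .bra, _ => ⟨AlgHom.id ℂ _, fun _ => rfl⟩
  | .bra, .full, _ => ⟨(Polynomial.aeval (0 : ℂ) : Bra →ₐ[ℂ] ℂ), vacuumPart_apply⟩
  | .full, .full, _ => ⟨AlgHom.id ℂ _, fun _ => rfl⟩

/-- The lowering derivation on the space of the later interval. -/
def lateDeriv : ∀ k : Kind, HSpace k →ₗ[ℂ] HSpace k
  | .op => weylD Ladder.a
  | .bra => (Polynomial.derivative : Bra →ₗ[ℂ] Bra)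
  | _ => 0

theorem lateDeriv_mul {k : Kind} (hk : k = .op ∨ k = .bra) (x y : HSpace k) :
    lateDeriv k (x * y) = lateDeriv k x * y + x * lateDeriv k y := by
  rcases hk with rfl | rfl
  · exact weylD_mul Ladder.a x y
  · exact Polynomial.derivative_mul (R := ℂ) (f := x) (g := y)

namespace Oscillator

variable {S : Oscillator} {U V U₁ U₂ : ConnOpen S.Space}

theorem kind_le (h : U.set ⊆ V.set) : (S.kind U).Le (S.kind V) := by
  have hi := @h S.initialPt
  have hf := @h S.finalPt
  unfold kind
  split_ifs <;> simp_all [Kind.Le]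

theorem hIncl_linProj (h : U.set ⊆ V.set) {k l : Kind} (hkl : k.Le l) (f : S.smooth U) :
    hIncl k l (S.linProj U k f) = S.linProj V l (S.smoothIncl h f) :=
  match k, l, hkl with
  | .op, .op, _ => rfl
  | .op, .ket, _ => (ketAction_one_right _).trans (vacuumKet_linWeyl _ _)
  | .op, .bra, _ => (braAction_one_right _).trans (vacuumBra_linWeyl _ _)
  | .op, .full, _ => (congrArg vacuumPart ((ketAction_one_right _).trans
      (vacuumKet_linWeyl _ _))).trans (vacuumPart_smul_X _)
  | .ket, .ket, _ => rfl
  | .ket, .full, _ => vacuumPart_smul_X _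
  | .bra, .bra, _ => rfl
  | .bra, .full, _ => vacuumPart_smul_X _
  | .full, .full, _ => rfl

theorem lateDeriv_linProj {k : Kind} (hk : k = .op ∨ k = .bra) (f : S.smooth U) :
    lateDeriv k (S.linProj U k f) = algebraMap ℂ _ (S.coeffMinus U f) := by
  rcases hk with rfl | rfl
  · exact weylD_a_linWeyl _ _
  · have h : ∀ α : ℂ, Polynomial.derivative (α • Polynomial.X) = algebraMap ℂ Bra α := fun α => by
      simp [Polynomial.smul_eq_C_mul]
    exact h _

theorem hProd_eq {k₁ k₂ : Kind} (l : Kind) (h₁ : k₁ = .op ∨ k₁ = .ket)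
    (h₂ : k₂ = .op ∨ k₂ = .bra) (x : HSpace k₁) (y : HSpace k₂) :
    hProd k₁ k₂ l x y = hIncl (k₁.join k₂) l (hProd k₁ k₂ (k₁.join k₂) x y) := by
  rcases h₁ with rfl | rfl <;> rcases h₂ with rfl | rfl <;> rfl

theorem join_le {k₁ k₂ l : Kind} (h₁ : k₁ = .op ∨ k₁ = .ket) (h₂ : k₂ = .op ∨ k₂ = .bra)
    (hl₁ : k₁.Le l) (hl₂ : k₂.Le l) : (k₁.join k₂).Le l := by
  rcases h₁ with rfl | rfl <;> rcases h₂ with rfl | rfl <;> cases l <;> trivial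

theorem hIncl_hIncl {k l m : Kind} (hkl : k.Le l) (hlm : l.Le m) (x : HSpace k) :
    hIncl l m (hIncl k l x) = hIncl k m x :=
  match k, l, m, hkl, hlm with
  | .op, .op, _, _, _ => rfl
  | .op, .ket, .ket, _, _ => rfl
  | .op, .ket, .full, _, _ => rfl
  | .op, .bra, .bra, _, _ => rfl
  -- The one case that is not definitional: `hIncl` to `.full` is defined through kets. Both routes
  -- extract the constant coefficient.
  | .op, .bra, .full, _, _ => by
    have h : (Polynomial.aeval (0 : ℂ)).comp vacuumBra
        = (Polynomial.aeval (0 : ℂ)).comp vacuumKet :=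
      MvPolynomial.algHom_ext fun i => by cases i <;> simp [vacuumBra, vacuumKet]
    exact (vacuumPart_apply _).trans ((congrArg _ (braAction_one_right x)).trans
      ((AlgHom.congr_fun h x).trans (vacuumPart_ketAction_one x).symm))
  | .op, .full, .full, _, _ => rfl
  | .ket, .ket, _, _, _ => rfl
  | .ket, .full, .full, _, _ => rfl
  | .bra, .bra, _, _, _ => rfl
  | .bra, .full, .full, _, _ => rfl
  | .full, .full, .full, _, _ => rfl

theorem hProd_one_left {k₁ k₂ l : Kind} (h₁ : k₁ = .op ∨ k₁ = .ket) (h₂ : k₂ = .op ∨ k₂ = .bra)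
    (hl₁ : k₁.Le l) (hl₂ : k₂.Le l) (y : HSpace k₂) : hProd k₁ k₂ l 1 y = hIncl k₂ l y := by
  have key : hProd k₁ k₂ (k₁.join k₂) 1 y = hIncl k₂ (k₁.join k₂) y := by
    rcases h₁ with rfl | rfl <;> rcases h₂ with rfl | rfl
    · exact weylMul_one_right y
    · exact braAction_one_left y
    · rfl
    · exact braKet_one_right y
  rw [hProd_eq l h₁ h₂, key, hIncl_hIncl ?_ (join_le h₁ h₂ hl₁ hl₂)]
  rcases h₁ with rfl | rfl <;> rcases h₂ with rfl | rfl <;> trivial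

/-- The on-shell counterpart of `symExp_ι_mul_mul`, uniform in the four kinds of product: a letter
of the earlier interval either stays uncontracted or is contracted with a lowering letter of the
later one. -/
theorem hProd_linProj_mul (h : U₁.set ⊆ V.set) {k₁ k₂ l : Kind} (h₁ : k₁ = .op ∨ k₁ = .ket)
    (h₂ : k₂ = .op ∨ k₂ = .bra) (hl₁ : k₁.Le l) (hl₂ : k₂.Le l) (f : S.smooth U₁)
    (x : HSpace k₁) (y : HSpace k₂) :
    hProd k₁ k₂ l (S.linProj U₁ k₁ f * x) y
      = S.linProj V l (S.smoothIncl h f) * hProd k₁ k₂ l x y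
        + S.coeffPlus U₁ f • hProd k₁ k₂ l x (lateDeriv k₂ y) := by
  have key : hProd k₁ k₂ (k₁.join k₂) (S.linProj U₁ k₁ f * x) y
      = S.linProj U₁ (k₁.join k₂) f * hProd k₁ k₂ (k₁.join k₂) x y
        + S.coeffPlus U₁ f • hProd k₁ k₂ (k₁.join k₂) x (lateDeriv k₂ y) := by
    rcases h₁ with rfl | rfl <;> rcases h₂ with rfl | rfl
    · exact weylMul_mul_right y _ x _ (weylD_adag_linWeyl _ _)
    · exact braAction_linWeyl_mul _ _ x y
    · exact ketAction_smul_X_mul _ x y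
    · exact braKet_smul_X_mul _ x y
  -- Inclusions are morphisms for the commutative products, so the recursion passes from the kind
  -- `k₁.join k₂` to `l`.
  have hj := join_le h₁ h₂ hl₁ hl₂
  obtain ⟨F, hF⟩ := exists_hIncl_eq hj
  rw [hProd_eq l h₁ h₂, key, hProd_eq l h₁ h₂, hProd_eq l h₁ h₂, ← hIncl_linProj h hj, hF, hF, hF,
    hF, map_add, map_mul, map_smul]

end Oscillator

end OffShellQM

end

noncomputable section

namespace OffShellQM

open GSym

namespace Oscillator

variable {S : Oscillator} {U V U₁ U₂ : ConnOpen S.Space}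

/-! ### The quantum projection -/

/-- `C` ignores the odd letters, so its exponential commutes with them and restricts to `symExp` on
even words. -/
theorem expWick_eq (x : S.Obs U) :
    S.expWick U x = evenOp (symExp (S.contraction U)) x := by
  have hwick : S.wickOperator U = evenOp (symContract (S.contraction U)) := rfl
  induction x using odd_induction with
  | even s =>
    rw [evenOp_even]
    refine locExp_commute (-symContract (S.contraction U)) (-S.wickOperator U) _ _
      (even : _ →ₐ[ℂ] S.Obs U).toLinearMap (fun s => ?_) s
    rw [LinearMap.neg_apply, LinearMap.neg_apply, map_neg, hwick]
    exact congrArg _ (evenOp_even _ s)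
  | add x y hx hy => rw [map_add, map_add, hx, hy]
  | odd_mul g x hx =>
    rw [evenOp_odd_mul, ← hx]
    refine locExp_commute (-S.wickOperator U) (-S.wickOperator U) _ _
      (LinearMap.mulLeft ℂ (odd g : S.Obs U)) (fun x => ?_) x
    rw [LinearMap.neg_apply, LinearMap.neg_apply, map_neg, hwick]
    exact congrArg _ (evenOp_odd_mul _ g x)

theorem proj_apply (x : S.Obs U) : S.proj U x
    = GSym.proj (S.linProj U (S.kind U)) (evenOp (symExp (S.contraction U)) x) := by
  rw [← expWick_eq]
  rfl

theorem proj_even (s : SymmetricAlgebra ℂ (S.smooth U)) : S.proj U (even s)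
    = SymmetricAlgebra.lift (S.linProj U (S.kind U)) (symExp (S.contraction U) s) := by
  rw [proj_apply, evenOp_even, GSym.proj_even]

theorem proj_odd_mul (g : S.smoothBdry U) (x : S.Obs U) : S.proj U (odd g * x) = 0 := by
  rw [proj_apply, evenOp_odd_mul, map_mul, proj_odd, zero_mul]

/-- The action of a function of degree `-1` in the BV differential. -/
def bvLetter (U : ConnOpen S.Space) :
    S.smoothBdry U →ₗ[ℂ] Module.End ℂ (SymmetricAlgebra ℂ (S.smooth U)) :=
  LinearMap.mul ℂ (SymmetricAlgebra ℂ (S.smooth U)) ∘ₗ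
    SymmetricAlgebra.ι ℂ (S.smooth U) ∘ₗ S.linDifferential U +
      symDeriv ∘ₗ ((Complex.I * S.hbar) • S.pairingForm U)

theorem bvLetter_apply (g : S.smoothBdry U) (s : SymmetricAlgebra ℂ (S.smooth U)) :
    bvLetter U g s = SymmetricAlgebra.ι ℂ _ (S.linDifferential U g) * s
      + symDeriv ((Complex.I * S.hbar) • S.pairingForm U g) s := rfl

theorem bvDifferential_apply (x : S.Obs U) : S.bvDifferential U x = koszul (bvLetter U) x :=
  (koszul_add _ _ x).symm

theorem contraction_linDifferential_eq (g : S.smoothBdry U) :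
    S.contraction U (S.linDifferential U g) = (Complex.I * S.hbar) • S.pairingForm U g :=
  LinearMap.ext fun f => contraction_linDifferential g f

/-- The operator `e^{-C}` intertwines the BV differential and the classical differential. -/
theorem evenOp_symExp_bvDifferential (x : S.Obs U) :
    evenOp (symExp (S.contraction U)) (S.bvDifferential U x)
      = raise (S.linDifferential U) (evenOp (symExp (S.contraction U)) x) := by
  rw [bvDifferential_apply]
  refine evenOp_koszul _ _ _ (fun g => LinearMap.ext fun s => ?_) x
  -- The derivative created by moving `e^{-C}` past the letter `dg` is along `C(dg, ·) = iħ⟨g, ·⟩`,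
  -- so it cancels the term of `Δ`.
  rw [Module.End.mul_apply, bvLetter_apply, map_add, symExp_ι_mul _ contraction_comm,
    symExp_symDeriv _ contraction_comm, contraction_linDifferential_eq, sub_add_cancel]
  rfl

theorem proj_raise (x : S.Obs U) :
    GSym.proj (S.linProj U (S.kind U)) (raise (S.linDifferential U) x) = 0 := by
  induction x using odd_induction with
  | even s => rw [raise, koszul_even, map_zero]
  | add x y hx hy => rw [map_add, map_add, hx, hy, add_zero]
  | odd_mul g x hx =>
    rw [raise_odd_mul, map_sub, map_mul, map_mul, proj_odd, GSym.proj_even,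
      SymmetricAlgebra.lift_ι_apply, linProj_linDifferential, zero_mul, zero_mul, sub_zero]

theorem proj_bvDifferential (x : S.Obs U) : S.proj U (S.bvDifferential U x) = 0 := by
  rw [proj_apply, evenOp_symExp_bvDifferential, proj_raise]

theorem proj_mem {p : ℤ} {x : S.Obs U} (hx : x ∈ S.obsGrading U p) (hp : p ≠ 0) :
    S.proj U x = 0 := by
  rw [proj_apply]
  exact proj_eq_zero _ hp (evenOp_mem _ hx)

theorem proj_obsIncl (h : U.set ⊆ V.set) (x : S.Obs U) :
    S.proj V (S.obsIncl h x) = hIncl (S.kind U) (S.kind V) (S.proj U x) := by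
  obtain ⟨F, hF⟩ := exists_hIncl_eq (kind_le h)
  rw [proj_apply, proj_apply, obsIncl, evenOp_map _ _ _ _ (symExp_symMap _ _ contraction_comm _
    contraction_comm (contraction_smoothIncl h)), hF]
  generalize evenOp (symExp (S.contraction U)) x = y
  induction y using letter_induction with
  | one => simp only [map_one]
  | add x y hx hy => simp only [map_add, hx, hy]
  | smul c x hx => simp only [map_smul, hx]
  | odd_mul g x hx => simp only [map_mul, map_odd, proj_odd, zero_mul, map_zero]
  | even_mul v x hx =>
    rw [map_mul (GSym.map _ _), map_mul (GSym.proj _), map_mul (GSym.proj _), map_mul F, hx,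
      map_even, GSym.proj_even, GSym.proj_even, symMap_ι, SymmetricAlgebra.lift_ι_apply,
      SymmetricAlgebra.lift_ι_apply, ← hF (S.linProj U _ v), hIncl_linProj h (kind_le h)]

end Oscillator

end OffShellQM

end

noncomputable section

namespace OffShellQM

open GSym

namespace Oscillator

variable {S : Oscillator} {U V U₁ U₂ : ConnOpen S.Space}

/-! ### Products -/

theorem obsIncl_odd (h : U.set ⊆ V.set) (g : S.smoothBdry U) :
    S.obsIncl h (odd g) = odd (S.smoothBdryIncl h g) :=
  map_odd _ _ g

theorem obsIncl_even (h : U.set ⊆ V.set) (s : SymmetricAlgebra ℂ (S.smooth U)) :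
    S.obsIncl h (even s) = even (symMap (S.smoothIncl h) s) :=
  map_even _ _ s

/-- The section `s ↦ e^{C} s` of the projection of words in functions of degree `0`. -/
theorem proj_even_symExp_neg (s : SymmetricAlgebra ℂ (S.smooth U)) :
    S.proj U (even (symExp (-S.contraction U) s))
      = SymmetricAlgebra.lift (S.linProj U (S.kind U)) s := by
  rw [proj_even, symExp_symExp_neg _ contraction_comm]

/-- Both sides are derivations over the lift of `Π₀`, and they agree on letters. So contracting a
letter of the later interval through `f₋` becomes the derivative in `a`. -/
theorem lift_symDeriv_coeffMinus {k : Kind} (hk : k = .op ∨ k = .bra)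
    (t : SymmetricAlgebra ℂ (S.smooth U)) :
    SymmetricAlgebra.lift (S.linProj U k) (symDeriv (S.coeffMinus U) t)
      = lateDeriv k (SymmetricAlgebra.lift (S.linProj U k) t) := by
  induction t using symInduction with
  | one =>
    have h := lateDeriv_mul hk 1 1
    rw [mul_one, mul_one, one_mul, left_eq_add] at h
    rw [symDeriv_one, map_zero, map_one, h]
  | add s t hs ht => simp only [map_add, hs, ht]
  | smul c s hs => simp only [map_smul, hs]
  | ι_mul v s hs =>
    rw [symDeriv_ι_mul, map_add, map_mul, map_mul, hs, map_smul, lateDeriv_mul hk,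
      SymmetricAlgebra.lift_ι_apply, lateDeriv_linProj hk, Algebra.smul_def, add_comm]

theorem kind_of_before (h : ∀ t ∈ U₁.set, ∀ s ∈ U₂.set, t < s) :
    S.kind U₁ = .op ∨ S.kind U₁ = .ket := by
  have hf : S.finalPt ∉ U₁.set := fun hf => by
    obtain ⟨s, hs⟩ := U₂.2.1
    exact absurd (h _ hf s hs) (not_lt.mpr s.2.2)
  unfold kind
  split_ifs <;> simp

theorem kind_of_after (h : ∀ t ∈ U₁.set, ∀ s ∈ U₂.set, t < s) :
    S.kind U₂ = .op ∨ S.kind U₂ = .bra := by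
  have hi : S.initialPt ∉ U₂.set := fun hi => by
    obtain ⟨t, ht⟩ := U₁.2.1
    exact absurd (h t ht _ hi) (not_lt.mpr t.2.1)
  unfold kind
  split_ifs <;> simp

theorem neg_contraction_comm (f g : S.smooth U) :
    (-S.contraction U) f g = (-S.contraction U) g f :=
  congrArg Neg.neg (contraction_comm f g)

/-- The operator `e^{-C}` applied to a product of normal ordered words of an earlier and a later
interval: the recursion in the letters of the earlier one. -/
theorem symExp_ι_mul_mul (h₁ : U₁.set ⊆ V.set) (h₂ : U₂.set ⊆ V.set)
    (h : ∀ t ∈ U₁.set, ∀ s ∈ U₂.set, t < s) (v : S.smooth U₁)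
    (s : SymmetricAlgebra ℂ (S.smooth U₁)) (t : SymmetricAlgebra ℂ (S.smooth U₂)) :
    symExp (S.contraction V)
        (symMap (S.smoothIncl h₁) (symExp (-S.contraction U₁) (SymmetricAlgebra.ι ℂ _ v * s))
          * symMap (S.smoothIncl h₂) (symExp (-S.contraction U₂) t))
      = SymmetricAlgebra.ι ℂ _ (S.smoothIncl h₁ v) * symExp (S.contraction V)
          (symMap (S.smoothIncl h₁) (symExp (-S.contraction U₁) s)
            * symMap (S.smoothIncl h₂) (symExp (-S.contraction U₂) t))
        + S.coeffPlus U₁ v • symExp (S.contraction V)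
          (symMap (S.smoothIncl h₁) (symExp (-S.contraction U₁) s)
            * symMap (S.smoothIncl h₂)
              (symExp (-S.contraction U₂) (symDeriv (S.coeffMinus U₂) t))) := by
  have e₁ : S.contraction U₁ v
      = S.contraction V (S.smoothIncl h₁ v) ∘ₗ S.smoothIncl h₁ := rfl
  -- Contracting `v` with later letters only sees their coefficient `f₋`.
  have e₂ : S.contraction V (S.smoothIncl h₁ v) ∘ₗ S.smoothIncl h₂
      = (-S.coeffPlus U₁ v) • S.coeffMinus U₂ := by
    ext g
    exact (contraction_of_lt h₁ h₂ h v g).trans (neg_mul _ _).symm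
  have e₃ := symDeriv_symMap (S.smoothIncl h₂) (S.contraction V (S.smoothIncl h₁ v))
    (symExp (-S.contraction U₂) t)
  rw [e₂, map_smul, LinearMap.smul_apply, ← symExp_symDeriv _ neg_contraction_comm,
    map_smul (symMap (S.smoothIncl h₂))] at e₃
  rw [symExp_ι_mul _ neg_contraction_comm, LinearMap.neg_apply, map_neg, LinearMap.neg_apply,
    sub_neg_eq_add, map_add, map_mul (symMap (S.smoothIncl h₁)), symMap_ι, e₁, ← symDeriv_symMap]
  generalize symMap (S.smoothIncl h₁) (symExp (-S.contraction U₁) s) = X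
  generalize S.smoothIncl h₁ v = w at *
  -- The derivative of the earlier factor is completed to that of the whole product, which `e^{-C}`
  -- on `V` then absorbs. What remains is minus the contraction with the later factor.
  have e₄ : (SymmetricAlgebra.ι ℂ _ w * X + symDeriv (S.contraction V w) X)
        * symMap (S.smoothIncl h₂) (symExp (-S.contraction U₂) t)
      = SymmetricAlgebra.ι ℂ _ w * (X * symMap (S.smoothIncl h₂) (symExp (-S.contraction U₂) t))
        + symDeriv (S.contraction V w)
          (X * symMap (S.smoothIncl h₂) (symExp (-S.contraction U₂) t))
        - X * symDeriv (S.contraction V w)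
          (symMap (S.smoothIncl h₂) (symExp (-S.contraction U₂) t)) := by
    rw [symDeriv_mul]
    ring
  rw [e₄, map_sub, map_add, symExp_ι_mul _ contraction_comm, symExp_symDeriv _ contraction_comm,
    sub_add_cancel, e₃, mul_smul_comm, map_smul, neg_smul, sub_neg_eq_add]

/-- Stated for words of the form `e^{C} s`, whose own contractions are removed by `Π`; `t` is
generalized because the recursion also calls on its derivative. -/
theorem proj_mul_even (h₁ : U₁.set ⊆ V.set) (h₂ : U₂.set ⊆ V.set)
    (h : ∀ t ∈ U₁.set, ∀ s ∈ U₂.set, t < s)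
    (s : SymmetricAlgebra ℂ (S.smooth U₁)) (t : SymmetricAlgebra ℂ (S.smooth U₂)) :
    S.proj V (S.obsIncl h₁ (even (symExp (-S.contraction U₁) s))
        * S.obsIncl h₂ (even (symExp (-S.contraction U₂) t)))
      = hProd (S.kind U₁) (S.kind U₂) (S.kind V)
        (S.proj U₁ (even (symExp (-S.contraction U₁) s)))
        (S.proj U₂ (even (symExp (-S.contraction U₂) t))) := by
  have k₁ := kind_of_before h
  have k₂ := kind_of_after h
  have hl₁ := kind_le h₁
  have hl₂ := kind_le h₂
  induction s using symInduction generalizing t with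
  | one =>
    rw [proj_even_symExp_neg 1, map_one (SymmetricAlgebra.lift _), hProd_one_left k₁ k₂ hl₁ hl₂,
      symExp_one, map_one, map_one, one_mul, proj_obsIncl]
  | add a b ha hb => simp only [map_add, add_mul, ha, hb, LinearMap.add_apply]
  | smul c a ha =>
    simp only [map_smul, smul_mul_assoc, ha, LinearMap.smul_apply]
  | ι_mul v a ha =>
    have ha₁ := ha t
    have ha₂ := ha (symDeriv (S.coeffMinus U₂) t)
    simp only [obsIncl_even, ← map_mul] at ha₁ ha₂ ⊢
    rw [proj_even, proj_even_symExp_neg, proj_even_symExp_neg] at ha₁ ha₂ ⊢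
    rw [symExp_ι_mul_mul h₁ h₂ h, map_add, map_mul, map_smul, ha₁, ha₂,
      SymmetricAlgebra.lift_ι_apply, map_mul, SymmetricAlgebra.lift_ι_apply,
      hProd_linProj_mul h₁ k₁ k₂ hl₁ hl₂, lift_symDeriv_coeffMinus k₂]

theorem proj_obsIncl_mul (h₁ : U₁.set ⊆ V.set) (h₂ : U₂.set ⊆ V.set)
    (h : ∀ t ∈ U₁.set, ∀ s ∈ U₂.set, t < s) (x : S.Obs U₁) (y : S.Obs U₂) :
    S.proj V (S.obsIncl h₁ x * S.obsIncl h₂ y)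
      = hProd (S.kind U₁) (S.kind U₂) (S.kind V) (S.proj U₁ x) (S.proj U₂ y) := by
  induction x using odd_induction with
  | add x x' hx hx' => simp only [map_add, add_mul, hx, hx', LinearMap.add_apply]
  | odd_mul g x hx =>
    rw [proj_odd_mul, map_zero, LinearMap.zero_apply, map_mul (S.obsIncl h₁), obsIncl_odd, mul_assoc,
      proj_odd_mul]
  | even s =>
    induction y using odd_induction with
    | add y y' hy hy' => simp only [map_add, mul_add, hy, hy']
    | odd_mul g y hy =>
      rw [proj_odd_mul, map_zero, map_mul (S.obsIncl h₂), obsIncl_odd, obsIncl_even, ← mul_assoc,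
        even_commute, mul_assoc, proj_odd_mul]
    -- Every even word has the form `e^{C} s`, as `e^{-C}` is invertible.
    | even t =>
      have e := proj_mul_even h₁ h₂ h (symExp (S.contraction U₁) s) (symExp (S.contraction U₂) t)
      rwa [symExp_neg_symExp _ contraction_comm, symExp_neg_symExp _ contraction_comm] at e

/-- `Π` kills every word with an odd letter, and even words are central. This handles the products
whose first interval is the later one. -/
theorem proj_mul_comm (x y : S.Obs U) : S.proj U (x * y) = S.proj U (y * x) := by
  induction x using odd_induction with
  | even s => rw [even_commute]
  | add x x' hx hx' => rw [add_mul, mul_add, map_add, map_add, hx, hx']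
  | odd_mul g x hx =>
    clear hx
    rw [mul_assoc, proj_odd_mul]
    induction y using odd_induction with
    | even s => rw [even_commute, mul_assoc, proj_odd_mul]
    | add y y' hy hy' => rw [add_mul, map_add, ← hy, ← hy', add_zero]
    | odd_mul e y _ => rw [mul_assoc, proj_odd_mul]

/-- Disjoint order-connected sets cannot interleave, so a single pair of points decides their order.
-/
theorem lt_or_lt_of_disjoint (h : Disjoint U₁.set U₂.set) :
    (∀ t ∈ U₁.set, ∀ s ∈ U₂.set, t < s) ∨ ∀ s ∈ U₂.set, ∀ t ∈ U₁.set, s < t := by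
  have main : ∀ {A B : ConnOpen S.Space}, Disjoint A.set B.set → ∀ a ∈ A.set, ∀ b ∈ B.set, a < b →
      ∀ t ∈ A.set, ∀ s ∈ B.set, t < s := by
    intro A B hAB a ha b hb hab t ht s hs
    have hA := A.2.2.ordConnected
    have hB := B.2.2.ordConnected
    have htb : t < b := lt_of_not_ge fun hbt =>
      Set.disjoint_left.mp hAB (hA.out ha ht ⟨hab.le, hbt⟩) hb
    exact lt_of_not_ge fun hst => Set.disjoint_left.mp hAB ht (hB.out hs hb ⟨hst, htb.le⟩)
  obtain ⟨a, ha⟩ := U₁.2.1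
  obtain ⟨b, hb⟩ := U₂.2.1
  rcases lt_trichotomy a b with hab | rfl | hab
  · exact Or.inl (main h a ha b hb hab)
  · exact absurd hb (Set.disjoint_left.mp h ha)
  · exact Or.inr (main h.symm b hb a ha hab)

theorem heisenberg_prod_of_lt (h : Disjoint U₁.set U₂.set) (h₁ : U₁.set ⊆ V.set)
    (h₂ : U₂.set ⊆ V.set) (hlt : ∀ t ∈ U₁.set, ∀ s ∈ U₂.set, t < s) :
    S.heisenberg.prod U₁ U₂ V h h₁ h₂ = hProd (S.kind U₁) (S.kind U₂) (S.kind V) :=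
  if_pos hlt

theorem heisenberg_prod_of_gt (h : Disjoint U₁.set U₂.set) (h₁ : U₁.set ⊆ V.set)
    (h₂ : U₂.set ⊆ V.set) (hlt : ∀ s ∈ U₂.set, ∀ t ∈ U₁.set, s < t) :
    S.heisenberg.prod U₁ U₂ V h h₁ h₂ = (hProd (S.kind U₂) (S.kind U₁) (S.kind V)).flip := by
  refine if_neg fun h' => ?_
  obtain ⟨a, ha⟩ := U₁.2.1
  obtain ⟨b, hb⟩ := U₂.2.1
  exact lt_asymm (h' a ha b hb) (hlt b hb a ha)

theorem isMorphism_proj : PrefactorizationData.IsMorphism S.offShell S.heisenberg S.proj where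
  degree U p x hx := by
    change S.proj U x ∈ (if p = 0 then ⊤ else ⊥ : Submodule ℂ (HSpace (S.kind U)))
    split_ifs with hp
    · trivial
    · exact (Submodule.mem_bot ℂ).mpr (proj_mem hx hp)
  chain U x := proj_bvDifferential x
  incl U V h x := proj_obsIncl h x
  prod U₁ U₂ V h h₁ h₂ x y := by
    rcases lt_or_lt_of_disjoint h with hlt | hlt
    · rw [heisenberg_prod_of_lt h h₁ h₂ hlt]
      exact proj_obsIncl_mul h₁ h₂ hlt x y
    · rw [heisenberg_prod_of_gt h h₁ h₂ hlt]
      exact (proj_mul_comm _ _).trans (proj_obsIncl_mul h₂ h₁ hlt y x)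

end Oscillator

end OffShellQM

end

noncomputable section

namespace OffShellQM

open GSym

namespace Oscillator

variable {S : Oscillator} {U V U₁ U₂ : ConnOpen S.Space}

/-! ### Off-shell quantum mechanics -/

/-- Multiplications commute and so do derivatives; the cross terms are `iħ⟨g, dg'⟩` and `iħ⟨g',
dg⟩`, equal by the symmetry of `d`. -/
theorem bvLetter_comm (g g' : S.smoothBdry U) :
    bvLetter U g * bvLetter U g' = bvLetter U g' * bvLetter U g := by
  ext s
  rw [Module.End.mul_apply, Module.End.mul_apply]
  simp only [bvLetter_apply, map_add, symDeriv_ι_mul, LinearMap.smul_apply]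
  rw [pairingForm_linDifferential_comm g g', symDeriv_comm, mul_left_comm]
  abel

theorem bvDifferential_bvDifferential (x : S.Obs U) :
    S.bvDifferential U (S.bvDifferential U x) = 0 := by
  rw [bvDifferential_apply, bvDifferential_apply, koszul_koszul _ bvLetter_comm]

theorem bvDifferential_mem {p : ℤ} {x : S.Obs U} (hx : x ∈ S.obsGrading U p) :
    S.bvDifferential U x ∈ S.obsGrading U (p + 1) := by
  rw [bvDifferential_apply]
  exact koszul_mem _ hx

theorem isBVAlgebra (U : ConnOpen S.Space) :
    IsBVAlgebra (S.obsGrading U) (S.bvDifferential U) where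
  decomposition := isInternal_grading
  one_mem := by
    have h := even_mem (E := S.smoothBdry U) (1 : SymmetricAlgebra ℂ (S.smooth U))
    rwa [map_one] at h
  mul_mem _ _ _ hx _ hy := GSym.mul_mem hx hy
  graded_comm _ _ _ hx _ hy := GSym.graded_comm hx hy
  degree_one _ _ hx := bvDifferential_mem hx
  square_zero := bvDifferential_bvDifferential
  second_order p q x hx y hy z := by
    simp only [bvDifferential_apply]
    refine koszul_second_order (bvLetter U)
      (fun g => symDeriv ((Complex.I * S.hbar) • S.pairingForm U g)) (fun g => symDeriv_mul _)
      (fun g => SymmetricAlgebra.ι ℂ _ (S.linDifferential U g))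
      (fun g s => (bvLetter_apply g s).trans (add_comm _ _))
      (fun v => (Complex.I * S.hbar) • (S.pairingForm U).flip v) (fun v g => ?_) hx hy z
    exact symDeriv_ι _ v

theorem bvDifferential_obsIncl (h : U.set ⊆ V.set) (x : S.Obs U) :
    S.bvDifferential V (S.obsIncl h x) = S.obsIncl h (S.bvDifferential U x) := by
  rw [bvDifferential_apply, bvDifferential_apply]
  refine koszul_map _ _ _ _ (fun g s => ?_) x
  rw [bvLetter_apply, bvLetter_apply, map_add, map_mul, symMap_ι, symDeriv_symMap]
  rfl

/-- Functions with disjoint supports pair to zero, so `Δ` creates no contraction between the two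
intervals. This is why the product is a chain map although `δ_BV` is not a derivation. -/
theorem bvLetter_mul_symMap (h : Disjoint U₁.set U₂.set) (h₁ : U₁.set ⊆ V.set)
    (h₂ : U₂.set ⊆ V.set) (g : S.smoothBdry U₁) (s : SymmetricAlgebra ℂ (S.smooth V))
    (t : SymmetricAlgebra ℂ (S.smooth U₂)) :
    bvLetter V (S.smoothBdryIncl h₁ g) (s * symMap (S.smoothIncl h₂) t)
      = bvLetter V (S.smoothBdryIncl h₁ g) s * symMap (S.smoothIncl h₂) t := by
  have e : ((Complex.I * S.hbar) • S.pairingForm V (S.smoothBdryIncl h₁ g))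
      ∘ₗ S.smoothIncl h₂ = 0 := by
    ext f
    have h0 : S.pairingForm V (S.smoothBdryIncl h₁ g) (S.smoothIncl h₂ f) = 0 :=
      pairing_eq_zero_of_disjoint h g.2.1 f.2
    rw [LinearMap.comp_apply, LinearMap.smul_apply, h0, smul_zero, LinearMap.zero_apply]
  rw [bvLetter_apply, bvLetter_apply, symDeriv_mul, symDeriv_symMap, e, map_zero,
    LinearMap.zero_apply, map_zero]
  ring

theorem bvDifferential_mul (h : Disjoint U₁.set U₂.set) (h₁ : U₁.set ⊆ V.set)
    (h₂ : U₂.set ⊆ V.set) {p : ℤ} {x : S.Obs U₁} (hx : x ∈ S.obsGrading U₁ p) (y : S.Obs U₂) :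
    S.bvDifferential V (S.obsIncl h₁ x * S.obsIncl h₂ y)
      = S.obsIncl h₁ (S.bvDifferential U₁ x) * S.obsIncl h₂ y
        + ((-1 : ℂ) ^ p) • (S.obsIncl h₁ x * S.obsIncl h₂ (S.bvDifferential U₂ y)) := by
  rw [← bvDifferential_obsIncl h₁, ← bvDifferential_obsIncl h₂, bvDifferential_apply,
    bvDifferential_apply, bvDifferential_apply]
  refine (koszul_map_mul_map _ _ _ _ _ (bvLetter_mul_symMap h h₁ h₂)
    (bvLetter_mul_symMap h.symm h₂ h₁) x y).trans (congrArg _ ?_)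
  rw [parity_eq (map_mem _ _ hx)]
  exact smul_mul_assoc _ _ _

theorem obsIncl_obsIncl {W : ConnOpen S.Space} (h : U.set ⊆ V.set) (h' : V.set ⊆ W.set)
    (x : S.Obs U) : S.obsIncl h' (S.obsIncl h x) = S.obsIncl (h.trans h') x :=
  map_map _ _ _ _ x

theorem obsIncl_mul {W : ConnOpen S.Space} (h₁ : U₁.set ⊆ V.set) (h₂ : U₂.set ⊆ V.set)
    (h : V.set ⊆ W.set) (x : S.Obs U₁) (y : S.Obs U₂) :
    S.obsIncl h (S.obsIncl h₁ x * S.obsIncl h₂ y)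
      = S.obsIncl (h₁.trans h) x * S.obsIncl (h₂.trans h) y := by
  rw [map_mul (S.obsIncl h), obsIncl_obsIncl h₁ h, obsIncl_obsIncl h₂ h]

theorem isPrefactorizationAlgebra_offShell : S.offShell.IsPrefactorizationAlgebra where
  decomposition _ := isInternal_grading
  d_degree _ _ _ hx := bvDifferential_mem hx
  d_d _ x := bvDifferential_bvDifferential x
  incl_degree _ _ _ _ _ hx := map_mem _ _ hx
  incl_d _ _ h x := bvDifferential_obsIncl h x
  prod_degree _ _ _ _ _ _ _ _ _ hx _ hy := GSym.mul_mem (map_mem _ _ hx) (map_mem _ _ hy)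
  prod_d _ _ _ h h₁ h₂ _ _ hx y := bvDifferential_mul h h₁ h₂ hx y
  incl_id _ x := map_id x
  incl_incl _ _ _ h h' x := obsIncl_obsIncl h h' x
  incl_prod _ _ _ _ _ h₁ h₂ h' x y := obsIncl_mul h₁ h₂ h' x y
  prod_incl _ _ _ _ _ _ h₁ h₂ k₁ k₂ x y :=
    congrArg₂ (fun a b => a * b) (obsIncl_obsIncl h₁ k₁ x) (obsIncl_obsIncl h₂ k₂ y)
  assoc _ _ _ _ _ _ _ _ _ _ _ a₁ a₂ b₂ b₃ c₁ c₂ x y z :=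
    (congrArg (· * S.obsIncl (b₃.trans c₂) z) (obsIncl_mul a₁ a₂ c₁ x y)).trans
      ((mul_assoc _ _ _).trans
        (congrArg (S.obsIncl (a₁.trans c₁) x * ·) (obsIncl_mul b₂ b₃ c₂ y z).symm))
  comm _ _ _ _ _ _ _ _ _ hx _ hy := GSym.graded_comm (map_mem _ _ hx) (map_mem _ _ hy)

end Oscillator

end OffShellQM

end

/-! ### Descent of the axioms to the on-shell side, and the cohomology. -/

noncomputable section

namespace OffShellQM

open GSym

/-- The grading of a vector space that is concentrated in degree `0`. -/
theorem isInternal_concentrated (A : Type) [AddCommGroup A] [Module ℂ A] :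
    DirectSum.IsInternal fun p : ℤ => if p = 0 then (⊤ : Submodule ℂ A) else ⊥ := by
  rw [DirectSum.isInternal_submodule_iff_iSupIndep_and_iSup_eq_top]
  refine ⟨fun p => ?_, eq_top_iff.mpr (le_iSup_of_le 0 (by simp))⟩
  by_cases hp : p = 0
  · have h : ⨆ (q : ℤ) (_ : q ≠ p), (if q = 0 then (⊤ : Submodule ℂ A) else ⊥) = ⊥ := by
      simp only [iSup_eq_bot]
      intro q hq
      rw [if_neg (hp ▸ hq)]
    rw [h]
    exact disjoint_bot_right
  · simp [hp]

/-- The image of a prefactorization algebra under a surjective morphism is one, if it is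
concentrated in degree `0`. -/
theorem PrefactorizationData.IsMorphism.isPrefactorizationAlgebra {X : Type} [TopologicalSpace X]
    {F G : PrefactorizationData X} {R : ∀ U, F.obj U →ₗ[ℂ] G.obj U}
    (hR : PrefactorizationData.IsMorphism F G R) (hF : F.IsPrefactorizationAlgebra)
    (hs : ∀ U z, ∃ x ∈ F.gr U 0, R U x = z) (hd : ∀ U x, G.d U x = 0)
    (hgr : ∀ U (p : ℤ), G.gr U p = if p = 0 then ⊤ else ⊥) : G.IsPrefactorizationAlgebra := by
  have eq_zero : ∀ {U : ConnOpen X} {p : ℤ}, p ≠ 0 → ∀ {x}, x ∈ G.gr U p → x = 0 := by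
    intro U p hp x hx
    rwa [hgr, if_neg hp, Submodule.mem_bot] at hx
  have mem : ∀ {U : ConnOpen X} {p : ℤ} {x : G.obj U}, (p ≠ 0 → x = 0) → x ∈ G.gr U p := by
    intro U p x h
    rw [hgr]
    split_ifs with hp
    · trivial
    · exact (Submodule.mem_bot ℂ).mpr (h hp)
  refine
    { decomposition := fun U => by
        rw [funext (hgr U)]
        exact isInternal_concentrated (G.obj U)
      d_degree := fun U p x _ => by rw [hd]; exact zero_mem _
      d_d := fun U x => hd U _
      incl_degree := fun U V h p x hx => mem fun hp => by
        rw [eq_zero hp hx, map_zero]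
      incl_d := fun U V h x => by rw [hd, hd, map_zero]
      prod_degree := fun U₁ U₂ V h h₁ h₂ p q x hx y hy => mem fun hpq => ?_
      prod_d := fun U₁ U₂ V h h₁ h₂ p x _ y => ?_
      incl_id := fun U x => ?_
      incl_incl := fun U V W h h' x => ?_
      incl_prod := fun U₁ U₂ V W h h₁ h₂ h' x y => ?_
      prod_incl := fun U₁ U₂ V₁ V₂ W h h₁ h₂ k₁ k₂ x y => ?_
      assoc := fun U₁ U₂ U₃ V₁ V₂ W h₁₂ h₂₃ h₁₃ k₁ k₂ a₁ a₂ b₂ b₃ c₁ c₂ x y z => ?_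
      comm := fun U₁ U₂ V h h₁ h₂ p q x hx y hy => ?_ }
  · by_cases hp : p = 0
    · rw [eq_zero (fun hq => hpq (by rw [hp, hq, add_zero])) hy, map_zero]
    · rw [eq_zero hp hx, map_zero, LinearMap.zero_apply]
  · rw [hd, hd, hd, map_zero, map_zero, LinearMap.zero_apply, smul_zero, add_zero]
  · obtain ⟨x, -, rfl⟩ := hs U x
    rw [← hR.incl, hF.incl_id]
  · obtain ⟨x, -, rfl⟩ := hs U x
    rw [← hR.incl, ← hR.incl, ← hR.incl, hF.incl_incl]
  · obtain ⟨x, -, rfl⟩ := hs U₁ x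
    obtain ⟨y, -, rfl⟩ := hs U₂ y
    rw [← hR.prod, ← hR.prod, ← hR.incl, hF.incl_prod]
  · obtain ⟨x, -, rfl⟩ := hs U₁ x
    obtain ⟨y, -, rfl⟩ := hs U₂ y
    rw [← hR.incl, ← hR.incl, ← hR.prod, ← hR.prod, hF.prod_incl]
  · obtain ⟨x, -, rfl⟩ := hs U₁ x
    obtain ⟨y, -, rfl⟩ := hs U₂ y
    obtain ⟨z, -, rfl⟩ := hs U₃ z
    rw [← hR.prod, ← hR.prod, ← hR.prod, ← hR.prod,
      hF.assoc U₁ U₂ U₃ V₁ V₂ W h₁₂ h₂₃ h₁₃ k₁ k₂ a₁ a₂ b₂ b₃ c₁ c₂]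
  · by_cases hp : p = 0
    · by_cases hq : q = 0
      · subst hp hq
        clear hx hy
        -- Here the preimages must have degree `0`, because the commutativity being transported
        -- concerns homogeneous elements.
        obtain ⟨x, hx, rfl⟩ := hs U₁ x
        obtain ⟨y, hy, rfl⟩ := hs U₂ y
        rw [← hR.prod, ← hR.prod, hF.comm U₁ U₂ V h h₁ h₂ 0 0 x hx y hy, map_smul]
      · rw [eq_zero hq hy, map_zero, map_zero, LinearMap.zero_apply, smul_zero]
    · rw [eq_zero hp hx, map_zero, map_zero, LinearMap.zero_apply, smul_zero]

namespace Oscillator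

variable {S : Oscillator} {U V U₁ U₂ : ConnOpen S.Space}

theorem exists_proj_eq (z : HSpace (S.kind U)) : ∃ x ∈ S.obsGrading U 0, S.proj U x = z := by
  obtain ⟨ψ, q, hψ, -⟩ := exists_section U
  exact ⟨even (symExp (-S.contraction U) (ψ z)), even_mem _, by
    rw [proj_even_symExp_neg, hψ]⟩

theorem proj_surjective (U : ConnOpen S.Space) : Function.Surjective (S.proj U) := fun z => by
  obtain ⟨x, -, hx⟩ := exists_proj_eq z
  exact ⟨x, hx⟩

/-! ### Canonical quantum mechanics -/

theorem isPrefactorizationAlgebra_heisenberg : S.heisenberg.IsPrefactorizationAlgebra :=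
  isMorphism_proj.isPrefactorizationAlgebra isPrefactorizationAlgebra_offShell
    (fun _ z => exists_proj_eq z) (fun _ _ => rfl) fun _ _ => rfl

/-! ### Cohomology -/

/-- A contraction of the complex of linear observables onto its cohomology. -/
theorem exists_linear_contraction (U : ConnOpen S.Space) :
    ∃ (ψ : HSpace (S.kind U) →ₐ[ℂ] SymmetricAlgebra ℂ (S.smooth U))
      (h : S.smooth U →ₗ[ℂ] S.smoothBdry U),
      (∀ f, ψ (S.linProj U (S.kind U) f)
        = SymmetricAlgebra.ι ℂ _ (f - S.linDifferential U (h f))) ∧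
      ∀ g, h (S.linDifferential U g) = g := by
  obtain ⟨ψ, q, -, hq⟩ := exists_section U
  obtain ⟨r, hr⟩ := (S.linDifferential U).exists_leftInverse_of_injective
    (LinearMap.ker_eq_bot.mpr linDifferential_injective)
  have hr' : ∀ g, r (S.linDifferential U g) = g := fun g => LinearMap.congr_fun hr g
  have hq0 : ∀ g, q (S.linDifferential U g) = 0 := fun g => by
    have e := (hq (S.linDifferential U g)).1
    rw [linProj_linDifferential, map_zero] at e
    -- Injectivity of `ι` on `q (dg)`: the derivative along `l` recovers the value of `l` from a
    -- letter.
    refine (Module.forall_dual_apply_eq_zero_iff ℂ _).mp fun l => ?_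
    have e' := symDeriv_ι l (q (S.linDifferential U g))
    rwa [← e, map_zero, eq_comm, SymmetricAlgebra.algebraMap_eq_zero_iff] at e'
  have hd : ∀ f, S.linDifferential U (r (f - q f)) = f - q f := fun f => by
    obtain ⟨g, hg⟩ := exists_linDifferential_eq (f - q f)
      (by rw [map_sub, (hq f).2, sub_self])
    rw [← hg, hr']
  -- `q` projects onto the chosen representatives of the cohomology and kills the image of `d`,
  -- while `f - q f` is always exact. Hence `id - q` is the projection onto the image of `d`, where
  -- `r` inverts `d`.
  refine ⟨ψ, r ∘ₗ (LinearMap.id - q), fun f => ?_, fun g => ?_⟩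
  · rw [(hq f).1, LinearMap.comp_apply, LinearMap.sub_apply, LinearMap.id_apply, hd,
      sub_sub_cancel]
  · rw [LinearMap.comp_apply, LinearMap.sub_apply, LinearMap.id_apply, hq0, sub_zero, hr']

/-- Conjugation by `e^{-C}` turns the claim into acyclicity of the classical Koszul complex on the
kernel of `Π₀`. -/
theorem exists_eq_bvDifferential (x : S.Obs U) (hx : S.bvDifferential U x = 0)
    (hp : S.proj U x = 0) : ∃ v, x = S.bvDifferential U v := by
  obtain ⟨ψ, h, hψ, hd⟩ := exists_linear_contraction U
  have e : ∀ y : S.Obs U, evenOp (symExp (-S.contraction U))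
      (evenOp (symExp (S.contraction U)) y) = y := fun y => by
    rw [evenOp_evenOp, show symExp (-S.contraction U) * symExp (S.contraction U) = 1 from
      LinearMap.ext fun s => symExp_neg_symExp _ contraction_comm s, evenOp, TensorProduct.map_one]
    rfl
  have e' : ∀ y : S.Obs U, evenOp (symExp (S.contraction U))
      (evenOp (symExp (-S.contraction U)) y) = y := fun y => by
    rw [evenOp_evenOp, show symExp (S.contraction U) * symExp (-S.contraction U) = 1 from
      LinearMap.ext fun s => symExp_symExp_neg _ contraction_comm s, evenOp, TensorProduct.map_one]
    rfl
  obtain ⟨v, hv⟩ := exists_eq_raise hd _ ψ hψ (evenOp (symExp (S.contraction U)) x)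
    (by rw [← evenOp_symExp_bvDifferential, hx, map_zero]) (by rw [← proj_apply, hp])
  refine ⟨evenOp (symExp (-S.contraction U)) v, ?_⟩
  rw [← e x, hv, ← e (S.bvDifferential U _), evenOp_symExp_bvDifferential, e']

theorem isQuasiIsomorphism_proj :
    PrefactorizationData.IsQuasiIsomorphism S.offShell S.heisenberg S.proj := by
  refine ⟨isMorphism_proj, fun U p x hx hdx => ?_, fun U p z hz _ => ?_⟩
  · rintro ⟨w, -, hw⟩
    -- The target has zero differential, so `hw` says that `Π x = 0`.
    obtain ⟨v, rfl⟩ := exists_eq_bvDifferential x hdx hw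
    exact exists_homogeneous_primitive (S.obsGrading U) isInternal_grading (S.bvDifferential U)
      (fun _ _ h => bvDifferential_mem h) hx
  · by_cases hp : p = 0
    · subst hp
      obtain ⟨x, hx, rfl⟩ := exists_proj_eq z
      refine ⟨x, hx, ?_, 0, zero_mem _, ?_⟩
      -- Every element of degree `0` is closed, since there is nothing in degree `1`.
      · have h : S.bvDifferential U x ∈ grading (S.smoothBdry U) (S.smooth U) (0 + 1) :=
          bvDifferential_mem hx
        rw [grading_eq_bot (by norm_num)] at h
        exact (Submodule.mem_bot ℂ).mp h
      · exact (add_zero _).symm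
    · refine ⟨0, zero_mem _, map_zero _, 0, zero_mem _, ?_⟩
      have h : ∀ y : HSpace (S.kind U), y ∈ (if p = 0 then ⊤ else ⊥ : Submodule ℂ _) → y = 0 :=
        fun y hy => by rwa [if_neg hp, Submodule.mem_bot] at hy
      exact (h z hz).trans ((add_zero _).symm.trans (congrArg (· + 0) (map_zero (S.proj U)).symm))

end Oscillator

end OffShellQM

end

theorem mainTheorem2 (S : OffShellQM.Oscillator) :
    (∀ U : OffShellQM.ConnOpen S.Space,
      OffShellQM.IsBVAlgebra (S.obsGrading U) (S.bvDifferential U)) ∧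
    S.offShell.IsPrefactorizationAlgebra ∧
    S.heisenberg.IsPrefactorizationAlgebra ∧
    OffShellQM.PrefactorizationData.IsMorphism S.offShell S.heisenberg S.proj ∧
    (∀ U : OffShellQM.ConnOpen S.Space, Function.Surjective (S.proj U)) ∧
    OffShellQM.PrefactorizationData.IsQuasiIsomorphism S.offShell S.heisenberg S.proj :=
  ⟨OffShellQM.Oscillator.isBVAlgebra, OffShellQM.Oscillator.isPrefactorizationAlgebra_offShell,
    OffShellQM.Oscillator.isPrefactorizationAlgebra_heisenberg,
    OffShellQM.Oscillator.isMorphism_proj, OffShellQM.Oscillator.proj_surjective,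
    OffShellQM.Oscillator.isQuasiIsomorphism_proj⟩
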